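/- **Proposition 1.** *Model.* Let $n\to\infty$ be the sample size and $p\to\infty$ the dimension, along a sequence of pairs $(n,p)$; all other quantities may depend on the pair, except the constants named below. One observes $$\mathbf y_t=\boldsymbol\mu+\sqrt p\,\xi_t\,\boldsymbol\Sigma_0^{1/2}\mathbf u_t\in\mathbb R^p,\qquad t=1,\dots,n,$$ where $\boldsymbol\mu\in\mathbb R^p$ and the $p\times p$ positive semidefinite matrix $\boldsymbol\Sigma_0$ are deterministic, $\operatorname{tr}\boldsymbol\Sigma_0=p$, the $\mathbf u_t$ are i.i.d. uniform on the unit sphere of $\mathbb R^p$, the scalars $\xi_t\ge 0$ are i.i.d., and $(\xi_t)$ is independent of $(\mathbf u_t)$. Let $\lambda_{0;1}\ge\dots\ge\lambda_{0;p}$ be the eigenvalues of $\boldsymbol\Sigma_0$. Assume: 1. there are constants $0<c<C<\infty$ and $0<\varepsilon<2$ with $E(\xi_t^{2+\varepsilon})<C$ and $P(|\xi_t|>c)=1$; 2. there are constants $0<c'<C'<\infty$ with $c'<(\boldsymbol\Sigma_0)_{ii}<C'$ for $1\le i\le p$; 3. there are a constant $K\in\mathbb N$, $K\le p$, and a constant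 $\delta>0$ with $\delta p\le\lambda_{0;i}\le p/\delta$ for $i=1,\dots,K$ and $\delta\le\lambda_{0;i}\le1/\delta$ for $i=K+1,\dots,p$. *Estimators.* Let $\Psi_H(x)=\min(H,\max(-H,x))$, where $H>0$ satisfies $H\to\infty$ and $H=O(\sqrt{n/\log p})$, and let $\widehat{\boldsymbol\mu}$ be any solution of $\sum_{t=1}^n\Psi_H(y_{i,t}-\widehat\mu_i)=0$, $i=1,\dots,p$. Let $\widehat{\boldsymbol\Gamma}$ be a $p\times K$ matrix whose columns are orthonormal eigenvectors for the $K$ largest eigenvalues of the spatial Kendall's tau matrix $$\frac{2}{n(n-1)}\sum_{i<i'}\frac{(\mathbf y_i-\mathbf y_{i'})(\mathbf y_i-\mathbf y_{i'})^T}{\|\mathbf y_i-\mathbf y_{i'}\|_2^2},$$ and let $\widehat{\mathbf P}_I$ be a $(p-K)\times p$ matrix with $\widehat{\mathbf P}_I\widehat{\boldsymbol\Gamma}=\mathbf 0$ and $\widehat{\mathbf P}_I\widehat{\mathbf P}_I^T=\mathbf I_{p-K}$. Put $$\widehat{\mathbf X}_t=\sqrt p\,\frac{\mathbf y_t-\widehat{\boldsymbol\mu}}{\|\widehat{\mathbf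 P}_I(\mathbf y_t-\widehat{\boldsymbol\mu})\|_2},\qquad \widehat\eta=\frac{p}{\operatorname{tr}\big(\frac1n\sum_{t=1}^n\widehat{\mathbf X}_t\widehat{\mathbf X}_t^T\big)},\qquad \widehat\xi_t=\frac{\|\widehat{\mathbf P}_I(\mathbf y_t-\widehat{\boldsymbol\mu})\|_2}{\sqrt{p\,\widehat\eta}}.$$ *Claim.* If $(\log p)^{2+\gamma}=o(n)$ for some $\gamma>0$ and $\log n=O(\log p)$, then there is a constant $c_1>0$ such that $$P\Big(\min_{1\le t\le n}\widehat\xi_t>c_1\Big)\to1,$$ and $$\frac1n\sum_{t=1}^n\Big(\frac{\xi_t^2}{\widehat\xi_t^2}-1\Big)^2=O_p\Big(\frac{\log p}{p}+\frac{\log p}{n}\Big).$$ -/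

import Mathlib

open MeasureTheory ProbabilityTheory Filter Asymptotics
open scoped Topology Matrix

noncomputable section

/-- The Euclidean norm of a coordinate vector. -/
def l2norm {m : ℕ} (v : Fin m → ℝ) : ℝ := ‖WithLp.toLp 2 v‖

/-- The uniform distribution on the unit sphere of `ℝᵖ`: surface measure, normalised to mass one. -/
def uniformSphere (p : ℕ) : Measure (EuclideanSpace ℝ (Fin p)) :=
  let S : Measure (Metric.sphere (0 : EuclideanSpace ℝ (Fin p)) 1) :=
    (volume : Measure (EuclideanSpace ℝ (Fin p))).toSphere
  ((S Set.univ)⁻¹ • S).map Subtype.val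

/-- `R` is the principal (positive semidefinite) square root of `S`. -/
def IsPSDSqrt {p : ℕ} (R S : Matrix (Fin p) (Fin p) ℝ) : Prop :=
  R.PosSemidef ∧ R * R = S

/-- The scalars `ξ_t` and the directions `u_t` that drive an elliptical sample of size `n` in
dimension `p`: the `ξ_t` are nonnegative, independent and identically distributed, the `u_t` are
independent and uniform on the unit sphere, and the two families are independent. -/
structure IsEllipticalDriver {n p : ℕ} {Ω : Type*} [MeasurableSpace Ω] (P : Measure Ω)
    (ξ : Fin n → Ω → ℝ) (u : Fin n → Ω → EuclideanSpace ℝ (Fin p)) : Prop where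
  measurable_scalar : ∀ t, Measurable (ξ t)
  measurable_direction : ∀ t, Measurable (u t)
  scalar_nonneg : ∀ t, ∀ᵐ ω ∂P, 0 ≤ ξ t ω
  scalar_indep : iIndepFun ξ P
  scalar_identDistrib : ∀ s t, IdentDistrib (ξ s) (ξ t) P P
  direction_indep : iIndepFun u P
  direction_law : ∀ t, P.map (u t) = uniformSphere p
  scalar_indep_direction : IndepFun (fun ω t => ξ t ω) (fun ω t => u t ω) P

/-- The elliptical observation `y = μ + √p ξ R u`, where `R` is a square root of the scatter
matrix. -/
def ellipticalObs {p : ℕ} (μ : Fin p → ℝ) (R : Matrix (Fin p) (Fin p) ℝ) (ξ : ℝ)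
    (u : EuclideanSpace ℝ (Fin p)) : Fin p → ℝ :=
  μ + (√(p : ℝ) * ξ) • (R *ᵥ u.ofLp)

/-- Eigenvalues in decreasing order: the first `K` are of exact order `p`, the others of exact
order one, with the constant `δ`. (`eigenvalues₀` is Mathlib's decreasing enumeration, from `0`.) -/
def HasFactorStructure {p : ℕ} {S : Matrix (Fin p) (Fin p) ℝ} (hS : S.IsHermitian)
    (K : ℕ) (δ : ℝ) : Prop :=
  ∀ i : Fin (Fintype.card (Fin p)),
    ((i : ℕ) < K → δ * p ≤ hS.eigenvalues₀ i ∧ hS.eigenvalues₀ i ≤ p / δ) ∧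
    (K ≤ (i : ℕ) → δ ≤ hS.eigenvalues₀ i ∧ hS.eigenvalues₀ i ≤ 1 / δ)

/-- The Huber function. -/
def huberPsi (H x : ℝ) : ℝ := min H (max (-H) x)

/-- `m` is a coordinatewise Huber location estimate from the observations `y`. -/
def IsHuberLocation {n p : ℕ} (H : ℝ) (y : Fin n → Fin p → ℝ) (m : Fin p → ℝ) : Prop :=
  ∀ i, ∑ t, huberPsi H (y t i - m i) = 0

/-- The spatial Kendall's tau matrix of the observations `y`. -/
def kendallTau {n p : ℕ} (y : Fin n → Fin p → ℝ) : Matrix (Fin p) (Fin p) ℝ :=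
  (2 / ((n : ℝ) * ((n : ℝ) - 1))) •
    ∑ s : Fin n, ∑ t ∈ Finset.Ioi s,
      (1 / l2norm (y s - y t) ^ 2) • Matrix.vecMulVec (y s - y t) (y s - y t)

theorem kendallTau_isHermitian {n p : ℕ} (y : Fin n → Fin p → ℝ) :
    (kendallTau y).IsHermitian := by
  ext i j
  simp [kendallTau, Matrix.sum_apply, Matrix.vecMulVec_apply, mul_comm]

/-- The columns of `G` are orthonormal, and column `j` is an eigenvector of `A` for the `j`-th
largest eigenvalue of `A` (counted with multiplicity). -/
def IsLeadingEigenvectors {p K : ℕ} {A : Matrix (Fin p) (Fin p) ℝ} (hA : A.IsHermitian)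
    (G : Matrix (Fin p) (Fin K) ℝ) : Prop :=
  Gᵀ * G = 1 ∧
  ∀ (j : Fin K) (i : Fin (Fintype.card (Fin p))), (i : ℕ) = (j : ℕ) →
    A *ᵥ G.col j = hA.eigenvalues₀ i • G.col j

/-- The rows of `Q` are an orthonormal basis of the orthogonal complement of the columns of `G`. -/
def IsNullProjection {p K : ℕ} (G : Matrix (Fin p) (Fin K) ℝ)
    (Q : Matrix (Fin (p - K)) (Fin p) ℝ) : Prop :=
  Q * G = 0 ∧ Q * Qᵀ = 1

/-- `m`, `G`, `Q` are outcomes of the location step and of the projection step computed from the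
observations `y`, with `K` factors and tuning parameter `H`. -/
structure IsIPSNFit {n p : ℕ} (K : ℕ) (H : ℝ) (y : Fin n → Fin p → ℝ) (m : Fin p → ℝ)
    (G : Matrix (Fin p) (Fin K) ℝ) (Q : Matrix (Fin (p - K)) (Fin p) ℝ) : Prop where
  location : IsHuberLocation H y m
  leading : IsLeadingEigenvectors (kendallTau_isHermitian y) G
  null : IsNullProjection G Q

/-- The idiosyncratic-projected self-normalised observations. -/
def ipsnX {n p q : ℕ} (y : Fin n → Fin p → ℝ) (m : Fin p → ℝ) (Q : Matrix (Fin q) (Fin p) ℝ)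
    (t : Fin n) : Fin p → ℝ :=
  (√(p : ℝ) / l2norm (Q *ᵥ (y t - m))) • (y t - m)

/-- The factor that gives the scatter estimate `(η / n) ∑ X_t X_tᵀ` trace `p`. -/
def ipsnEta {n p q : ℕ} (y : Fin n → Fin p → ℝ) (m : Fin p → ℝ)
    (Q : Matrix (Fin q) (Fin p) ℝ) : ℝ :=
  (p : ℝ) / Matrix.trace
    ((1 / (n : ℝ)) • ∑ t, Matrix.vecMulVec (ipsnX y m Q t) (ipsnX y m Q t))

/-- The estimate of `ξ_t`. The factor `p` under the root makes the scatter estimate equal to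
`(1 / n) ∑ (y_t - m) (y_t - m)ᵀ / ξ̂_t²`. -/
def ipsnScale {n p q : ℕ} (y : Fin n → Fin p → ℝ) (m : Fin p → ℝ)
    (Q : Matrix (Fin q) (Fin p) ℝ) (t : Fin n) : ℝ :=
  l2norm (Q *ᵥ (y t - m)) / √((p : ℝ) * ipsnEta y m Q)

/-- The events `A k` have probability tending to one. It is stated as `P (Aᶜ) → 0`, which is the
same as `P A → 1` when `A` is measurable, and is the stronger of the two for outer measure. -/
def HighProbability {Ω : ℕ → Type*} [∀ k, MeasurableSpace (Ω k)] (P : ∀ k, Measure (Ω k))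
    (A : ∀ k, Set (Ω k)) : Prop :=
  Tendsto (fun k => P k (A k)ᶜ) atTop (𝓝 0)

/-- `X k = O_p(r k)`. -/
def IsBigOInProbability {Ω : ℕ → Type*} [∀ k, MeasurableSpace (Ω k)] (P : ∀ k, Measure (Ω k))
    (X : ∀ k, Ω k → ℝ) (r : ℕ → ℝ) : Prop :=
  ∀ τ : ℝ, 0 < τ → ∃ M : ℝ, 0 < M ∧
    ∀ᶠ k in atTop, P k {ω | M * r k < |X k ω|} ≤ ENNReal.ofReal τ

end

/-!
Standardise the residuals: with `x_t = R u_t + (μ - m) / (√p ξ_t)` one has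
`y_t - m = √p ξ_t x_t`, and the definitions of the estimators give `ξ̂_t² = ξ_t² d_t q`, where
`d_t = ‖Q x_t‖²` and `q` is the average of `‖x_s‖² / d_s` (`ipsnScale_eq`). The scalars `ξ_t` cancel
inside `d_t` and `q` up to the location error, so it suffices that `d_t` is close in mean square to
the constant `τ`, the bulk trace divided by `p`, and that `‖x_t‖²` averages to about one; then `q` is
close to `1 / τ` (`average_inv_mul_sub_one_sq_le`). Since `d_t ≤ ‖x_t‖²`, always `q ≥ 1`, and a lower
bound on `d_t` bounds `ξ̂_t` below.

Three errors enter.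

* Location. The score equation is monotone, the scores are symmetric because `u_t` and `-u_t` have
  the same law, and a Chernoff bound with the truncation `H = O(√(n / log p))` shows that all the
  coordinates of the Huber estimate are within `O(√(log p / n))` of the centre
  (`measure_huber_deviation_le`). After division by `√p ξ_t ≥ √p c` this is an error of norm
  `O(√(log p / n))` in `x_t`.

* Factor space. In an eigenbasis of the scatter matrix, an entry of the Kendall matrix is an average
  over pairs of a kernel that depends only on the direction of `ξ_s u_s - ξ_t u_t`. This direction is
  rotation invariant on the sphere, so reflections show that the mean matrix is diagonal; its top
  entries are at least a constant and its bulk entries are `O(1 / p)`. One kernel has Frobenius norm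
  at most one, so the variance of the average over pairs, summed over *all* entries, is `O(1 / n)`
  without any loss in the dimension (`integral_sum_kendall_sub_mean_sq_le`). A one-sided Davis-Kahan
  argument (`leakage_le`) bounds by `O(1 / n)` the squared mass that the estimated factor space has
  outside the true one. The top part of `R u_t` has squared length `O(log p)` uniformly in `t`, by a
  sub-Gaussian bound for the coordinates of `u_t` and `log n = O(log p)`, so the projection leaves of
  it only `O(log p / n)` (`abs_projNorm_sq_sub_le`).

* Fluctuation of quadratic forms in `u_t`. Squared coordinates on the sphere are negatively
  correlated, so the bulk form has variance `O(1 / p)`, and the average over `t` of the full form,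
  whose variance is `O(1)`, has variance `O(1 / n)`.

`ipsnScale_bounds` is the deterministic conclusion on the event that all these errors are small, and
`measure_inaccurate_le` bounds the probability of the complement. What is needed about the uniform
law on the sphere (second and fourth moments, a sub-Gaussian bound, a lower bound for the first
absolute moment) follows from rotation invariance alone.
-/

/-! ### Rotation invariant laws on the unit sphere -/

/-- `ν` is carried by the unit sphere of `ℝᵖ` and invariant under every linear isometry. -/
structure IsRotationInvariant {p : ℕ} (ν : Measure (EuclideanSpace ℝ (Fin p))) : Prop where
  map_eq : ∀ O : EuclideanSpace ℝ (Fin p) ≃ₗᵢ[ℝ] EuclideanSpace ℝ (Fin p), ν.map O = ν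
  norm_eq_one : ∀ᵐ x ∂ν, ‖x‖ = 1

namespace IsRotationInvariant

variable {p : ℕ} {ν : Measure (EuclideanSpace ℝ (Fin p))}

theorem integrable [IsFiniteMeasure ν] (hν : IsRotationInvariant ν)
    {f : EuclideanSpace ℝ (Fin p) → ℝ} (hf : Continuous f) : Integrable f ν := by
  obtain ⟨C, hC⟩ := (isCompact_closedBall (0 : EuclideanSpace ℝ (Fin p)) 1).exists_bound_of_continuousOn
    hf.continuousOn
  refine Integrable.of_bound hf.aestronglyMeasurable C ?_
  filter_upwards [hν.norm_eq_one] with x hx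
  exact hC x (by simp [hx])

theorem integral_comp (hν : IsRotationInvariant ν)
    (O : EuclideanSpace ℝ (Fin p) ≃ₗᵢ[ℝ] EuclideanSpace ℝ (Fin p))
    (f : EuclideanSpace ℝ (Fin p) → ℝ) : ∫ x, f (O x) ∂ν = ∫ x, f x ∂ν := by
  conv_rhs => rw [← hν.map_eq O]
  exact (integral_map_equiv O.toHomeomorph.toMeasurableEquiv f).symm

/-- The law of a coordinate depends only on the length of the direction: a reflection carries one
direction to the other. -/
theorem integral_inner_eq (hν : IsRotationInvariant ν) {a b : EuclideanSpace ℝ (Fin p)}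
    (hab : ‖a‖ = ‖b‖) (f : ℝ → ℝ) : ∫ x, f (inner ℝ a x) ∂ν = ∫ x, f (inner ℝ b x) ∂ν := by
  set O := Submodule.reflection (Submodule.span ℝ {a - b})ᗮ
  have h1 : O a = b := Submodule.reflection_sub hab
  rw [← hν.integral_comp O (fun x => f (inner ℝ b x))]
  refine integral_congr_ae (ae_of_all _ fun x => ?_)
  simp only
  rw [← h1, O.inner_map_map]

theorem integral_inner_sq [IsProbabilityMeasure ν] (hν : IsRotationInvariant ν)
    {a : EuclideanSpace ℝ (Fin p)} (ha : ‖a‖ = 1) :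
    ∫ x, (inner ℝ a x) ^ 2 ∂ν = 1 / p := by
  let b := EuclideanSpace.basisFun (Fin p) ℝ
  have h1 : ∀ i, ∫ x, (inner ℝ (b i) x) ^ 2 ∂ν = ∫ x, (inner ℝ a x) ^ 2 ∂ν := fun i =>
    hν.integral_inner_eq (by rw [ha, b.norm_eq_one]) (fun t => t ^ 2)
  have h2 : ∑ i, ∫ x, (inner ℝ (b i) x) ^ 2 ∂ν = 1 := by
    rw [← integral_finsetSum _ fun i _ => hν.integrable (by fun_prop)]
    rw [integral_congr_ae (g := fun _ => (1 : ℝ))]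
    · simp
    filter_upwards [hν.norm_eq_one] with x hx
    have := b.sum_sq_norm_inner_right x
    simp only [Real.norm_eq_abs, sq_abs] at this
    rw [this, hx, one_pow]
  have hp : (p : ℝ) ≠ 0 := by
    rintro h0
    have : p = 0 := by exact_mod_cast h0
    subst this
    simp at h2
  simp only [h1, Finset.sum_const, Finset.card_univ, Fintype.card_fin, nsmul_eq_mul] at h2
  field_simp
  linarith

/-- Compare the fourth moments along `a ± b`, which are rotations of `√2 a`. -/
theorem integral_inner_sq_mul_inner_sq [IsFiniteMeasure ν] (hν : IsRotationInvariant ν)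
    {a b : EuclideanSpace ℝ (Fin p)} (ha : ‖a‖ = 1) (hb : ‖b‖ = 1) (hab : inner ℝ a b = 0) :
    ∫ x, (inner ℝ a x) ^ 2 * (inner ℝ b x) ^ 2 ∂ν = (∫ x, (inner ℝ a x) ^ 4 ∂ν) / 3 := by
  have hsq : ∀ s : ℝ, (s = 1 ∨ s = -1) → ‖a + s • b‖ = ‖√2 • a‖ := by
    intro s hs
    have h1 : ‖a + s • b‖ ^ 2 = 2 := by
      rw [norm_add_sq_real, inner_smul_right, hab, norm_smul, ha, hb]
      rcases hs with rfl | rfl <;> norm_num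
    rw [norm_smul, ha, ← Real.sqrt_sq (norm_nonneg (a + s • b)), h1]
    simp [abs_of_nonneg (Real.sqrt_nonneg 2)]
  have h1 := hν.integral_inner_eq (hsq 1 (Or.inl rfl)) (fun t => t ^ 4)
  have h2 := hν.integral_inner_eq (hsq (-1) (Or.inr rfl)) (fun t => t ^ 4)
  have h3 := hν.integral_inner_eq (ha.trans hb.symm) (fun t => t ^ 4)
  have h4 : ∫ x, (inner ℝ (√2 • a) x) ^ 4 ∂ν = 4 * ∫ x, (inner ℝ a x) ^ 4 ∂ν := by
    rw [← integral_const_mul]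
    congr 1; ext x
    rw [inner_smul_left, mul_pow]
    have : (√2 : ℝ) ^ 4 = 4 := by
      rw [show (4 : ℕ) = 2 * 2 from rfl, pow_mul, Real.sq_sqrt (by norm_num)]; norm_num
    simp [this]
  have h5 : ∫ x, ((inner ℝ (a + (1 : ℝ) • b) x) ^ 4 + (inner ℝ (a + (-1 : ℝ) • b) x) ^ 4) ∂ν
      = ∫ x, (2 * (inner ℝ a x) ^ 4 + 12 * ((inner ℝ a x) ^ 2 * (inner ℝ b x) ^ 2)
        + 2 * (inner ℝ b x) ^ 4) ∂ν := by
    congr 1; ext x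
    simp only [inner_add_left, inner_smul_left]
    simp
    ring
  rw [integral_add (hν.integrable (by fun_prop)) (hν.integrable (by fun_prop)),
    integral_add (hν.integrable (by fun_prop)) (hν.integrable (by fun_prop)),
    integral_add (hν.integrable (by fun_prop)) (hν.integrable (by fun_prop)),
    integral_const_mul, integral_const_mul, integral_const_mul] at h5
  linarith

theorem integral_inner_pow_four [IsProbabilityMeasure ν] (hν : IsRotationInvariant ν)
    {a : EuclideanSpace ℝ (Fin p)} (ha : ‖a‖ = 1) :
    ∫ x, (inner ℝ a x) ^ 4 ∂ν = 3 / (p * (p + 2)) := by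
  have hp : 0 < p := by
    rcases Nat.eq_zero_or_pos p with rfl | h
    · rw [Subsingleton.elim a 0] at ha; simp at ha
    · exact h
  let b := EuclideanSpace.basisFun (Fin p) ℝ
  let i₀ : Fin p := ⟨0, hp⟩
  have h0 : ∫ x, (inner ℝ a x) ^ 4 ∂ν = ∫ x, (inner ℝ (b i₀) x) ^ 4 ∂ν :=
    hν.integral_inner_eq (by rw [ha, b.norm_eq_one]) (fun t => t ^ 4)
  rw [h0]
  set M := ∫ x, (inner ℝ (b i₀) x) ^ 4 ∂ν with hM
  have h2 : ∑ j, ∫ x, (inner ℝ (b i₀) x) ^ 2 * (inner ℝ (b j) x) ^ 2 ∂ν = 1 / p := by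
    rw [← integral_finsetSum _ fun i _ => hν.integrable (by fun_prop),
      ← hν.integral_inner_sq (b.norm_eq_one i₀)]
    refine integral_congr_ae ?_
    filter_upwards [hν.norm_eq_one] with x hx
    have := b.sum_sq_norm_inner_right x
    simp only [Real.norm_eq_abs, sq_abs] at this
    rw [← Finset.mul_sum, this, hx, one_pow, mul_one]
  have h3 : ∀ j, ∫ x, (inner ℝ (b i₀) x) ^ 2 * (inner ℝ (b j) x) ^ 2 ∂ν
      = M / 3 + if j = i₀ then 2 * M / 3 else 0 := by
    intro j
    by_cases hj : j = i₀
    · subst hj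
      simp only [if_true]
      have : M = ∫ x, (inner ℝ (b i₀) x) ^ 2 * (inner ℝ (b i₀) x) ^ 2 ∂ν := by
        rw [hM]; congr 1; ext x; ring
      rw [← this]; ring
    · rw [hν.integral_inner_sq_mul_inner_sq (b.norm_eq_one _) (b.norm_eq_one _)
        (b.inner_eq_zero (Ne.symm hj)), if_neg hj, add_zero]
  simp only [h3, Finset.sum_add_distrib, Finset.sum_const, Finset.card_univ, Fintype.card_fin,
    nsmul_eq_mul, Finset.sum_ite_eq', Finset.mem_univ, if_true] at h2
  have hp' : (0 : ℝ) < p := by exact_mod_cast hp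
  field_simp at h2 ⊢
  linarith

/-- The variance of a nonnegative quadratic form: distinct squared coordinates are negatively
correlated, so only the diagonal fourth moments count. -/
theorem integral_quadratic_sub_sq_le [IsProbabilityMeasure ν] (hν : IsRotationInvariant ν)
    (b : OrthonormalBasis (Fin p) ℝ (EuclideanSpace ℝ (Fin p))) (s : Finset (Fin p))
    {l : Fin p → ℝ} (hl : ∀ i, 0 ≤ l i) :
    ∫ x, (∑ i ∈ s, l i * (inner ℝ (b i) x) ^ 2 - (∑ i ∈ s, l i) / p) ^ 2 ∂ν
      ≤ 3 * (∑ i ∈ s, l i ^ 2) / p ^ 2 := by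
  rcases Nat.eq_zero_or_pos p with rfl | hp
  · simp [Finset.eq_empty_of_isEmpty s]
  have hp' : (0 : ℝ) < p := by exact_mod_cast hp
  have h1 : ∫ x, (∑ i ∈ s, l i * (inner ℝ (b i) x) ^ 2) ∂ν = (∑ i ∈ s, l i) / p := by
    rw [integral_finsetSum _ fun i _ => hν.integrable (by fun_prop), Finset.sum_div]
    refine Finset.sum_congr rfl fun i _ => ?_
    rw [integral_const_mul, hν.integral_inner_sq (b.norm_eq_one i)]; ring
  have h2 : ∫ x, (∑ i ∈ s, l i * (inner ℝ (b i) x) ^ 2) ^ 2 ∂ν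
      = ∑ i ∈ s, ∑ j ∈ s, l i * l j * ∫ x, (inner ℝ (b i) x) ^ 2 * (inner ℝ (b j) x) ^ 2 ∂ν := by
    simp only [sq (∑ i ∈ s, _), Finset.sum_mul_sum]
    rw [integral_finsetSum _ fun i _ => hν.integrable (by fun_prop)]
    refine Finset.sum_congr rfl fun i _ => ?_
    rw [integral_finsetSum _ fun i _ => hν.integrable (by fun_prop)]
    refine Finset.sum_congr rfl fun j _ => ?_
    rw [← integral_const_mul]
    congr 1; ext x; ring
  have h3 : ∀ i j, l i * l j * ∫ x, (inner ℝ (b i) x) ^ 2 * (inner ℝ (b j) x) ^ 2 ∂ν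
      ≤ l i * l j * (1 / p ^ 2) + if j = i then l i ^ 2 * (3 / p ^ 2) else 0 := by
    intro i j
    have hll := mul_nonneg (hl i) (hl j)
    have key : (3 : ℝ) / (p * (p + 2)) ≤ 3 / p ^ 2 :=
      div_le_div_of_nonneg_left (by norm_num) (by positivity) (by nlinarith)
    by_cases hj : j = i
    · subst hj
      simp only [if_true]
      have : ∫ x, (inner ℝ (b j) x) ^ 2 * (inner ℝ (b j) x) ^ 2 ∂ν = 3 / (p * (p + 2)) := by
        rw [← hν.integral_inner_pow_four (b.norm_eq_one j)]; congr 1; ext x; ring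
      rw [this]
      have h4 := mul_le_mul_of_nonneg_left key hll
      have h5 : 0 ≤ l j * l j * (1 / (p : ℝ) ^ 2) := by positivity
      nlinarith
    · rw [hν.integral_inner_sq_mul_inner_sq (b.norm_eq_one _) (b.norm_eq_one _)
        (b.inner_eq_zero (Ne.symm hj)), if_neg hj, add_zero,
        hν.integral_inner_pow_four (b.norm_eq_one _)]
      refine mul_le_mul_of_nonneg_left ?_ hll
      have : (1 : ℝ) / p ^ 2 = 3 / p ^ 2 / 3 := by ring
      rw [this]
      exact div_le_div_of_nonneg_right key (by norm_num)
  set A := (∑ i ∈ s, l i) / p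
  have h4 : ∫ x, (∑ i ∈ s, l i * (inner ℝ (b i) x) ^ 2 - A) ^ 2 ∂ν
      = ∫ x, (∑ i ∈ s, l i * (inner ℝ (b i) x) ^ 2) ^ 2 ∂ν - A ^ 2 := by
    have : ∀ x, (∑ i ∈ s, l i * (inner ℝ (b i) x) ^ 2 - A) ^ 2
      = (∑ i ∈ s, l i * (inner ℝ (b i) x) ^ 2) ^ 2
        - 2 * A * (∑ i ∈ s, l i * (inner ℝ (b i) x) ^ 2) + A ^ 2 := fun x => by ring
    simp only [this]
    rw [integral_add (hν.integrable (by fun_prop)) (integrable_const _),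
      integral_sub (hν.integrable (by fun_prop)) (hν.integrable (by fun_prop)),
      integral_const_mul, h1]
    simp
    ring
  rw [h4, h2]
  have h5 : ∑ i ∈ s, ∑ j ∈ s, l i * l j * ∫ x, (inner ℝ (b i) x) ^ 2 * (inner ℝ (b j) x) ^ 2 ∂ν
      ≤ ∑ i ∈ s, ∑ j ∈ s,
        (l i * l j * (1 / p ^ 2) + if j = i then l i ^ 2 * (3 / p ^ 2) else 0) :=
    Finset.sum_le_sum fun i _ => Finset.sum_le_sum fun j _ => h3 i j
  have h6 : ∑ i ∈ s, ∑ j ∈ s,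
        (l i * l j * (1 / (p : ℝ) ^ 2) + if j = i then l i ^ 2 * (3 / (p : ℝ) ^ 2) else 0)
      = A ^ 2 + 3 * (∑ i ∈ s, l i ^ 2) / p ^ 2 := by
    simp only [Finset.sum_add_distrib]
    congr 1
    · simp only [A, ← Finset.sum_mul, div_pow, sq (∑ i ∈ s, l i), Finset.sum_mul_sum]
      ring
    · rw [Finset.sum_congr rfl fun i hi => by rw [Finset.sum_ite_eq' s i, if_pos hi],
        ← Finset.sum_mul]
      ring
  linarith

/-- Khintchine's argument: after rotating `a` to the diagonal direction, sign flips of the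
coordinates turn the coordinate into a Rademacher sum with variance proxy `1 / p`. -/
theorem integral_exp_inner_le [IsProbabilityMeasure ν] (hν : IsRotationInvariant ν)
    {a : EuclideanSpace ℝ (Fin p)} (ha : ‖a‖ = 1) (l : ℝ) :
    ∫ x, Real.exp (l * inner ℝ a x) ∂ν ≤ Real.exp (l ^ 2 / (2 * p)) := by
  have hp : 0 < p := by
    rcases Nat.eq_zero_or_pos p with rfl | h
    · rw [Subsingleton.elim a 0] at ha; simp at ha
    · exact h
  have hp' : (0 : ℝ) < p := by exact_mod_cast hp
  let d : EuclideanSpace ℝ (Fin p) := WithLp.toLp 2 fun _ => (√p)⁻¹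
  have hd : ‖d‖ = 1 := by
    rw [EuclideanSpace.norm_eq]
    simp [d, hp'.ne']
  rw [hν.integral_inner_eq (ha.trans hd.symm) (fun t => Real.exp (l * t))]
  let O : (Fin p → ℤˣ) → (EuclideanSpace ℝ (Fin p) ≃ₗᵢ[ℝ] EuclideanSpace ℝ (Fin p)) := fun e =>
    LinearIsometryEquiv.piLpCongrRight 2 fun i =>
      if e i = 1 then LinearIsometryEquiv.refl ℝ ℝ else LinearIsometryEquiv.neg ℝ
  have hO : ∀ e x i, (O e x) i = ((e i : ℤ) : ℝ) * x i := by
    intro e x i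
    rcases Int.units_eq_one_or (e i) with h | h <;>
      simp [O, h]
  have hin : ∀ x : EuclideanSpace ℝ (Fin p), inner ℝ d x = (√p)⁻¹ * ∑ i, x i := by
    intro x
    rw [Finset.mul_sum]
    simp [PiLp.inner_apply, d, mul_comm]
  have h1 : ∀ e, ∫ x, Real.exp (l * inner ℝ d (O e x)) ∂ν = ∫ x, Real.exp (l * inner ℝ d x) ∂ν :=
    fun e => hν.integral_comp (O e) (fun x => Real.exp (l * inner ℝ d x))
  have hcont : ∀ e, Integrable (fun x => Real.exp (l * inner ℝ d (O e x))) ν := fun e =>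
    hν.integrable (by have := (O e).continuous; fun_prop)
  have h2 : ∫ x, (∑ e : Fin p → ℤˣ, Real.exp (l * inner ℝ d (O e x))) ∂ν
      = 2 ^ p * ∫ x, Real.exp (l * inner ℝ d x) ∂ν := by
    rw [integral_finsetSum _ fun e _ => hcont e]
    simp [h1]
  have h3 : ∫ x, (∑ e : Fin p → ℤˣ, Real.exp (l * inner ℝ d (O e x))) ∂ν
      ≤ ∫ _x, 2 ^ p * Real.exp (l ^ 2 / (2 * p)) ∂ν := by
    refine integral_mono_ae (integrable_finsetSum _ fun e _ => hcont e) (integrable_const _) ?_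
    filter_upwards [hν.norm_eq_one] with x hx
    have h4 : ∀ e, Real.exp (l * inner ℝ d (O e x))
        = ∏ i, Real.exp (l * (√p)⁻¹ * (((e i : ℤ) : ℝ) * x i)) := by
      intro e
      rw [hin, ← Real.exp_sum, ← Finset.mul_sum, mul_assoc]
      simp only [hO]
    have h5 : ∑ e : Fin p → ℤˣ, ∏ i, Real.exp (l * (√p)⁻¹ * (((e i : ℤ) : ℝ) * x i))
        = ∏ i, ∑ u : ℤˣ, Real.exp (l * (√p)⁻¹ * (((u : ℤ) : ℝ) * x i)) := by
      rw [Finset.prod_univ_sum, Fintype.piFinset_univ]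
    have h6 : ∀ i, ∑ u : ℤˣ, Real.exp (l * (√p)⁻¹ * (((u : ℤ) : ℝ) * x i))
        ≤ 2 * Real.exp (l ^ 2 / (2 * p) * x i ^ 2) := by
      intro i
      have : (Finset.univ : Finset ℤˣ) = {1, -1} := rfl
      rw [this, Finset.sum_pair (by decide)]
      have h7 := Real.cosh_le_exp_half_sq (l * (√p)⁻¹ * x i)
      rw [Real.cosh_eq] at h7
      have h8 : (l * (√p)⁻¹ * x i) ^ 2 / 2 = l ^ 2 / (2 * p) * x i ^ 2 := by
        rw [mul_pow, mul_pow, inv_pow, Real.sq_sqrt hp'.le]; field_simp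
      rw [h8] at h7
      simp only [Units.val_one, Int.cast_one, one_mul, Units.val_neg, Int.cast_neg, neg_mul,
        mul_neg]
      linarith
    simp only [h4, h5]
    calc ∏ i, ∑ u : ℤˣ, Real.exp (l * (√p)⁻¹ * (((u : ℤ) : ℝ) * x i))
        ≤ ∏ i, 2 * Real.exp (l ^ 2 / (2 * p) * x i ^ 2) :=
          Finset.prod_le_prod (fun i _ => Finset.sum_nonneg fun u _ => (Real.exp_pos _).le)
            fun i _ => h6 i
      _ = 2 ^ p * Real.exp (l ^ 2 / (2 * p)) := by
          rw [Finset.prod_mul_distrib, ← Real.exp_sum, ← Finset.mul_sum]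
          have : ∑ i, x i ^ 2 = 1 := by
            have := EuclideanSpace.real_norm_sq_eq x
            rw [← this, hx, one_pow]
          rw [this]; simp
  rw [h2] at h3
  simp only [integral_const, probReal_univ, smul_eq_mul, one_mul] at h3
  exact le_of_mul_le_mul_left h3 (by positivity)

theorem measureReal_le_inner_le [IsProbabilityMeasure ν] (hν : IsRotationInvariant ν)
    {a : EuclideanSpace ℝ (Fin p)} (ha : ‖a‖ = 1) {s : ℝ} (hs : 0 ≤ s) :
    ν.real {x | s ≤ inner ℝ a x} ≤ Real.exp (-(p * s ^ 2 / 2)) := by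
  have hp : 0 < p := by
    rcases Nat.eq_zero_or_pos p with rfl | h
    · rw [Subsingleton.elim a 0] at ha; simp at ha
    · exact h
  have hp' : (0 : ℝ) < p := by exact_mod_cast hp
  have h1 := measure_ge_le_exp_mul_mgf (μ := ν) (X := fun x => inner ℝ a x) (t := p * s) s
    (by positivity) (hν.integrable (by fun_prop))
  refine h1.trans ?_
  have h2 := hν.integral_exp_inner_le ha (p * s)
  rw [mgf]
  refine (mul_le_mul_of_nonneg_left h2 (Real.exp_pos _).le).trans (le_of_eq ?_)
  rw [← Real.exp_add]
  congr 1
  field_simp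
  ring

theorem measureReal_le_abs_inner_le [IsProbabilityMeasure ν] (hν : IsRotationInvariant ν)
    {a : EuclideanSpace ℝ (Fin p)} (ha : ‖a‖ = 1) {s : ℝ} (hs : 0 ≤ s) :
    ν.real {x | s ≤ |inner ℝ a x|} ≤ 2 * Real.exp (-(p * s ^ 2 / 2)) := by
  have h1 := hν.measureReal_le_inner_le ha hs
  have h2 := hν.measureReal_le_inner_le (a := -a) (by rwa [norm_neg]) hs
  have : {x | s ≤ |inner ℝ a x|} = {x | s ≤ inner ℝ a x} ∪ {x | s ≤ inner ℝ (-a) x} := by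
    ext x; simp [le_abs]
  rw [this]
  refine (measureReal_union_le _ _).trans ?_
  linarith

/-- The second and fourth moments bound the first absolute moment below: integrate
`x² ≤ t |x| + x⁴ / t²`, with `t² = 6 / p` so that the last term takes at most half of the left
side. -/
theorem le_integral_abs_inner [IsProbabilityMeasure ν] (hν : IsRotationInvariant ν)
    {a : EuclideanSpace ℝ (Fin p)} (ha : ‖a‖ = 1) :
    1 / (2 * √6 * √p) ≤ ∫ x, |inner ℝ a x| ∂ν := by
  have hp : 0 < p := by
    rcases Nat.eq_zero_or_pos p with rfl | h
    · rw [Subsingleton.elim a 0] at ha; simp at ha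
    · exact h
  have hp' : (0 : ℝ) < p := by exact_mod_cast hp
  set t : ℝ := √6 / √p with ht
  have ht0 : 0 < t := by positivity
  have ht2 : t ^ 2 = 6 / p := by
    rw [ht, div_pow, Real.sq_sqrt (by norm_num), Real.sq_sqrt hp'.le]
  have h1 : ∀ y : ℝ, y ^ 2 ≤ t * |y| + y ^ 4 / t ^ 2 := by
    intro y
    rcases le_total |y| t with h | h
    · have : y ^ 2 = |y| * |y| := by rw [← sq, sq_abs]
      have h3 : 0 ≤ y ^ 4 / t ^ 2 := by positivity
      nlinarith [abs_nonneg y]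
    · have h3 : t ^ 2 ≤ y ^ 2 := by
        rw [← sq_abs y]; exact pow_le_pow_left₀ ht0.le h 2
      have h4 : y ^ 2 ≤ y ^ 4 / t ^ 2 := by
        rw [le_div_iff₀ (by positivity)]; nlinarith [sq_nonneg y]
      have := mul_nonneg ht0.le (abs_nonneg y)
      linarith
  have h2 : ∫ x, (inner ℝ a x) ^ 2 ∂ν
      ≤ ∫ x, (t * |inner ℝ a x| + (inner ℝ a x) ^ 4 / t ^ 2) ∂ν :=
    integral_mono (hν.integrable (by fun_prop)) (hν.integrable (by fun_prop)) fun x => h1 _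
  rw [integral_add (hν.integrable (by fun_prop)) (hν.integrable (by fun_prop)),
    integral_const_mul, integral_div, hν.integral_inner_sq ha, hν.integral_inner_pow_four ha,
    ht2] at h2
  set I := ∫ x, |inner ℝ a x| ∂ν
  have h3 : 3 / (p * (p + 2) : ℝ) / (6 / p) ≤ 1 / (2 * p) := by
    rw [div_div_eq_mul_div, div_mul_eq_mul_div, div_div, div_le_div_iff₀ (by positivity) (by positivity)]
    nlinarith
  have h4 : 1 / (2 * p) ≤ t * I := by
    have : (1 : ℝ) / p = 1 / (2 * p) + 1 / (2 * p) := by field_simp; norm_num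
    linarith
  have h5 : 1 / (2 * √6 * √p) = 1 / (2 * p) / t := by
    rw [ht]
    have := Real.mul_self_sqrt hp'.le
    field_simp
    rw [sq, this]
  rw [h5, div_le_iff₀ ht0]
  linarith

end IsRotationInvariant

/-! ### The uniform law on the sphere -/

theorem isProbabilityMeasure_uniformSphere {p : ℕ} (hp : 0 < p) :
    IsProbabilityMeasure (uniformSphere p) := by
  have : Nontrivial (EuclideanSpace ℝ (Fin p)) := by
    have : Nonempty (Fin p) := ⟨⟨0, hp⟩⟩
    infer_instance
  refine ⟨?_⟩
  rw [uniformSphere, Measure.map_apply measurable_subtype_coe MeasurableSet.univ,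
    Set.preimage_univ, Measure.smul_apply, smul_eq_mul]
  refine ENNReal.inv_mul_cancel ?_ (measure_ne_top _ _)
  rw [Measure.measure_univ_ne_zero]
  exact Measure.toSphere_ne_zero _

/-- The mass of a set is the normalised volume of the cone over it in the unit ball. -/
theorem uniformSphere_apply {p : ℕ} {A : Set (EuclideanSpace ℝ (Fin p))} (hA : MeasurableSet A) :
    uniformSphere p A = ((volume : Measure (EuclideanSpace ℝ (Fin p))).toSphere Set.univ)⁻¹ *
      (p * volume (Set.image2 (fun (r : ℝ) x => r • x) (Set.Ioo 0 1) (A ∩ Metric.sphere 0 1))) := by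
  rw [uniformSphere, Measure.map_apply measurable_subtype_coe hA, Measure.smul_apply, smul_eq_mul,
    Measure.toSphere_apply' _ (measurable_subtype_coe hA), Subtype.image_preimage_coe]
  simp [Set.inter_comm, Set.image2_smul]

theorem isRotationInvariant_uniformSphere (p : ℕ) :
    IsRotationInvariant (uniformSphere p) where
  map_eq O := by
    ext A hA
    have hO : Measurable O := O.continuous.measurable
    rw [Measure.map_apply hO hA, uniformSphere_apply hA, uniformSphere_apply (hO hA)]
    congr 2
    have h1 : Set.image2 (fun (r : ℝ) x => r • x) (Set.Ioo 0 1) (O ⁻¹' A ∩ Metric.sphere 0 1)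
        = O ⁻¹' (Set.image2 (fun (r : ℝ) x => r • x) (Set.Ioo 0 1) (A ∩ Metric.sphere 0 1)) := by
      ext x
      simp only [Set.mem_image2, Set.mem_preimage, Set.mem_inter_iff, mem_sphere_zero_iff_norm]
      constructor
      · rintro ⟨r, hr, y, ⟨hy, hy1⟩, rfl⟩
        exact ⟨r, hr, O y, ⟨hy, by simpa using hy1⟩, by simp⟩
      · rintro ⟨r, hr, y, ⟨hy, hy1⟩, h⟩
        refine ⟨r, hr, O.symm y, ⟨by simpa using hy, by simpa using hy1⟩, ?_⟩
        apply O.injective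
        simpa using h
    rw [h1]
    exact O.measurePreserving.measure_preimage_equiv (f := O.toHomeomorph.toMeasurableEquiv) _
  norm_eq_one := by
    rw [uniformSphere, ae_map_iff measurable_subtype_coe.aemeasurable
      (measurableSet_eq_fun (by fun_prop) (by fun_prop))]
    exact ae_of_all _ fun x => by simp

/-- The cone over a point lies in a line, which is a null set from dimension two on. -/
theorem uniformSphere_singleton {p : ℕ} (hp : 2 ≤ p) (a : EuclideanSpace ℝ (Fin p)) :
    uniformSphere p {a} = 0 := by
  have h1 : volume (Set.image2 (fun (r : ℝ) x => r • x) (Set.Ioo 0 1)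
      ({a} ∩ Metric.sphere (0 : EuclideanSpace ℝ (Fin p)) 1)) = 0 := by
    refine measure_mono_null (t := (Submodule.span ℝ {a} : Set (EuclideanSpace ℝ (Fin p)))) ?_ ?_
    · rintro x ⟨r, hr, y, ⟨rfl, -⟩, rfl⟩
      exact Submodule.smul_mem _ _ (Submodule.mem_span_singleton_self _)
    · refine Measure.addHaar_submodule _ _ fun h => ?_
      have h2 := finrank_span_le_card (R := ℝ) ({a} : Set (EuclideanSpace ℝ (Fin p)))
      rw [h, finrank_top, finrank_euclideanSpace_fin] at h2
      simp at h2
      omega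
  rw [uniformSphere_apply (measurableSet_singleton a), h1]
  simp

/-! ### The driving pairs -/

namespace IsEllipticalDriver

variable {n p : ℕ} {Ω : Type*} [MeasurableSpace Ω] {P : Measure Ω}
  {ξ : Fin n → Ω → ℝ} {u : Fin n → Ω → EuclideanSpace ℝ (Fin p)}

theorem measurable_pair (h : IsEllipticalDriver P ξ u) (t : Fin n) :
    Measurable fun ω => (ξ t ω, u t ω) :=
  (h.measurable_scalar t).prodMk (h.measurable_direction t)

theorem indepFun_scalar_direction (h : IsEllipticalDriver P ξ u) (s t : Fin n) :
    IndepFun (ξ s) (u t) P :=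
  h.scalar_indep_direction.comp (φ := fun x : Fin n → ℝ => x s)
    (ψ := fun x : Fin n → EuclideanSpace ℝ (Fin p) => x t)
    (measurable_pi_apply s) (measurable_pi_apply t)

theorem iIndepFun_pair [IsProbabilityMeasure P] (h : IsEllipticalDriver P ξ u) :
    iIndepFun (fun t ω => (ξ t ω, u t ω)) P := by
  rw [iIndepFun_iff_map_fun_eq_pi_map fun t => (h.measurable_pair t).aemeasurable]
  have : ∀ t, IsProbabilityMeasure (P.map fun ω => (ξ t ω, u t ω)) := fun t =>
    Measure.isProbabilityMeasure_map (h.measurable_pair t).aemeasurable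
  symm
  refine Measure.pi_eq_generateFrom
    (C := fun _ => Set.image2 (· ×ˢ ·) {s : Set ℝ | MeasurableSet s}
      {t : Set (EuclideanSpace ℝ (Fin p)) | MeasurableSet t})
    (fun _ => generateFrom_prod) (fun _ => isPiSystem_prod) (fun t => ?_) ?_
  · refine ⟨fun _ => Set.univ, fun _ => ⟨Set.univ, by simp, Set.univ, by simp, Set.univ_prod_univ⟩,
      fun _ => measure_lt_top _ _, Set.iUnion_const _⟩
  · intro s hs
    choose A hA' B hB' hAB using hs
    have hA : ∀ t, MeasurableSet (A t) := hA'
    have hB : ∀ t, MeasurableSet (B t) := hB'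
    have hs : s = fun t => A t ×ˢ B t := funext fun t => (hAB t).symm
    subst hs
    have hm : Measurable fun ω t => (ξ t ω, u t ω) := measurable_pi_lambda _ h.measurable_pair
    rw [Measure.map_apply hm (MeasurableSet.univ_pi fun t => (hA t).prod (hB t))]
    have h1 : (fun ω t => (ξ t ω, u t ω)) ⁻¹' Set.univ.pi (fun t => A t ×ˢ B t)
        = (fun ω t => ξ t ω) ⁻¹' Set.univ.pi A ∩ (fun ω t => u t ω) ⁻¹' Set.univ.pi B := by
      ext ω
      simp only [Set.mem_preimage, Set.mem_pi, Set.mem_univ, true_imp_iff, Set.mem_prod,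
        Set.mem_inter_iff]
      exact forall_and
    have h2 : (fun ω t => ξ t ω) ⁻¹' Set.univ.pi A = ⋂ t ∈ Finset.univ, ξ t ⁻¹' A t := by
      ext ω; simp
    have h3 : (fun ω t => u t ω) ⁻¹' Set.univ.pi B = ⋂ t ∈ Finset.univ, u t ⁻¹' B t := by
      ext ω; simp
    rw [h1, h.scalar_indep_direction.measure_inter_preimage_eq_mul _ _ (MeasurableSet.univ_pi hA)
      (MeasurableSet.univ_pi hB), h2, h3,
      h.scalar_indep.measure_inter_preimage_eq_mul Finset.univ fun t _ => hA t,
      h.direction_indep.measure_inter_preimage_eq_mul Finset.univ fun t _ => hB t,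
      ← Finset.prod_mul_distrib]
    refine Finset.prod_congr rfl fun t _ => ?_
    rw [Measure.map_apply (h.measurable_pair t) ((hA t).prod (hB t)), Set.mk_preimage_prod,
      (h.indepFun_scalar_direction t t).measure_inter_preimage_eq_mul _ _ (hA t) (hB t)]

theorem dim_pos [IsProbabilityMeasure P] (h : IsEllipticalDriver P ξ u) (t : Fin n) : 0 < p := by
  rcases Nat.eq_zero_or_pos p with rfl | hp
  · exfalso
    have h1 := h.direction_law t
    have h2 := (isRotationInvariant_uniformSphere 0).norm_eq_one
    rw [← h1, ae_map_iff (h.measurable_direction t).aemeasurable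
      (measurableSet_eq_fun (by fun_prop) (by fun_prop))] at h2
    obtain ⟨ω, hω⟩ := h2.exists
    rw [Subsingleton.elim (u t ω) 0] at hω
    simp at hω
  · exact hp

theorem norm_direction (h : IsEllipticalDriver P ξ u) (t : Fin n) : ∀ᵐ ω ∂P, ‖u t ω‖ = 1 := by
  have h2 := (isRotationInvariant_uniformSphere p).norm_eq_one
  rwa [← h.direction_law t, ae_map_iff (h.measurable_direction t).aemeasurable
    (measurableSet_eq_fun (by fun_prop) (by fun_prop))] at h2

theorem integral_direction (h : IsEllipticalDriver P ξ u) (t : Fin n)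
    {f : EuclideanSpace ℝ (Fin p) → ℝ} (hf : Measurable f) :
    ∫ ω, f (u t ω) ∂P = ∫ x, f x ∂(uniformSphere p) := by
  rw [← h.direction_law t, integral_map (h.measurable_direction t).aemeasurable
    hf.aestronglyMeasurable]

theorem ae_direction_ne [IsProbabilityMeasure P] (h : IsEllipticalDriver P ξ u) (hp : 2 ≤ p)
    {s t : Fin n} (hst : s ≠ t) :
    ∀ᵐ ω ∂P, u s ω ≠ u t ω := by
  have := isProbabilityMeasure_uniformSphere (p := p) (by omega)
  have hm : Measurable fun ω => (u s ω, u t ω) :=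
    (h.measurable_direction s).prodMk (h.measurable_direction t)
  have h1 : P.map (fun ω => (u s ω, u t ω)) = (uniformSphere p).prod (uniformSphere p) := by
    rw [(indepFun_iff_map_prod_eq_prod_map_map (h.measurable_direction s).aemeasurable
      (h.measurable_direction t).aemeasurable).1 (h.direction_indep.indepFun hst),
      h.direction_law, h.direction_law]
  have hD : MeasurableSet {x : EuclideanSpace ℝ (Fin p) × EuclideanSpace ℝ (Fin p) | x.1 = x.2} :=
    measurableSet_eq_fun measurable_fst measurable_snd
  have h2 : (uniformSphere p).prod (uniformSphere p)
      {x : EuclideanSpace ℝ (Fin p) × EuclideanSpace ℝ (Fin p) | x.1 = x.2} = 0 := by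
    rw [Measure.prod_apply hD]
    simp only [Set.preimage_ofPred_eq]
    rw [lintegral_congr (g := fun _ => 0)]
    · simp
    · intro x
      rw [← uniformSphere_singleton hp x]
      congr 1
      ext z
      simp [eq_comm]
  rw [← h1, Measure.map_apply hm hD] at h2
  rw [ae_iff]
  simpa using h2

theorem map_pair_rotate [IsProbabilityMeasure P] (h : IsEllipticalDriver P ξ u) (t : Fin n)
    (O : EuclideanSpace ℝ (Fin p) ≃ₗᵢ[ℝ] EuclideanSpace ℝ (Fin p)) :
    P.map (fun ω => (ξ t ω, O (u t ω))) = P.map (fun ω => (ξ t ω, u t ω)) := by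
  have := isProbabilityMeasure_uniformSphere (h.dim_pos t)
  have hO : Measurable O := O.continuous.measurable
  have : IsProbabilityMeasure (P.map (ξ t)) :=
    Measure.isProbabilityMeasure_map (h.measurable_scalar t).aemeasurable
  have hi := h.indepFun_scalar_direction t t
  have hi' : IndepFun (ξ t) (fun ω => O (u t ω)) P := hi.comp measurable_id hO
  have hr := (indepFun_iff_map_prod_eq_prod_map_map (h.measurable_scalar t).aemeasurable
    (hO.comp (h.measurable_direction t)).aemeasurable).1 hi'
  refine hr.trans ?_
  rw [(indepFun_iff_map_prod_eq_prod_map_map (h.measurable_scalar t).aemeasurable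
    (h.measurable_direction t).aemeasurable).1 hi]
  congr 1
  have := Measure.map_map (μ := P) hO (h.measurable_direction t)
  rw [h.direction_law, (isRotationInvariant_uniformSphere p).map_eq O] at this
  rw [h.direction_law]
  exact this.symm

theorem integral_pair_rotate [IsProbabilityMeasure P] (h : IsEllipticalDriver P ξ u) (t : Fin n)
    (O : EuclideanSpace ℝ (Fin p) ≃ₗᵢ[ℝ] EuclideanSpace ℝ (Fin p))
    {f : ℝ × EuclideanSpace ℝ (Fin p) → ℝ} (hf : Measurable f) :
    ∫ ω, f (ξ t ω, O (u t ω)) ∂P = ∫ ω, f (ξ t ω, u t ω) ∂P := by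
  have hm : Measurable fun ω => (ξ t ω, O (u t ω)) :=
    (h.measurable_scalar t).prodMk (O.continuous.measurable.comp (h.measurable_direction t))
  rw [← integral_map (φ := fun ω => (ξ t ω, O (u t ω))) (f := f) hm.aemeasurable
      hf.aestronglyMeasurable, h.map_pair_rotate t O,
    integral_map (h.measurable_pair t).aemeasurable hf.aestronglyMeasurable]

/-- A simultaneous rotation of two directions leaves the joint law of the two driving pairs
unchanged. -/
theorem map_two_pairs_rotate [IsProbabilityMeasure P] (h : IsEllipticalDriver P ξ u) {s t : Fin n}
    (hst : s ≠ t) (O : EuclideanSpace ℝ (Fin p) ≃ₗᵢ[ℝ] EuclideanSpace ℝ (Fin p)) :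
    P.map (fun ω => ((ξ s ω, O (u s ω)), (ξ t ω, O (u t ω))))
      = P.map (fun ω => ((ξ s ω, u s ω), (ξ t ω, u t ω))) := by
  have hO : Measurable O := O.continuous.measurable
  have hm' : ∀ r, Measurable fun ω => (ξ r ω, O (u r ω)) := fun r =>
    (h.measurable_scalar r).prodMk (hO.comp (h.measurable_direction r))
  have hi := h.iIndepFun_pair.indepFun hst
  have hi' : IndepFun (fun ω => (ξ s ω, O (u s ω))) (fun ω => (ξ t ω, O (u t ω))) P :=
    hi.comp (φ := fun x => (x.1, O x.2)) (ψ := fun x => (x.1, O x.2))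
      (measurable_fst.prodMk (hO.comp measurable_snd))
      (measurable_fst.prodMk (hO.comp measurable_snd))
  rw [(indepFun_iff_map_prod_eq_prod_map_map (hm' s).aemeasurable (hm' t).aemeasurable).1 hi',
    (indepFun_iff_map_prod_eq_prod_map_map (h.measurable_pair s).aemeasurable
      (h.measurable_pair t).aemeasurable).1 hi, h.map_pair_rotate, h.map_pair_rotate]

end IsEllipticalDriver

/-! ### The Huber location estimate -/

theorem huberPsi_mono (H : ℝ) : Monotone (huberPsi H) := fun _ _ h =>
  min_le_min le_rfl (max_le_max le_rfl h)

theorem continuous_huberPsi (H : ℝ) : Continuous (huberPsi H) := by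
  unfold huberPsi; fun_prop

theorem abs_huberPsi_le {H : ℝ} (hH : 0 < H) (x : ℝ) : |huberPsi H x| ≤ H := by
  rw [huberPsi, abs_le]
  exact ⟨le_min (by linarith) (le_max_left _ _), min_le_left _ _⟩

theorem huberPsi_neg {H : ℝ} (hH : 0 < H) (x : ℝ) : huberPsi H (-x) = -huberPsi H x := by
  simp only [huberPsi, min_def, max_def]
  split_ifs <;> linarith

theorem huberPsi_sq_le {H : ℝ} (hH : 0 < H) (x : ℝ) : huberPsi H x ^ 2 ≤ x ^ 2 := by
  rw [sq_le_sq, huberPsi]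
  rcases le_total x (-H) with h1 | h1
  · rw [max_eq_left h1, min_eq_right (by linarith), abs_neg, abs_of_pos hH,
      abs_of_nonpos (by linarith)]
    linarith
  · rw [max_eq_right h1]
    rcases le_total H x with h2 | h2
    · rw [min_eq_left h2, abs_of_pos hH]
      exact h2.trans (le_abs_self x)
    · rw [min_eq_right h2]

/-- On the linear stretch of the Huber function a shift by `s` lowers it by exactly `s`; away from
that stretch the right-hand side is nonnegative. -/
theorem huberPsi_shift_le {H s x : ℝ} (hH : 1 < H) (hs : 0 ≤ s) (hs1 : s ≤ 1) :
    huberPsi H (x - s) ≤ huberPsi H x - s * (1 - x ^ 2 / (H - 1) ^ 2) := by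
  rcases le_total |x| (H - 1) with h | h
  · have h0 := abs_le.1 h
    have h1 : ∀ z, -H ≤ z → z ≤ H → huberPsi H z = z := fun z h1 h2 => by
      rw [huberPsi, max_eq_right h1, min_eq_right h2]
    rw [h1 x (by linarith) (by linarith), h1 (x - s) (by linarith) (by linarith)]
    have : 0 ≤ s * (x ^ 2 / (H - 1) ^ 2) := by positivity
    linarith
  · have h1 : 1 ≤ x ^ 2 / (H - 1) ^ 2 := by
      rw [one_le_div (by nlinarith), ← sq_abs x]
      exact pow_le_pow_left₀ (by linarith) h 2
    have h2 := huberPsi_mono H (show x - s ≤ x by linarith)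
    nlinarith

section HuberTail

variable {Ω : Type*} [MeasurableSpace Ω] {P : Measure Ω} [IsProbabilityMeasure P]

/-- The exponential moment of the Huber score at a shifted centre, for a variable whose score is
centred. The drift `-s / 2` beats the quadratic term when the exponent is small. -/
theorem mgf_huberPsi_sub_le {H s l v : ℝ} {x : Ω → ℝ} (hx : Measurable x)
    (hH : 1 < H) (hs : 0 ≤ s) (hs1 : s ≤ 1) (hl : 0 ≤ l) (hlH : l * H ≤ 1)
    (hint : Integrable (fun ω => x ω ^ 2) P) (hv : ∫ ω, x ω ^ 2 ∂P ≤ v)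
    (hHv : 2 * v ≤ (H - 1) ^ 2) (hsymm : ∫ ω, huberPsi H (x ω) ∂P = 0) :
    mgf (fun ω => huberPsi H (x ω - s)) P l ≤ Real.exp (-(l * s / 2) + l ^ 2 * (2 * v + 2)) := by
  have hH0 : 0 < H := by linarith
  have hm : ∀ c, Measurable fun ω => huberPsi H (x ω - c) := fun c =>
    (continuous_huberPsi H).measurable.comp (hx.sub_const c)
  have hb : ∀ c, Integrable (fun ω => huberPsi H (x ω - c)) P := fun c =>
    Integrable.of_bound (hm c).aestronglyMeasurable H
      (ae_of_all _ fun ω => abs_huberPsi_le hH0 _)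
  have hb0 : Integrable (fun ω => huberPsi H (x ω)) P := by simpa using hb 0
  have hi1 : ∀ a b : ℝ, Integrable (fun ω => a + b * x ω ^ 2) P := fun a b =>
    (integrable_const a).add (hint.const_mul b)
  have hi2 : Integrable (fun ω => 1 + l * huberPsi H (x ω - s)) P :=
    (integrable_const 1).add ((hb s).const_mul l)
  have hi3 : Integrable (fun ω => l ^ 2 * (2 * x ω ^ 2 + 2)) P :=
    ((hint.const_mul 2).add (integrable_const 2)).const_mul _
  have h1 : ∀ ω, Real.exp (l * huberPsi H (x ω - s))
      ≤ 1 + l * huberPsi H (x ω - s) + l ^ 2 * (2 * x ω ^ 2 + 2) := by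
    intro ω
    have h2 : |l * huberPsi H (x ω - s)| ≤ 1 := by
      rw [abs_mul, abs_of_nonneg hl]
      exact (mul_le_mul_of_nonneg_left (abs_huberPsi_le hH0 _) hl).trans hlH
    have h3 := (abs_le.1 (Real.abs_exp_sub_one_sub_id_le h2)).2
    have h4 : huberPsi H (x ω - s) ^ 2 ≤ 2 * x ω ^ 2 + 2 := by
      refine (huberPsi_sq_le hH0 _).trans ?_
      nlinarith [sq_nonneg (x ω + s)]
    have h5 := mul_le_mul_of_nonneg_left h4 (sq_nonneg l)
    rw [mul_pow] at h3
    linarith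
  have h0 : ∫ ω, huberPsi H (x ω - s) ∂P ≤ -(s / 2) := by
    have h2 : ∫ ω, huberPsi H (x ω - s) ∂P
        ≤ ∫ ω, (huberPsi H (x ω) - (s + -(s / (H - 1) ^ 2) * x ω ^ 2)) ∂P := by
      refine integral_mono (hb s) (hb0.sub (hi1 _ _)) fun ω => ?_
      have := huberPsi_shift_le (x := x ω) hH hs hs1
      simp only
      refine this.trans (le_of_eq ?_)
      ring
    rw [integral_sub hb0 (hi1 _ _), hsymm, integral_add (integrable_const _) (hint.const_mul _),
      integral_const_mul] at h2
    simp only [integral_const, probReal_univ, smul_eq_mul, one_mul] at h2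
    have h3 : s / (H - 1) ^ 2 * ∫ ω, x ω ^ 2 ∂P ≤ s / 2 := by
      have hHp : 0 < (H - 1) ^ 2 := by have : 0 < H - 1 := by linarith
                                       positivity
      rw [div_mul_eq_mul_div, div_le_iff₀ hHp]
      nlinarith
    linarith
  have h6 : mgf (fun ω => huberPsi H (x ω - s)) P l
      ≤ ∫ ω, (1 + l * huberPsi H (x ω - s) + l ^ 2 * (2 * x ω ^ 2 + 2)) ∂P := by
    rw [mgf]
    exact integral_mono_of_nonneg (ae_of_all _ fun ω => (Real.exp_pos _).le) (hi2.add hi3)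
      (ae_of_all _ h1)
  refine h6.trans ?_
  rw [integral_add hi2 hi3, integral_add (integrable_const _) ((hb s).const_mul _),
    integral_const_mul, integral_const_mul,
    integral_add (hint.const_mul _) (integrable_const _), integral_const_mul]
  simp only [integral_const, probReal_univ, smul_eq_mul, one_mul]
  have h7 := mul_le_mul_of_nonneg_left h0 hl
  have h8 : l ^ 2 * (2 * ∫ ω, x ω ^ 2 ∂P + 2) ≤ l ^ 2 * (2 * v + 2) :=
    mul_le_mul_of_nonneg_left (by linarith) (sq_nonneg l)
  have h9 := Real.add_one_le_exp (-(l * s / 2) + l ^ 2 * (2 * v + 2))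
  linarith

theorem measure_sum_huberPsi_nonneg_le {n : ℕ} {H s l v : ℝ} {x : Fin n → Ω → ℝ}
    (hx : ∀ t, Measurable (x t)) (hind : iIndepFun x P)
    (hH : 1 < H) (hs : 0 ≤ s) (hs1 : s ≤ 1) (hl : 0 ≤ l) (hlH : l * H ≤ 1)
    (hint : ∀ t, Integrable (fun ω => x t ω ^ 2) P) (hv : ∀ t, ∫ ω, x t ω ^ 2 ∂P ≤ v)
    (hHv : 2 * v ≤ (H - 1) ^ 2) (hsymm : ∀ t, ∫ ω, huberPsi H (x t ω) ∂P = 0) :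
    P.real {ω | 0 ≤ ∑ t, huberPsi H (x t ω - s)}
      ≤ Real.exp (n * (-(l * s / 2) + l ^ 2 * (2 * v + 2))) := by
  have hH0 : 0 < H := by linarith
  set X : Fin n → Ω → ℝ := fun t ω => huberPsi H (x t ω - s) with hX
  have hm : ∀ t, Measurable (X t) := fun t =>
    (continuous_huberPsi H).measurable.comp ((hx t).sub_const s)
  have hXi : iIndepFun X P :=
    hind.comp (fun _ z => huberPsi H (z - s)) fun _ =>
      (continuous_huberPsi H).measurable.comp (measurable_id.sub_const s)
  have hsum : ∀ ω, (∑ t, X t) ω = ∑ t, X t ω := fun ω => by simp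
  have h1 : Integrable (fun ω => Real.exp (l * (∑ t, X t) ω)) P := by
    refine Integrable.of_bound (C := Real.exp (l * (n * H))) ?_ (ae_of_all _ fun ω => ?_)
    · refine (Real.measurable_exp.comp (Measurable.const_mul (f := ∑ t, X t) ?_ l)).aestronglyMeasurable
      rw [show (∑ t, X t) = fun ω => ∑ t, X t ω from funext hsum]
      exact Finset.measurable_sum _ fun t _ => hm t
    · rw [Real.norm_eq_abs, abs_of_pos (Real.exp_pos _), Real.exp_le_exp]
      refine mul_le_mul_of_nonneg_left ?_ hl
      rw [hsum]
      refine (Finset.sum_le_sum fun t _ => (le_abs_self _).trans (abs_huberPsi_le hH0 _)).trans ?_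
      simp
  have h2 := measure_ge_le_exp_mul_mgf (μ := P) (X := ∑ t, X t) 0 hl h1
  simp only [mul_zero, Real.exp_zero, one_mul, hsum] at h2
  refine h2.trans ?_
  rw [hXi.mgf_sum hm]
  calc ∏ t, mgf (X t) P l
      ≤ ∏ _t : Fin n, Real.exp (-(l * s / 2) + l ^ 2 * (2 * v + 2)) :=
        Finset.prod_le_prod (fun t _ => mgf_nonneg) fun t _ =>
          mgf_huberPsi_sub_le (hx t) hH hs hs1 hl hlH (hint t) (hv t) hHv (hsymm t)
    _ = _ := by rw [Finset.prod_const, ← Real.exp_nat_mul]; simp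

end HuberTail

/-- The row `i` of a matrix as a Euclidean vector. -/
noncomputable def rowVec {p : ℕ} (R : Matrix (Fin p) (Fin p) ℝ) (i : Fin p) :
    EuclideanSpace ℝ (Fin p) := WithLp.toLp 2 (R i)

theorem mulVec_eq_inner_rowVec {p : ℕ} (R : Matrix (Fin p) (Fin p) ℝ)
    (x : EuclideanSpace ℝ (Fin p)) (i : Fin p) : (R *ᵥ x.ofLp) i = inner ℝ (rowVec R i) x := by
  simp [rowVec, PiLp.inner_apply, Matrix.mulVec, dotProduct, mul_comm]

theorem IsPSDSqrt.norm_rowVec_sq {p : ℕ} {R S : Matrix (Fin p) (Fin p) ℝ} (h : IsPSDSqrt R S)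
    (i : Fin p) : ‖rowVec R i‖ ^ 2 = S i i := by
  rw [EuclideanSpace.real_norm_sq_eq, ← h.2, Matrix.mul_apply]
  refine Finset.sum_congr rfl fun j _ => ?_
  have := h.1.isHermitian.apply i j
  simp only [star_trivial] at this
  simp [rowVec, sq, this]

namespace IsEllipticalDriver

variable {n p : ℕ} {Ω : Type*} [MeasurableSpace Ω] {P : Measure Ω} [IsProbabilityMeasure P]
  {ξ : Fin n → Ω → ℝ} {u : Fin n → Ω → EuclideanSpace ℝ (Fin p)}

theorem integral_direction_inner_sq (h : IsEllipticalDriver P ξ u) (t : Fin n)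
    (a : EuclideanSpace ℝ (Fin p)) :
    Integrable (fun ω => (inner ℝ a (u t ω)) ^ 2) P ∧
      ∫ ω, (inner ℝ a (u t ω)) ^ 2 ∂P = ‖a‖ ^ 2 / p := by
  have := isProbabilityMeasure_uniformSphere (h.dim_pos t)
  have hν := isRotationInvariant_uniformSphere p
  constructor
  · have h1 : Integrable (fun x => (inner ℝ a x) ^ 2) (uniformSphere p) :=
      hν.integrable (by fun_prop)
    rw [← h.direction_law t] at h1
    exact h1.comp_measurable (h.measurable_direction t)
  · rw [h.integral_direction t (f := fun x => (inner ℝ a x) ^ 2)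
      (by fun_prop)]
    rcases eq_or_ne a 0 with rfl | ha
    · simp
    have ha' : ‖a‖ ≠ 0 := norm_ne_zero_iff.2 ha
    have h1 := hν.integral_inner_sq (a := ‖a‖⁻¹ • a) (by rw [norm_smul]; simp [ha'])
    have h2 : ∀ x, (inner ℝ a x) ^ 2 = ‖a‖ ^ 2 * (inner ℝ (‖a‖⁻¹ • a) x) ^ 2 := by
      intro x
      rw [inner_smul_left]
      simp
      field_simp
    simp only [h2]
    rw [integral_const_mul, h1]
    ring

theorem integral_scalar_mul_inner_sq (h : IsEllipticalDriver P ξ u) (t : Fin n)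
    (a : EuclideanSpace ℝ (Fin p)) (hξ : Integrable (fun ω => ξ t ω ^ 2) P) :
    Integrable (fun ω => (√(p : ℝ) * ξ t ω * inner ℝ a (u t ω)) ^ 2) P ∧
      ∫ ω, (√(p : ℝ) * ξ t ω * inner ℝ a (u t ω)) ^ 2 ∂P = (∫ ω, ξ t ω ^ 2 ∂P) * ‖a‖ ^ 2 := by
  have hp : (0 : ℝ) < p := by exact_mod_cast h.dim_pos t
  have hi : IndepFun (fun ω => ξ t ω ^ 2) (fun ω => (inner ℝ a (u t ω)) ^ 2) P :=
    (h.indepFun_scalar_direction t t).comp (φ := fun z => z ^ 2) (ψ := fun z => (inner ℝ a z) ^ 2)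
      (by fun_prop) (by fun_prop)
  obtain ⟨h1, h2⟩ := h.integral_direction_inner_sq t a
  have h3 : ∀ ω, (√(p : ℝ) * ξ t ω * inner ℝ a (u t ω)) ^ 2
      = p * (ξ t ω ^ 2 * (inner ℝ a (u t ω)) ^ 2) := fun ω => by
    rw [mul_pow, mul_pow, Real.sq_sqrt hp.le]; ring
  simp only [h3]
  refine ⟨(hi.integrable_mul hξ h1).const_mul _, ?_⟩
  rw [integral_const_mul]
  have h4 := hi.integral_fun_mul_eq_mul_integral hξ.aestronglyMeasurable h1.aestronglyMeasurable
  rw [h4, h2]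
  field_simp

theorem integral_huberPsi_eq_zero (h : IsEllipticalDriver P ξ u) (t : Fin n)
    (a : EuclideanSpace ℝ (Fin p)) {H : ℝ} (hH : 0 < H) (c : ℝ) :
    ∫ ω, huberPsi H (c * ξ t ω * inner ℝ a (u t ω)) ∂P = 0 := by
  have hm : Measurable fun z : ℝ × EuclideanSpace ℝ (Fin p) => huberPsi H (c * z.1 * inner ℝ a z.2) :=
    (continuous_huberPsi H).measurable.comp (by fun_prop)
  have h1 := h.integral_pair_rotate t (LinearIsometryEquiv.neg ℝ) hm
  simp only [LinearIsometryEquiv.coe_neg, inner_neg_right, mul_neg, huberPsi_neg hH,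
    integral_neg] at h1
  linarith

/-- The Huber estimate is uniformly close to the centre: the score equation is monotone in the
centre, so a deviation beyond `s` forces the score at the centre shifted by `s` to have the wrong
sign, which a Chernoff bound rules out. -/
theorem measure_huber_deviation_le (h : IsEllipticalDriver P ξ u)
    {R S : Matrix (Fin p) (Fin p) ℝ} (hR : IsPSDSqrt R S) {c : Fin p → ℝ}
    {y : Ω → Fin n → Fin p → ℝ} (hy : ∀ ω t, y ω t = ellipticalObs c R (ξ t ω) (u t ω))
    {H s l v : ℝ} {m : Ω → Fin p → ℝ} (hm : ∀ ω, IsHuberLocation H (y ω) (m ω))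
    (hH : 1 < H) (hs : 0 ≤ s) (hs1 : s ≤ 1) (hl : 0 ≤ l) (hlH : l * H ≤ 1)
    (hHv : 2 * v ≤ (H - 1) ^ 2) (hξ : ∀ t, Integrable (fun ω => ξ t ω ^ 2) P)
    (hv : ∀ t i, (∫ ω, ξ t ω ^ 2 ∂P) * S i i ≤ v) :
    P.real {ω | ∃ i, s < |m ω i - c i|}
      ≤ 2 * p * Real.exp (n * (-(l * s / 2) + l ^ 2 * (2 * v + 2))) := by
  have hH0 : 0 < H := by linarith
  set B := Real.exp (n * (-(l * s / 2) + l ^ 2 * (2 * v + 2))) with hB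
  set x : Fin p → Fin n → Ω → ℝ := fun i t ω => √(p : ℝ) * ξ t ω * inner ℝ (rowVec R i) (u t ω)
    with hx
  have hxy : ∀ ω t i, y ω t i = c i + x i t ω := by
    intro ω t i
    rw [hy, ellipticalObs, Pi.add_apply, Pi.smul_apply, mulVec_eq_inner_rowVec, smul_eq_mul]
  have hxm : ∀ i t, Measurable (x i t) := fun i t => by
    have := h.measurable_scalar t
    have := h.measurable_direction t
    fun_prop
  have hxi : ∀ i, iIndepFun (x i) P := fun i =>
    h.iIndepFun_pair.comp (fun _ z => √(p : ℝ) * z.1 * inner ℝ (rowVec R i) z.2)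
      fun _ => by fun_prop
  have hx2 : ∀ i t, Integrable (fun ω => x i t ω ^ 2) P ∧ ∫ ω, x i t ω ^ 2 ∂P ≤ v := fun i t => by
    obtain ⟨h1, h2⟩ := h.integral_scalar_mul_inner_sq t (rowVec R i) (hξ t)
    refine ⟨h1, h2.le.trans ?_⟩
    rw [hR.norm_rowVec_sq]
    exact hv t i
  have hxs : ∀ i t, ∫ ω, huberPsi H (x i t ω) ∂P = 0 := fun i t =>
    h.integral_huberPsi_eq_zero t _ hH0 _
  have hpos : ∀ i, P.real {ω | 0 ≤ ∑ t, huberPsi H (x i t ω - s)} ≤ B := fun i =>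
    measure_sum_huberPsi_nonneg_le (hxm i) (hxi i) hH hs hs1 hl hlH (fun t => (hx2 i t).1)
      (fun t => (hx2 i t).2) hHv (hxs i)
  have hneg : ∀ i, P.real {ω | 0 ≤ ∑ t, huberPsi H (-x i t ω - s)} ≤ B := fun i =>
    measure_sum_huberPsi_nonneg_le (x := fun t ω => -x i t ω) (fun t => (hxm i t).neg)
      ((hxi i).comp (fun _ z => -z) fun _ => measurable_neg) hH hs hs1 hl hlH
      (fun t => by simpa using (hx2 i t).1) (fun t => by simpa using (hx2 i t).2) hHv
      fun t => by simp only [huberPsi_neg hH0, integral_neg, hxs i t, neg_zero]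
  have hsub : {ω | ∃ i, s < |m ω i - c i|} ⊆ ⋃ i, ({ω | 0 ≤ ∑ t, huberPsi H (x i t ω - s)} ∪
      {ω | 0 ≤ ∑ t, huberPsi H (-x i t ω - s)}) := by
    rintro ω ⟨i, hi⟩
    refine Set.mem_iUnion.2 ⟨i, ?_⟩
    have h0 := hm ω i
    rcases lt_abs.1 hi with h1 | h1
    · left
      rw [Set.mem_ofPred_eq]
      rw [← h0]
      refine Finset.sum_le_sum fun t _ => huberPsi_mono H ?_
      rw [hxy]; linarith
    · right
      rw [Set.mem_ofPred_eq]
      have h2 : ∑ t, huberPsi H (-(y ω t i - m ω i)) = 0 := by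
        simp only [huberPsi_neg hH0, Finset.sum_neg_distrib, h0, neg_zero]
      rw [← h2]
      refine Finset.sum_le_sum fun t _ => huberPsi_mono H ?_
      rw [hxy]; linarith
  refine (measureReal_mono hsub (measure_ne_top _ _)).trans ?_
  refine (measureReal_iUnion_fintype_le _).trans ?_
  have : ∑ _i : Fin p, (B + B) = 2 * p * B := by simp; ring
  rw [← this]
  exact Finset.sum_le_sum fun i _ => (measureReal_union_le _ _).trans (add_le_add (hpos i) (hneg i))

end IsEllipticalDriver

/-! ### The spectral form of the scatter matrix -/

/-- The scatter matrix and its root in coordinates: `b` is an orthonormal eigenbasis, `l` lists the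
eigenvalues of the scatter matrix, `R` acts on `b i` as `√(l i)`, and `T` is the set of the `K`
indices whose eigenvalues are of order `p`. -/
structure IsFactorBasis {p : ℕ} (R : Matrix (Fin p) (Fin p) ℝ)
    (b : OrthonormalBasis (Fin p) ℝ (EuclideanSpace ℝ (Fin p))) (l : Fin p → ℝ)
    (T : Finset (Fin p)) (K : ℕ) (δ : ℝ) : Prop where
  card_top : T.card = K
  inner_root : ∀ i (x : EuclideanSpace ℝ (Fin p)),
    inner ℝ (b i) (WithLp.toLp 2 (R *ᵥ x.ofLp)) = √(l i) * inner ℝ (b i) x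
  top : ∀ i ∈ T, δ * p ≤ l i ∧ l i ≤ p / δ
  bulk : ∀ i ∉ T, δ ≤ l i ∧ l i ≤ 1 / δ
  sum_eq : ∑ i, l i = p

/-- The root is determined by its square: `(R + √λ) (R - √λ)` kills an eigenvector for `λ`, and
`R + √λ` is injective. -/
theorem IsPSDSqrt.mulVec_eigenvectorBasis {p : ℕ} {R S : Matrix (Fin p) (Fin p) ℝ}
    (h : IsPSDSqrt R S) (hS : S.IsHermitian) (i : Fin p) (hpos : 0 < hS.eigenvalues i) :
    R *ᵥ (hS.eigenvectorBasis i).ofLp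
      = √(hS.eigenvalues i) • (hS.eigenvectorBasis i).ofLp := by
  set v := (hS.eigenvectorBasis i).ofLp
  set r := √(hS.eigenvalues i) with hr
  have hr0 : 0 < r := Real.sqrt_pos.2 hpos
  have h1 : S *ᵥ v = hS.eigenvalues i • v := hS.mulVec_eigenvectorBasis i
  set z := R *ᵥ v - r • v with hz
  have h2 : R *ᵥ z = -(r • z) := by
    rw [hz, Matrix.mulVec_sub, Matrix.mulVec_mulVec, h.2, h1, Matrix.mulVec_smul, smul_sub,
      smul_smul, ← Real.sqrt_mul_self hpos.le, Real.sqrt_mul hpos.le, ← hr]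
    abel
  have h3 := h.1.dotProduct_mulVec_nonneg z
  rw [h2] at h3
  simp only [star_trivial, dotProduct_neg, dotProduct_smul, smul_eq_mul] at h3
  have h4 : z ⬝ᵥ z = 0 := by
    have h5 : 0 ≤ z ⬝ᵥ z := by simpa using dotProduct_self_star_nonneg z
    nlinarith
  have h6 : z = 0 := dotProduct_self_eq_zero.1 h4
  exact sub_eq_zero.1 h6

theorem exists_isFactorBasis {p K : ℕ} {R S : Matrix (Fin p) (Fin p) ℝ} {δ : ℝ} (hδ : 0 < δ)
    (hS : S.PosSemidef) (hR : IsPSDSqrt R S) (htr : S.trace = p) (hK : K ≤ p)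
    (hf : HasFactorStructure hS.isHermitian K δ) :
    ∃ b l T, IsFactorBasis R b l T K δ := by
  set hH := hS.isHermitian
  let e : Fin (Fintype.card (Fin p)) ≃ Fin p := Fintype.equivOfCardEq (Fintype.card_fin _)
  have he : ∀ i, hH.eigenvalues i = hH.eigenvalues₀ (e.symm i) := fun i => rfl
  let T : Finset (Fin p) := Finset.univ.filter fun i => (e.symm i : ℕ) < K
  have htop : ∀ i ∈ T, δ * p ≤ hH.eigenvalues i ∧ hH.eigenvalues i ≤ p / δ := fun i hi => by
    rw [he]; exact (hf (e.symm i)).1 (by simpa [T] using hi)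
  have hbulk : ∀ i ∉ T, δ ≤ hH.eigenvalues i ∧ hH.eigenvalues i ≤ 1 / δ := fun i hi => by
    rw [he]; exact (hf (e.symm i)).2 (by simpa [T] using hi)
  refine ⟨hH.eigenvectorBasis, hH.eigenvalues, T, ?_, ?_, htop, hbulk, ?_⟩
  · have h1 : T.card = (Finset.univ.filter fun j : Fin (Fintype.card (Fin p)) => (j : ℕ) < K).card := by
      refine Finset.card_bij (fun i _ => e.symm i) (fun i hi => by simpa [T] using hi)
        (fun i _ j _ h => e.symm.injective h) fun j hj => ⟨e j, by simpa [T] using hj, by simp⟩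
    rw [h1, Fin.card_filter_val_lt]
    simpa using hK
  · intro i x
    have hpos : 0 < hH.eigenvalues i := by
      by_cases hi : i ∈ T
      · have : (0 : ℝ) < p := by exact_mod_cast i.pos
        have := (htop i hi).1
        have : 0 < δ * p := by positivity
        linarith
      · exact hδ.trans_le (hbulk i hi).1
    have h1 := hR.mulVec_eigenvectorBasis hH i hpos
    have hRT : Rᵀ = R := by simpa using hR.1.isHermitian.eq
    simp only [EuclideanSpace.inner_eq_star_dotProduct, star_trivial]
    rw [dotProduct_comm, Matrix.dotProduct_mulVec, ← Matrix.mulVec_transpose, hRT, h1,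
      smul_dotProduct, dotProduct_comm, smul_eq_mul]
  · rw [← htr, hH.trace_eq_sum_eigenvalues]; simp

namespace IsFactorBasis

variable {p K : ℕ} {R : Matrix (Fin p) (Fin p) ℝ} {δ : ℝ}
  {b : OrthonormalBasis (Fin p) ℝ (EuclideanSpace ℝ (Fin p))} {l : Fin p → ℝ} {T : Finset (Fin p)}

theorem le_eigenvalue (hb : IsFactorBasis R b l T K δ) (hδ : 0 < δ) (i : Fin p) : δ ≤ l i := by
  by_cases hi : i ∈ T
  · have h1 : (1 : ℝ) ≤ p := by exact_mod_cast i.pos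
    exact le_trans (by nlinarith) (hb.top i hi).1
  · exact (hb.bulk i hi).1

theorem norm_root_sq (hb : IsFactorBasis R b l T K δ) (hδ : 0 < δ)
    (x : EuclideanSpace ℝ (Fin p)) :
    ‖WithLp.toLp 2 (R *ᵥ x.ofLp)‖ ^ 2 = ∑ i, l i * inner ℝ (b i) x ^ 2 := by
  rw [← b.sum_sq_norm_inner_right]
  refine Finset.sum_congr rfl fun i _ => ?_
  rw [hb.inner_root, Real.norm_eq_abs, sq_abs, mul_pow,
    Real.sq_sqrt (hδ.le.trans (hb.le_eigenvalue hδ i))]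

end IsFactorBasis

/-! ### The mean of the Kendall kernel -/

/-- Entry `(i, j)`, in the basis `b`, of the projection onto the line spanned by the image of `w`
under the operator that scales `b i` by `√(l i)`. -/
noncomputable def kendallKernel {p : ℕ} (b : OrthonormalBasis (Fin p) ℝ (EuclideanSpace ℝ (Fin p)))
    (l : Fin p → ℝ) (i j : Fin p) (w : EuclideanSpace ℝ (Fin p)) : ℝ :=
  (√(l i) * inner ℝ (b i) w) * (√(l j) * inner ℝ (b j) w) / ∑ k, l k * inner ℝ (b k) w ^ 2

section KendallKernel

variable {p : ℕ} {b : OrthonormalBasis (Fin p) ℝ (EuclideanSpace ℝ (Fin p))} {l : Fin p → ℝ}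

theorem measurable_kendallKernel (i j : Fin p) : Measurable (kendallKernel b l i j) := by
  unfold kendallKernel
  fun_prop

theorem kendallKernel_smul {c : ℝ} (hc : c ≠ 0) (i j : Fin p) (w : EuclideanSpace ℝ (Fin p)) :
    kendallKernel b l i j (c • w) = kendallKernel b l i j w := by
  simp only [kendallKernel, inner_smul_right, mul_pow]
  have h1 : ∑ k, l k * (c ^ 2 * inner ℝ (b k) w ^ 2) = c ^ 2 * ∑ k, l k * inner ℝ (b k) w ^ 2 := by
    rw [Finset.mul_sum]; exact Finset.sum_congr rfl fun k _ => by ring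
  rw [h1, show √(l i) * (c * inner ℝ (b i) w) * (√(l j) * (c * inner ℝ (b j) w))
    = c ^ 2 * (√(l i) * inner ℝ (b i) w * (√(l j) * inner ℝ (b j) w)) by ring]
  exact mul_div_mul_left _ _ (pow_ne_zero 2 hc)

/-- The kernel is a rank one projection or zero, so its entries have square sum at most one. -/
theorem sum_kendallKernel_sq_le (hl : ∀ i, 0 ≤ l i) (w : EuclideanSpace ℝ (Fin p)) :
    ∑ i, ∑ j, kendallKernel b l i j w ^ 2 ≤ 1 := by
  set Y := ∑ k, l k * inner ℝ (b k) w ^ 2 with hY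
  have h1 : ∀ i j, kendallKernel b l i j w ^ 2
      = (l i * inner ℝ (b i) w ^ 2) * (l j * inner ℝ (b j) w ^ 2) / Y ^ 2 := by
    intro i j
    rw [kendallKernel, div_pow, mul_pow, mul_pow, mul_pow, Real.sq_sqrt (hl i), Real.sq_sqrt (hl j)]
  simp only [h1, ← Finset.sum_div, ← Finset.sum_mul_sum]
  rw [← hY, ← sq]
  exact div_self_le_one _

theorem abs_kendallKernel_le (hl : ∀ i, 0 ≤ l i) (i j : Fin p) (w : EuclideanSpace ℝ (Fin p)) :
    |kendallKernel b l i j w| ≤ 1 := by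
  rw [← sq_le_one_iff_abs_le_one]
  refine le_trans ?_ (sum_kendallKernel_sq_le (b := b) hl w)
  refine le_trans ?_ (Finset.single_le_sum (f := fun i => ∑ j, kendallKernel b l i j w ^ 2)
    (fun _ _ => Finset.sum_nonneg fun _ _ => sq_nonneg _) (Finset.mem_univ i))
  exact Finset.single_le_sum (f := fun j => kendallKernel b l i j w ^ 2)
    (fun _ _ => sq_nonneg _) (Finset.mem_univ j)

variable {ν : Measure (EuclideanSpace ℝ (Fin p))}

/-- The reflection that flips the coordinate `i` flips the sign of the entry. -/
theorem integral_kendallKernel_of_ne (hν : IsRotationInvariant ν) {i j : Fin p} (hij : i ≠ j) :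
    ∫ w, kendallKernel b l i j w ∂ν = 0 := by
  set O := Submodule.reflection (Submodule.span ℝ {b i})ᗮ
  have hOi : O (b i) = -b i := Submodule.reflection_orthogonalComplement_singleton_eq_neg _
  have hOk : ∀ k, k ≠ i → O (b k) = b k := fun k hk => by
    refine Submodule.reflection_mem_subspace_eq_self ?_
    rw [Submodule.mem_orthogonal_singleton_iff_inner_right]
    exact b.inner_eq_zero hk.symm
  have h1 : ∀ k w, inner ℝ (b k) (O w) = inner ℝ (O (b k)) w := fun k w => by
    rw [← O.inner_map_map (b k) (O w), Submodule.reflection_reflection]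
  have h2 : ∀ k w, inner ℝ (b k) (O w) ^ 2 = inner ℝ (b k) w ^ 2 := fun k w => by
    rw [h1]
    by_cases hk : k = i
    · subst hk; rw [hOi, inner_neg_left, neg_sq]
    · rw [hOk k hk]
  have h3 : ∀ w, kendallKernel b l i j (O w) = -kendallKernel b l i j w := fun w => by
    simp only [kendallKernel, h2]
    rw [h1, h1, hOi, hOk j hij.symm, inner_neg_left]
    ring
  have h4 := hν.integral_comp O (kendallKernel b l i j)
  simp only [h3, integral_neg] at h4
  linarith

theorem integrable_kendallKernel [IsProbabilityMeasure ν] (hl : ∀ i, 0 ≤ l i) (i j : Fin p) :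
    Integrable (kendallKernel b l i j) ν :=
  Integrable.of_bound (measurable_kendallKernel i j).aestronglyMeasurable 1
    (ae_of_all _ fun w => abs_kendallKernel_le hl i j w)

theorem integral_kendallKernel_bulk_le [IsProbabilityMeasure ν] (hν : IsRotationInvariant ν)
    {T : Finset (Fin p)} {K : ℕ} {δ : ℝ} (hδ : 0 < δ) {R : Matrix (Fin p) (Fin p) ℝ}
    (hb : IsFactorBasis R b l T K δ) {i : Fin p} (hi : i ∉ T) :
    ∫ w, kendallKernel b l i i w ∂ν ≤ 1 / (δ ^ 2 * p) := by
  have hl : ∀ i, 0 ≤ l i := fun i => hδ.le.trans (hb.le_eigenvalue hδ i)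
  have h1 : ∫ w, kendallKernel b l i i w ∂ν ≤ ∫ w, 1 / δ ^ 2 * (inner ℝ (b i) w) ^ 2 ∂ν := by
    refine integral_mono_ae (integrable_kendallKernel hl i i) (hν.integrable (by fun_prop)) ?_
    filter_upwards [hν.norm_eq_one] with w hw
    have h2 : δ ≤ ∑ k, l k * inner ℝ (b k) w ^ 2 := by
      have h3 := b.sum_sq_norm_inner_right w
      simp only [Real.norm_eq_abs, sq_abs] at h3
      rw [hw, one_pow] at h3
      calc δ = ∑ k, δ * inner ℝ (b k) w ^ 2 := by rw [← Finset.mul_sum, h3, mul_one]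
        _ ≤ _ := Finset.sum_le_sum fun k _ =>
          mul_le_mul_of_nonneg_right (hb.le_eigenvalue hδ k) (sq_nonneg _)
    rw [kendallKernel, show √(l i) * inner ℝ (b i) w * (√(l i) * inner ℝ (b i) w)
      = √(l i) ^ 2 * inner ℝ (b i) w ^ 2 by ring, Real.sq_sqrt (hl i),
      show 1 / δ ^ 2 * inner ℝ (b i) w ^ 2 = (1 / δ * inner ℝ (b i) w ^ 2) / δ by
        field_simp]
    exact div_le_div₀ (by positivity)
      (mul_le_mul_of_nonneg_right (hb.bulk i hi).2 (sq_nonneg _)) hδ h2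
  rw [integral_const_mul, hν.integral_inner_sq (b.norm_eq_one i)] at h1
  refine h1.trans (le_of_eq ?_)
  rw [div_mul_div_comm, one_mul]

/-- The tangent bound `X / Y ≥ 2 θ √X - θ² Y` reduces the claim to the first absolute moment of a
coordinate and the mean of the quadratic form, which is one. -/
theorem le_integral_kendallKernel_top [IsProbabilityMeasure ν] (hν : IsRotationInvariant ν)
    {T : Finset (Fin p)} {K : ℕ} {δ : ℝ} (hδ : 0 < δ) {R : Matrix (Fin p) (Fin p) ℝ}
    (hb : IsFactorBasis R b l T K δ) {i : Fin p} (hi : i ∈ T) :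
    δ / 24 ≤ ∫ w, kendallKernel b l i i w ∂ν := by
  have hl : ∀ i, 0 ≤ l i := fun i => hδ.le.trans (hb.le_eigenvalue hδ i)
  have hp : (0 : ℝ) < p := by exact_mod_cast i.pos
  set θ : ℝ := √δ / (2 * √6) with hθ
  have hθ2 : θ ^ 2 = δ / 24 := by
    rw [hθ, div_pow, mul_pow, Real.sq_sqrt hδ.le, Real.sq_sqrt (by norm_num)]; norm_num
  have hθ0 : 0 ≤ θ := by positivity
  have h1 : ∫ w, (2 * θ * √(l i) * |inner ℝ (b i) w|
      - θ ^ 2 * ∑ k, l k * inner ℝ (b k) w ^ 2) ∂ν ≤ ∫ w, kendallKernel b l i i w ∂ν := by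
    refine integral_mono (hν.integrable (by fun_prop)) (integrable_kendallKernel hl i i) fun w => ?_
    simp only
    rw [kendallKernel, show √(l i) * inner ℝ (b i) w * (√(l i) * inner ℝ (b i) w)
      = (√(l i) * |inner ℝ (b i) w|) ^ 2 by rw [mul_pow, sq_abs]; ring]
    set X := √(l i) * |inner ℝ (b i) w| with hX
    have hXY : X ^ 2 ≤ ∑ k, l k * inner ℝ (b k) w ^ 2 := by
      rw [hX, mul_pow, Real.sq_sqrt (hl i), sq_abs]
      exact Finset.single_le_sum (f := fun k => l k * inner ℝ (b k) w ^ 2)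
        (fun k _ => mul_nonneg (hl k) (sq_nonneg _)) (Finset.mem_univ i)
    set Y := ∑ k, l k * inner ℝ (b k) w ^ 2
    rcases (le_trans (sq_nonneg X) hXY).eq_or_lt with hY | hY
    · have : X = 0 := by nlinarith [sq_nonneg X]
      rw [mul_assoc, ← hX, this, ← hY]; simp
    · rw [le_div_iff₀ hY, mul_assoc, ← hX]
      nlinarith [sq_nonneg (X - θ * Y)]
  refine le_trans ?_ h1
  rw [integral_sub (hν.integrable (by fun_prop)) (hν.integrable (by fun_prop)),
    integral_const_mul, integral_const_mul,
    integral_finsetSum _ fun i _ => hν.integrable (by fun_prop)]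
  have h2 : ∑ k, ∫ w, l k * inner ℝ (b k) w ^ 2 ∂ν = 1 := by
    have : ∀ k, ∫ w, l k * inner ℝ (b k) w ^ 2 ∂ν = l k / p := fun k => by
      rw [integral_const_mul, hν.integral_inner_sq (b.norm_eq_one k), mul_one_div]
    simp only [this]
    rw [← Finset.sum_div, hb.sum_eq, div_self hp.ne']
  rw [h2, mul_one, hθ2]
  have h3 := hν.le_integral_abs_inner (b.norm_eq_one i)
  have h4 : √δ * √p ≤ √(l i) := by
    rw [← Real.sqrt_mul hδ.le]; exact Real.sqrt_le_sqrt (hb.top i hi).1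
  have h5 : θ ≤ √(l i) * ∫ w, |inner ℝ (b i) w| ∂ν := by
    calc θ = √δ * √p * (1 / (2 * √6 * √p)) := by
          have : √(p : ℝ) ≠ 0 := (Real.sqrt_pos.2 hp).ne'
          rw [hθ]; field_simp
      _ ≤ _ := mul_le_mul h4 h3 (by positivity) (Real.sqrt_nonneg _)
  have h6 := mul_le_mul_of_nonneg_left h5 hθ0
  nlinarith

end KendallKernel

/-! ### The spatial Kendall matrix concentrates -/

/-- The pairs `(s, t)` with `s < t`. -/
def orderedPairs (n : ℕ) : Finset (Fin n × Fin n) := Finset.univ.filter fun e => e.1 < e.2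

theorem sum_sum_Ioi_eq_sum_orderedPairs {n : ℕ} {M : Type*} [AddCommMonoid M]
    (f : Fin n → Fin n → M) :
    ∑ s, ∑ t ∈ Finset.Ioi s, f s t = ∑ e ∈ orderedPairs n, f e.1 e.2 := by
  rw [orderedPairs, Finset.sum_filter, ← Finset.univ_product_univ, Finset.sum_product]
  refine Finset.sum_congr rfl fun s _ => ?_
  rw [← Finset.sum_filter]
  refine Finset.sum_congr ?_ fun _ _ => rfl
  ext t; simp

theorem card_orderedPairs (n : ℕ) : ((orderedPairs n).card : ℝ) = n * (n - 1) / 2 := by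
  have h1 : (orderedPairs n).card = ∑ s : Fin n, (n - 1 - (s : ℕ)) := by
    rw [Finset.card_eq_sum_ones, ← sum_sum_Ioi_eq_sum_orderedPairs (fun _ _ => 1)]
    simp
  rw [h1, Fin.sum_univ_eq_sum_range (fun i => n - 1 - i) n, Finset.sum_range_reflect (fun i => i) n,
    Finset.sum_range_id]
  rw [Nat.cast_div (Nat.even_mul_pred_self n).two_dvd (by norm_num)]
  rcases n with _ | n
  · simp
  · push_cast; simp

/-- The average of a function over the pairs `(s, t)` with `s < t`. -/
noncomputable def pairAverage {n : ℕ} (f : Fin n × Fin n → ℝ) : ℝ :=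
  2 / ((n : ℝ) * ((n : ℝ) - 1)) * ∑ e ∈ orderedPairs n, f e

theorem pairAverage_le {n : ℕ} (hn : 2 ≤ n) {f : Fin n × Fin n → ℝ} {c : ℝ}
    (h : ∀ e, e.1 ≠ e.2 → f e ≤ c) : pairAverage f ≤ c := by
  have hn' : (2 : ℝ) ≤ n := by exact_mod_cast hn
  have h1 : (0 : ℝ) < n * (n - 1) := by nlinarith
  have h2 : ∑ e ∈ orderedPairs n, f e ≤ n * (n - 1) / 2 * c := by
    rw [← card_orderedPairs, ← nsmul_eq_mul]
    exact Finset.sum_le_card_nsmul _ _ _ fun e he => h e (ne_of_lt (Finset.mem_filter.1 he).2)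
  rw [pairAverage, div_mul_eq_mul_div, div_le_iff₀ h1]
  linarith

theorem pairAverage_neg {n : ℕ} (f : Fin n × Fin n → ℝ) :
    pairAverage (fun e => -f e) = -pairAverage f := by
  simp [pairAverage]

theorem le_pairAverage {n : ℕ} (hn : 2 ≤ n) {f : Fin n × Fin n → ℝ} {c : ℝ}
    (h : ∀ e, e.1 ≠ e.2 → c ≤ f e) : c ≤ pairAverage f := by
  have := pairAverage_le hn (f := fun e => -f e) (c := -c) fun e he => neg_le_neg (h e he)
  rw [pairAverage_neg] at this
  linarith

theorem card_filter_meets_le {n : ℕ} (e : Fin n × Fin n) :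
    ((orderedPairs n).filter fun f => f.1 = e.1 ∨ f.1 = e.2 ∨ f.2 = e.1 ∨ f.2 = e.2).card
      ≤ 4 * n := by
  have h1 : ∀ a : Fin n, (Finset.univ.filter fun f : Fin n × Fin n => f.1 = a).card ≤ n := fun a => by
    refine (Finset.card_le_card (t := {a} ×ˢ Finset.univ) fun f hf => ?_).trans (by simp)
    rw [Finset.mem_product]
    simpa using hf
  have h2 : ∀ a : Fin n, (Finset.univ.filter fun f : Fin n × Fin n => f.2 = a).card ≤ n := fun a => by
    refine (Finset.card_le_card (t := Finset.univ ×ˢ {a}) fun f hf => ?_).trans (by simp)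
    rw [Finset.mem_product]
    simpa using hf
  refine (Finset.card_le_card (t := Finset.univ.filter fun f : Fin n × Fin n => f.1 = e.1 ∨ f.1 = e.2 ∨
    f.2 = e.1 ∨ f.2 = e.2) (Finset.filter_subset_filter _ (Finset.subset_univ _))).trans ?_
  simp only [Finset.filter_or]
  refine (Finset.card_union_le _ _).trans ?_
  have := (Finset.card_union_le (Finset.univ.filter fun f : Fin n × Fin n => f.1 = e.2)
    ((Finset.univ.filter fun f : Fin n × Fin n => f.2 = e.1) ∪
      Finset.univ.filter fun f : Fin n × Fin n => f.2 = e.2))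
  have := (Finset.card_union_le (Finset.univ.filter fun f : Fin n × Fin n => f.2 = e.1)
      (Finset.univ.filter fun f : Fin n × Fin n => f.2 = e.2))
  have := h1 e.1
  have := h1 e.2
  have := h2 e.1
  have := h2 e.2
  omega

section PairSums

variable {Ω : Type*} [MeasurableSpace Ω] {P : Measure Ω} [IsProbabilityMeasure P]

/-- Second moment of a sum over pairs in which the terms of disjoint pairs are uncorrelated: only
the at most `4 n` pairs meeting a given one contribute. -/
theorem integral_sum_orderedPairs_sq_le {n : ℕ} {X : Fin n × Fin n → Ω → ℝ}
    (hX : ∀ e, Measurable (X e)) (hb : ∀ e ω, |X e ω| ≤ 2)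
    (hunc : ∀ e ∈ orderedPairs n, ∀ f ∈ orderedPairs n,
      ¬(f.1 = e.1 ∨ f.1 = e.2 ∨ f.2 = e.1 ∨ f.2 = e.2) → ∫ ω, X e ω * X f ω ∂P = 0) :
    ∫ ω, (∑ e ∈ orderedPairs n, X e ω) ^ 2 ∂P
      ≤ 4 * n * ∑ e ∈ orderedPairs n, ∫ ω, X e ω ^ 2 ∂P := by
  have hi : ∀ e f, Integrable (fun ω => X e ω * X f ω) P := fun e f =>
    Integrable.of_bound ((hX e).mul (hX f)).aestronglyMeasurable 4 (ae_of_all _ fun ω => by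
      rw [Real.norm_eq_abs, abs_mul]
      nlinarith [hb e ω, hb f ω, abs_nonneg (X e ω), abs_nonneg (X f ω)])
  have hi2 : ∀ e, Integrable (fun ω => X e ω ^ 2) P := fun e => by simpa only [sq] using hi e e
  set M : Fin n × Fin n → Fin n × Fin n → Prop := fun e f =>
    f.1 = e.1 ∨ f.1 = e.2 ∨ f.2 = e.1 ∨ f.2 = e.2 with hM
  have hMs : ∀ e f, M e f ↔ M f e := fun e f => by
    simp only [hM, eq_comm]; tauto
  have h1 : ∫ ω, (∑ e ∈ orderedPairs n, X e ω) ^ 2 ∂P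
      = ∑ e ∈ orderedPairs n, ∑ f ∈ orderedPairs n, ∫ ω, X e ω * X f ω ∂P := by
    simp only [sq, Finset.sum_mul_sum]
    rw [integral_finsetSum _ fun e _ => integrable_finsetSum _ fun f _ => hi e f]
    exact Finset.sum_congr rfl fun e _ => integral_finsetSum _ fun f _ => hi e f
  have h2 : ∀ e ∈ orderedPairs n, ∀ f ∈ orderedPairs n, ∫ ω, X e ω * X f ω ∂P
      ≤ (if M e f then (∫ ω, X e ω ^ 2 ∂P) / 2 else 0)
        + (if M f e then (∫ ω, X f ω ^ 2 ∂P) / 2 else 0) := by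
    intro e he f hf
    by_cases hm : M e f
    · rw [if_pos hm, if_pos ((hMs e f).1 hm), ← add_div, ← integral_add (hi2 e) (hi2 f),
        ← integral_div]
      refine integral_mono (hi e f) (((hi2 e).add (hi2 f)).div_const 2) fun ω => ?_
      simp only
      nlinarith [sq_nonneg (X e ω - X f ω)]
    · rw [if_neg hm, if_neg fun h => hm ((hMs e f).2 h), hunc e he f hf hm, add_zero]
  have h3 : ∀ e ∈ orderedPairs n, ∑ f ∈ orderedPairs n,
      (if M e f then (∫ ω, X e ω ^ 2 ∂P) / 2 else 0) ≤ 2 * n * ∫ ω, X e ω ^ 2 ∂P := by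
    intro e _
    have h0 : 0 ≤ ∫ ω, X e ω ^ 2 ∂P := integral_nonneg fun ω => sq_nonneg _
    rw [← Finset.sum_filter, Finset.sum_const, nsmul_eq_mul]
    have h4 : (((orderedPairs n).filter fun f => M e f).card : ℝ) ≤ 4 * n := by
      exact_mod_cast card_filter_meets_le e
    nlinarith
  calc ∫ ω, (∑ e ∈ orderedPairs n, X e ω) ^ 2 ∂P
      ≤ ∑ e ∈ orderedPairs n, ∑ f ∈ orderedPairs n,
        ((if M e f then (∫ ω, X e ω ^ 2 ∂P) / 2 else 0)
        + (if M f e then (∫ ω, X f ω ^ 2 ∂P) / 2 else 0)) := by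
        rw [h1]
        exact Finset.sum_le_sum fun e he => Finset.sum_le_sum fun f hf => h2 e he f hf
    _ = (∑ e ∈ orderedPairs n, ∑ f ∈ orderedPairs n,
          if M e f then (∫ ω, X e ω ^ 2 ∂P) / 2 else 0)
        + ∑ f ∈ orderedPairs n, ∑ e ∈ orderedPairs n,
          if M f e then (∫ ω, X f ω ^ 2 ∂P) / 2 else 0 := by
        simp only [Finset.sum_add_distrib]
        congr 1
        exact Finset.sum_comm
    _ ≤ ∑ e ∈ orderedPairs n, 2 * n * ∫ ω, X e ω ^ 2 ∂P
        + ∑ e ∈ orderedPairs n, 2 * n * ∫ ω, X e ω ^ 2 ∂P :=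
        add_le_add (Finset.sum_le_sum h3) (Finset.sum_le_sum h3)
    _ = _ := by rw [← Finset.mul_sum]; ring

end PairSums

/-- The difference of two scaled directions, whose image under the root of the scatter matrix is
the difference of two observations up to the factor `√p`. -/
noncomputable def pairDiff {n p : ℕ} {Ω : Type*} (ξ : Fin n → Ω → ℝ)
    (u : Fin n → Ω → EuclideanSpace ℝ (Fin p)) (e : Fin n × Fin n) (ω : Ω) :
    EuclideanSpace ℝ (Fin p) := ξ e.1 ω • u e.1 ω - ξ e.2 ω • u e.2 ω

/-- Entry `(i, j)` of a matrix in the orthonormal basis `b`. -/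
noncomputable def entryIn {p : ℕ} (b : OrthonormalBasis (Fin p) ℝ (EuclideanSpace ℝ (Fin p)))
    (A : Matrix (Fin p) (Fin p) ℝ) (i j : Fin p) : ℝ :=
  inner ℝ (b i) (WithLp.toLp 2 (A *ᵥ (b j).ofLp))

theorem entryIn_kendallTau {n p K : ℕ} {Ω : Type*} {ξ : Fin n → Ω → ℝ}
    {u : Fin n → Ω → EuclideanSpace ℝ (Fin p)} {R : Matrix (Fin p) (Fin p) ℝ} {δ : ℝ}
    {b : OrthonormalBasis (Fin p) ℝ (EuclideanSpace ℝ (Fin p))} {l : Fin p → ℝ}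
    {T : Finset (Fin p)} (hδ : 0 < δ) (hb : IsFactorBasis R b l T K δ) {c : Fin p → ℝ} {ω : Ω}
    {y : Fin n → Fin p → ℝ} (hy : ∀ t, y t = ellipticalObs c R (ξ t ω) (u t ω)) (i j : Fin p) :
    entryIn b (kendallTau y) i j
      = pairAverage fun e => kendallKernel b l i j (pairDiff ξ u e ω) := by
  have hp : (0 : ℝ) < p := by exact_mod_cast i.pos
  have h1 : ∀ s t, WithLp.toLp 2 (y s - y t)
      = √(p : ℝ) • WithLp.toLp 2 (R *ᵥ (pairDiff ξ u (s, t) ω).ofLp) := by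
    intro s t
    rw [← WithLp.toLp_smul]
    congr 1
    simp only [hy, ellipticalObs, pairDiff, WithLp.ofLp_sub, WithLp.ofLp_smul, Matrix.mulVec_sub,
      Matrix.mulVec_smul, smul_sub, smul_smul]
    abel
  have h2 : ∀ s t, l2norm (y s - y t) ^ 2
      = p * ∑ k, l k * inner ℝ (b k) (pairDiff ξ u (s, t) ω) ^ 2 := by
    intro s t
    rw [l2norm, h1, norm_smul, mul_pow, hb.norm_root_sq hδ, Real.norm_eq_abs, sq_abs,
      Real.sq_sqrt hp.le]
  have h3 : ∀ s t k, inner ℝ (b k) (WithLp.toLp 2 (y s - y t))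
      = √(p : ℝ) * (√(l k) * inner ℝ (b k) (pairDiff ξ u (s, t) ω)) := by
    intro s t k
    rw [h1, inner_smul_right, hb.inner_root]
  have h4 : ∀ s t, inner ℝ (b i) (WithLp.toLp 2 (((1 / l2norm (y s - y t) ^ 2) •
      Matrix.vecMulVec (y s - y t) (y s - y t)) *ᵥ (b j).ofLp))
      = kendallKernel b l i j (pairDiff ξ u (s, t) ω) := by
    intro s t
    have h5 : (y s - y t) ⬝ᵥ (b j).ofLp = inner ℝ (b j) (WithLp.toLp 2 (y s - y t)) := by
      simp [EuclideanSpace.inner_eq_star_dotProduct]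
    rw [Matrix.smul_mulVec, Matrix.vecMulVec_mulVec, WithLp.toLp_smul, inner_smul_right,
      h5, h2, op_smul_eq_smul, WithLp.toLp_smul, inner_smul_right, h3, h3, kendallKernel]
    set Y := ∑ k, l k * inner ℝ (b k) (pairDiff ξ u (s, t) ω) ^ 2
    have h6 : √(p : ℝ) * √(p : ℝ) = p := Real.mul_self_sqrt hp.le
    rw [show ∀ A B : ℝ, 1 / (p * Y) * (√(p : ℝ) * A * (√(p : ℝ) * B))
      = (√(p : ℝ) * √(p : ℝ)) * (B * A) / (p * Y) from fun A B => by ring, h6]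
    exact mul_div_mul_left _ _ hp.ne'
  rw [entryIn, pairAverage, kendallTau, Matrix.smul_mulVec, WithLp.toLp_smul, inner_smul_right,
    sum_sum_Ioi_eq_sum_orderedPairs (fun s t => (1 / l2norm (y s - y t) ^ 2) •
      Matrix.vecMulVec (y s - y t) (y s - y t)), Matrix.sum_mulVec, WithLp.toLp_sum, inner_sum]
  congr 1
  exact Finset.sum_congr rfl fun e _ => h4 e.1 e.2

namespace IsEllipticalDriver

variable {n p : ℕ} {Ω : Type*} [MeasurableSpace Ω] {P : Measure Ω}
  {ξ : Fin n → Ω → ℝ} {u : Fin n → Ω → EuclideanSpace ℝ (Fin p)}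

theorem measurable_pairDiff (h : IsEllipticalDriver P ξ u) (e : Fin n × Fin n) :
    Measurable (pairDiff ξ u e) :=
  ((h.measurable_scalar _).smul (h.measurable_direction _)).sub
    ((h.measurable_scalar _).smul (h.measurable_direction _))

theorem ae_pairDiff_ne_zero [IsProbabilityMeasure P]
    (h : IsEllipticalDriver P ξ u) (hp : 2 ≤ p) (hpos : ∀ t, ∀ᵐ ω ∂P, 0 < ξ t ω)
    {e : Fin n × Fin n} (he : e.1 ≠ e.2) :
    ∀ᵐ ω ∂P, pairDiff ξ u e ω ≠ 0 := by
  filter_upwards [h.ae_direction_ne hp he, hpos e.1, hpos e.2, h.norm_direction e.1,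
    h.norm_direction e.2] with ω h1 h2 h3 h4 h5 h0
  have h6 : ξ e.1 ω • u e.1 ω = ξ e.2 ω • u e.2 ω := sub_eq_zero.1 h0
  have h7 := congrArg norm h6
  rw [norm_smul, norm_smul, h4, h5, Real.norm_eq_abs, Real.norm_eq_abs, abs_of_pos h2,
    abs_of_pos h3, mul_one, mul_one] at h7
  rw [h7] at h6
  exact h1 (smul_right_injective _ h3.ne' h6)

theorem isRotationInvariant_map_pairDiff [IsProbabilityMeasure P]
    (h : IsEllipticalDriver P ξ u) (hp : 2 ≤ p) (hpos : ∀ t, ∀ᵐ ω ∂P, 0 < ξ t ω)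
    {e : Fin n × Fin n} (he : e.1 ≠ e.2) :
    IsRotationInvariant (P.map fun ω => ‖pairDiff ξ u e ω‖⁻¹ • pairDiff ξ u e ω) := by
  have hm : Measurable fun ω => ‖pairDiff ξ u e ω‖⁻¹ • pairDiff ξ u e ω := by
    have := h.measurable_pairDiff e
    fun_prop
  constructor
  · intro O
    have hO : Measurable O := O.continuous.measurable
    let g : (ℝ × EuclideanSpace ℝ (Fin p)) × (ℝ × EuclideanSpace ℝ (Fin p)) →
        EuclideanSpace ℝ (Fin p) := fun z =>
      ‖z.1.1 • z.1.2 - z.2.1 • z.2.2‖⁻¹ • (z.1.1 • z.1.2 - z.2.1 • z.2.2)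
    have hg : Measurable g := by fun_prop
    have h1 := congrArg (Measure.map g) (h.map_two_pairs_rotate he O)
    have hm' : ∀ r, Measurable fun ω => (ξ r ω, O (u r ω)) := fun r =>
      (h.measurable_scalar r).prodMk (hO.comp (h.measurable_direction r))
    rw [Measure.map_map hg ((hm' e.1).prodMk (hm' e.2)),
      Measure.map_map hg ((h.measurable_pair e.1).prodMk (h.measurable_pair e.2))] at h1
    rw [Measure.map_map hO hm]
    refine Eq.trans ?_ h1
    congr 1
    ext1 ω
    simp only [Function.comp, g, pairDiff]
    rw [← map_smul O (ξ e.1 ω), ← map_smul O (ξ e.2 ω), ← map_sub, O.norm_map, map_smul]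
  · rw [ae_map_iff hm.aemeasurable (measurableSet_eq_fun (by fun_prop) (by fun_prop))]
    filter_upwards [h.ae_pairDiff_ne_zero hp hpos he] with ω hω
    rw [norm_smul, norm_inv, norm_norm, inv_mul_cancel₀ (norm_ne_zero_iff.2 hω)]

theorem integral_kendallKernel_pairDiff [IsProbabilityMeasure P]
    (h : IsEllipticalDriver P ξ u) (hp : 2 ≤ p) (hpos : ∀ t, ∀ᵐ ω ∂P, 0 < ξ t ω)
    {e : Fin n × Fin n} (he : e.1 ≠ e.2)
    {b : OrthonormalBasis (Fin p) ℝ (EuclideanSpace ℝ (Fin p))} {l : Fin p → ℝ} (i j : Fin p) :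
    ∫ w, kendallKernel b l i j w ∂(P.map fun ω => ‖pairDiff ξ u e ω‖⁻¹ • pairDiff ξ u e ω)
      = ∫ ω, kendallKernel b l i j (pairDiff ξ u e ω) ∂P := by
  have hm : Measurable fun ω => ‖pairDiff ξ u e ω‖⁻¹ • pairDiff ξ u e ω := by
    have := h.measurable_pairDiff e
    fun_prop
  rw [integral_map hm.aemeasurable (measurable_kendallKernel i j).aestronglyMeasurable]
  refine integral_congr_ae ?_
  filter_upwards [h.ae_pairDiff_ne_zero hp hpos he] with ω hω
  exact kendallKernel_smul (inv_ne_zero (norm_ne_zero_iff.2 hω)) i j _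

variable {b : OrthonormalBasis (Fin p) ℝ (EuclideanSpace ℝ (Fin p))} {l : Fin p → ℝ}

/-- Summed over all entries, the sample average of the kernel has variance of order `1 / n`: the
entries of one kernel have square sum at most one, whatever the dimension. -/
theorem integral_sum_kendall_sub_mean_sq_le [IsProbabilityMeasure P]
    (h : IsEllipticalDriver P ξ u) (hn : 2 ≤ n)
    (hl : ∀ i, 0 ≤ l i) :
    Integrable (fun ω => ∑ i, ∑ j, (pairAverage (fun e => kendallKernel b l i j (pairDiff ξ u e ω))
      - pairAverage (fun e => ∫ ω', kendallKernel b l i j (pairDiff ξ u e ω') ∂P)) ^ 2) P ∧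
    ∫ ω, ∑ i, ∑ j, (pairAverage (fun e => kendallKernel b l i j (pairDiff ξ u e ω))
      - pairAverage (fun e => ∫ ω', kendallKernel b l i j (pairDiff ξ u e ω') ∂P)) ^ 2 ∂P
      ≤ 16 / (n : ℝ) := by
  simp only [pairAverage]
  have hn' : (2 : ℝ) ≤ n := by exact_mod_cast hn
  set a : ℝ := 2 / ((n : ℝ) * ((n : ℝ) - 1)) with ha
  set m : Fin p → Fin p → Fin n × Fin n → ℝ := fun i j e =>
    ∫ ω', kendallKernel b l i j (pairDiff ξ u e ω') ∂P with hmdef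
  set X : Fin p → Fin p → Fin n × Fin n → Ω → ℝ := fun i j e ω =>
    kendallKernel b l i j (pairDiff ξ u e ω) - m i j e with hX
  have hk : ∀ i j e, Measurable fun ω => kendallKernel b l i j (pairDiff ξ u e ω) := fun i j e =>
    (measurable_kendallKernel i j).comp (h.measurable_pairDiff e)
  have hki : ∀ i j e, Integrable (fun ω => kendallKernel b l i j (pairDiff ξ u e ω)) P :=
    fun i j e => Integrable.of_bound (hk i j e).aestronglyMeasurable 1
      (ae_of_all _ fun ω => abs_kendallKernel_le hl i j _)
  have hXm : ∀ i j e, Measurable (X i j e) := fun i j e => (hk i j e).sub_const _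
  have hmb : ∀ i j e, |m i j e| ≤ 1 := fun i j e => by
    have := norm_integral_le_of_norm_le_const (μ := P) (C := 1)
      (f := fun ω => kendallKernel b l i j (pairDiff ξ u e ω))
      (ae_of_all _ fun ω => abs_kendallKernel_le (b := b) hl i j (pairDiff ξ u e ω))
    simpa using this
  have hXb : ∀ i j e ω, |X i j e ω| ≤ 2 := fun i j e ω => by
    refine (abs_sub _ _).trans ?_
    have := abs_kendallKernel_le (b := b) hl i j (pairDiff ξ u e ω)
    linarith [hmb i j e]
  have hX0 : ∀ i j e, ∫ ω, X i j e ω ∂P = 0 := fun i j e => by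
    simp only [hX]
    rw [integral_sub (hki i j e) (integrable_const _)]
    simp [hmdef]
  have hunc : ∀ i j, ∀ e ∈ orderedPairs n, ∀ f ∈ orderedPairs n,
      ¬(f.1 = e.1 ∨ f.1 = e.2 ∨ f.2 = e.1 ∨ f.2 = e.2) →
      ∫ ω, X i j e ω * X i j f ω ∂P = 0 := by
    intro i j e _ f _ hef
    push Not at hef
    have h1 := h.iIndepFun_pair.indepFun_prodMk_prodMk h.measurable_pair e.1 e.2 f.1 f.2
      hef.1.symm hef.2.2.1.symm hef.2.1.symm hef.2.2.2.symm
    have h2 : ∀ c : ℝ, Measurable fun z : (ℝ × EuclideanSpace ℝ (Fin p)) ×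
        (ℝ × EuclideanSpace ℝ (Fin p)) =>
        kendallKernel b l i j (z.1.1 • z.1.2 - z.2.1 • z.2.2) - c := fun c =>
      ((measurable_kendallKernel i j).comp (by fun_prop)).sub_const c
    have h3 : IndepFun (X i j e) (X i j f) P := h1.comp (h2 (m i j e)) (h2 (m i j f))
    rw [h3.integral_fun_mul_eq_mul_integral (hXm i j e).aestronglyMeasurable
      (hXm i j f).aestronglyMeasurable, hX0, zero_mul]
  have h1 : ∀ i j ω, (a * ∑ e ∈ orderedPairs n, kendallKernel b l i j (pairDiff ξ u e ω)
      - a * ∑ e ∈ orderedPairs n, m i j e) ^ 2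
      = a ^ 2 * (∑ e ∈ orderedPairs n, X i j e ω) ^ 2 := fun i j ω => by
    simp only [hX, Finset.sum_sub_distrib]; ring
  have hS : ∀ i j, Integrable (fun ω => a ^ 2 * (∑ e ∈ orderedPairs n, X i j e ω) ^ 2) P := by
    intro i j
    refine Integrable.const_mul ?_ _
    refine Integrable.of_bound (C := (∑ e ∈ orderedPairs n, (2 : ℝ)) ^ 2) ?_
      (ae_of_all _ fun ω => ?_)
    · exact ((Finset.measurable_sum _ fun e _ => hXm i j e).pow_const 2).aestronglyMeasurable
    · rw [Real.norm_eq_abs, abs_of_nonneg (sq_nonneg _), ← sq_abs]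
      exact pow_le_pow_left₀ (abs_nonneg _) ((Finset.abs_sum_le_sum_abs _ _).trans
        (Finset.sum_le_sum fun e _ => hXb i j e ω)) 2
  -- the variance of one kernel is at most its second moment
  have hone : ∀ e, ∑ i, ∑ j, ∫ ω, X i j e ω ^ 2 ∂P ≤ 1 := by
    intro e
    have h2 : ∀ i j, ∫ ω, X i j e ω ^ 2 ∂P
        ≤ ∫ ω, kendallKernel b l i j (pairDiff ξ u e ω) ^ 2 ∂P := by
      intro i j
      have hki2 : Integrable (fun ω => kendallKernel b l i j (pairDiff ξ u e ω) ^ 2) P :=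
        Integrable.of_bound ((hk i j e).pow_const 2).aestronglyMeasurable 1 (ae_of_all _ fun ω => by
          rw [Real.norm_eq_abs, abs_of_nonneg (sq_nonneg _)]
          exact (sq_le_one_iff_abs_le_one _).2 (abs_kendallKernel_le hl i j _))
      have h3 : ∀ ω, X i j e ω ^ 2 = kendallKernel b l i j (pairDiff ξ u e ω) ^ 2
          - 2 * m i j e * kendallKernel b l i j (pairDiff ξ u e ω) + m i j e ^ 2 := fun ω => by
        simp only [hX]; ring
      have h5 : Integrable (fun ω => kendallKernel b l i j (pairDiff ξ u e ω) ^ 2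
          - 2 * m i j e * kendallKernel b l i j (pairDiff ξ u e ω)) P :=
        hki2.sub ((hki i j e).const_mul _)
      simp only [h3]
      rw [integral_add h5 (integrable_const _),
        integral_sub hki2 ((hki i j e).const_mul _), integral_const_mul]
      have : ∫ ω, kendallKernel b l i j (pairDiff ξ u e ω) ∂P = m i j e := rfl
      rw [this]
      simp only [integral_const, probReal_univ, smul_eq_mul, one_mul]
      nlinarith [sq_nonneg (m i j e)]
    have hki2 : ∀ i j, Integrable (fun ω => kendallKernel b l i j (pairDiff ξ u e ω) ^ 2) P :=
      fun i j => Integrable.of_bound ((hk i j e).pow_const 2).aestronglyMeasurable 1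
        (ae_of_all _ fun ω => by
          rw [Real.norm_eq_abs, abs_of_nonneg (sq_nonneg _)]
          exact (sq_le_one_iff_abs_le_one _).2 (abs_kendallKernel_le hl i j _))
    refine (Finset.sum_le_sum fun i _ => Finset.sum_le_sum fun j _ => h2 i j).trans ?_
    have h4 : ∑ i, ∑ j, ∫ ω, kendallKernel b l i j (pairDiff ξ u e ω) ^ 2 ∂P
        = ∫ ω, ∑ i, ∑ j, kendallKernel b l i j (pairDiff ξ u e ω) ^ 2 ∂P := by
      rw [integral_finsetSum _ fun i _ => integrable_finsetSum _ fun j _ => hki2 i j]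
      exact Finset.sum_congr rfl fun i _ => (integral_finsetSum _ fun j _ => hki2 i j).symm
    rw [h4]
    refine (integral_mono (integrable_finsetSum _ fun i _ => integrable_finsetSum _ fun j _ =>
      hki2 i j) (integrable_const 1) fun ω => sum_kendallKernel_sq_le hl _).trans ?_
    simp
  simp only [hmdef] at h1
  simp only [h1]
  refine ⟨integrable_finsetSum _ fun i _ => integrable_finsetSum _ fun j _ => hS i j, ?_⟩
  rw [integral_finsetSum _ fun i _ => integrable_finsetSum _ fun j _ => hS i j]
  have h5 : ∀ i, ∫ ω, ∑ j, a ^ 2 * (∑ e ∈ orderedPairs n, X i j e ω) ^ 2 ∂P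
      ≤ ∑ j, a ^ 2 * (4 * n * ∑ e ∈ orderedPairs n, ∫ ω, X i j e ω ^ 2 ∂P) := fun i => by
    rw [integral_finsetSum _ fun j _ => hS i j]
    refine Finset.sum_le_sum fun j _ => ?_
    rw [integral_const_mul]
    exact mul_le_mul_of_nonneg_left (integral_sum_orderedPairs_sq_le (hXm i j) (hXb i j)
      (hunc i j)) (sq_nonneg a)
  refine (Finset.sum_le_sum fun i _ => h5 i).trans ?_
  have h6 : ∑ i, ∑ j, a ^ 2 * (4 * n * ∑ e ∈ orderedPairs n, ∫ ω, X i j e ω ^ 2 ∂P)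
      = a ^ 2 * (4 * n) * ∑ e ∈ orderedPairs n, ∑ i, ∑ j, ∫ ω, X i j e ω ^ 2 ∂P := by
    simp only [← mul_assoc, ← Finset.mul_sum]
    congr 1
    rw [Finset.sum_comm (s := orderedPairs n)]
    exact Finset.sum_congr rfl fun i _ => Finset.sum_comm
  rw [h6]
  have h7 : ∑ e ∈ orderedPairs n, ∑ i, ∑ j, ∫ ω, X i j e ω ^ 2 ∂P ≤ n * (n - 1) / 2 := by
    rw [← card_orderedPairs]
    refine (Finset.sum_le_sum fun e _ => hone e).trans ?_
    simp
  refine (mul_le_mul_of_nonneg_left h7 (by positivity)).trans ?_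
  have h8 : (0 : ℝ) < n - 1 := by linarith
  have h9 : (0 : ℝ) < n := by linarith
  rw [ha]
  have h10 : (2 / ((n : ℝ) * (n - 1))) ^ 2 * (4 * n) * (n * (n - 1) / 2) = 8 / (n - 1) := by
    field_simp; norm_num
  rw [h10, div_le_div_iff₀ h8 h9]
  linarith

end IsEllipticalDriver

/-! ### Eigenvectors of a perturbed diagonal matrix -/

/-- A column of a matrix as a Euclidean vector. -/
noncomputable def colVec {p K : ℕ} (G : Matrix (Fin p) (Fin K) ℝ) (j : Fin K) :
    EuclideanSpace ℝ (Fin p) := WithLp.toLp 2 (G.col j)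

theorem inner_colVec_colVec {p K : ℕ} {G : Matrix (Fin p) (Fin K) ℝ} (hG : Gᵀ * G = 1)
    (i j : Fin K) : inner ℝ (colVec G i) (colVec G j) = if i = j then 1 else 0 := by
  have h1 : (Gᵀ * G) i j = if i = j then 1 else 0 := by rw [hG, Matrix.one_apply]
  rw [← h1, Matrix.mul_apply]
  simp [colVec, PiLp.inner_apply, mul_comm]

theorem norm_colVec {p K : ℕ} {G : Matrix (Fin p) (Fin K) ℝ} (hG : Gᵀ * G = 1)
    (j : Fin K) : ‖colVec G j‖ = 1 := by
  have h1 := inner_colVec_colVec hG j j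
  rw [if_pos rfl, real_inner_self_eq_norm_sq] at h1
  nlinarith [norm_nonneg (colVec G j)]

theorem inner_mulVec_eq_sum_entryIn {p : ℕ}
    (b : OrthonormalBasis (Fin p) ℝ (EuclideanSpace ℝ (Fin p)))
    (A : Matrix (Fin p) (Fin p) ℝ) (i : Fin p) (x : EuclideanSpace ℝ (Fin p)) :
    inner ℝ (b i) (WithLp.toLp 2 (A *ᵥ x.ofLp)) = ∑ k, entryIn b A i k * inner ℝ (b k) x := by
  have h1 : WithLp.toLp 2 (A *ᵥ x.ofLp) = Matrix.toEuclideanLin A x := rfl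
  have h2 : ∀ k, entryIn b A i k = inner ℝ (b i) (Matrix.toEuclideanLin A (b k)) := fun k => rfl
  rw [h1]
  conv_lhs => rw [← b.sum_repr' x]
  simp only [map_sum, map_smul, inner_sum, inner_smul_right, h2]
  exact Finset.sum_congr rfl fun k _ => by rw [mul_comm]

/-- One half of the Courant-Fischer principle: if the quadratic form of `A` is at least `c` on a
coordinate subspace of dimension `K`, so are the `K` largest eigenvalues. Otherwise the subspace
would meet the orthogonal complement of the eigenvectors with larger eigenvalues. -/
theorem le_eigenvalues_of_le_quadratic {p K : ℕ} {A : Matrix (Fin p) (Fin p) ℝ}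
    (hA : A.IsHermitian) (b : OrthonormalBasis (Fin p) ℝ (EuclideanSpace ℝ (Fin p)))
    {T : Finset (Fin p)} (hT : T.card = K) {c : ℝ}
    (h : ∀ x : EuclideanSpace ℝ (Fin p), (∀ i ∉ T, inner ℝ (b i) x = 0) →
      c * ‖x‖ ^ 2 ≤ inner ℝ x (WithLp.toLp 2 (A *ᵥ x.ofLp)))
    (k : Fin (Fintype.card (Fin p))) (hk : (k : ℕ) < K) : c ≤ hA.eigenvalues₀ k := by
  by_contra! hlt
  let e : Fin (Fintype.card (Fin p)) ≃ Fin p := Fintype.equivOfCardEq (Fintype.card_fin _)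
  have he : ∀ i, hA.eigenvalues i = hA.eigenvalues₀ (e.symm i) := fun i => rfl
  set f := hA.eigenvectorBasis
  let B : Finset (Fin p) := Finset.univ.filter fun i => e.symm i < k
  have hB : B.card = k := by
    have h1 : B.card = (Finset.Iio k).card :=
      Finset.card_bij (fun i _ => e.symm i) (fun i hi => by simpa [B] using hi)
        (fun i _ j _ h => e.symm.injective h) fun j hj => ⟨e j, by simpa [B] using hj, by simp⟩
    rw [h1, Fin.card_Iio]
  let φ : (T → ℝ) →ₗ[ℝ] (B → ℝ) := LinearMap.pi fun i =>
    ∑ t : T, (inner ℝ (f i) (b t)) • LinearMap.proj t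
  have hker : LinearMap.ker φ ≠ ⊥ := LinearMap.ker_ne_bot_of_finrank_lt (by simp [hT, hB, hk])
  obtain ⟨a, ha, ha0⟩ := Submodule.exists_mem_ne_zero_of_ne_bot hker
  set x : EuclideanSpace ℝ (Fin p) := ∑ t : T, a t • b t with hx
  have hxb : ∀ t : T, inner ℝ (b t) x = a t := fun t => by
    rw [hx, inner_sum, Finset.sum_eq_single t]
    · rw [inner_smul_right, real_inner_self_eq_norm_sq, b.norm_eq_one]; simp
    · intro s _ hs
      rw [inner_smul_right, b.inner_eq_zero fun h => hs (Subtype.ext h).symm, mul_zero]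
    · simp
  have hxT : ∀ i ∉ T, inner ℝ (b i) x = 0 := fun i hi => by
    rw [hx, inner_sum]
    refine Finset.sum_eq_zero fun t _ => ?_
    have hne : i ≠ t := fun h => hi (by rw [h]; exact t.2)
    rw [inner_smul_right, b.inner_eq_zero hne, mul_zero]
  have hxf : ∀ i ∈ B, inner ℝ (f i) x = 0 := fun i hi => by
    have := congrFun (LinearMap.mem_ker.1 ha) ⟨i, hi⟩
    simp only [φ, LinearMap.pi_apply, LinearMap.sum_apply, LinearMap.smul_apply,
      LinearMap.proj_apply, smul_eq_mul, Pi.zero_apply] at this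
    rw [← this, hx, inner_sum]
    exact Finset.sum_congr rfl fun t _ => by rw [inner_smul_right, mul_comm]
  have hx0 : x ≠ 0 := by
    intro h0
    refine ha0 (funext fun t => ?_)
    rw [← hxb t, h0, inner_zero_right]; rfl
  have h1 := h x hxT
  have h2 : inner ℝ x (WithLp.toLp 2 (A *ᵥ x.ofLp))
      = ∑ i, hA.eigenvalues i * inner ℝ (f i) x ^ 2 := by
    have h3 : WithLp.toLp 2 (A *ᵥ x.ofLp) = Matrix.toEuclideanLin A x := rfl
    have h4 : ∀ i, Matrix.toEuclideanLin A (f i) = hA.eigenvalues i • f i := fun i => by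
      have := hA.mulVec_eigenvectorBasis i
      exact congrArg (WithLp.toLp 2) this
    rw [h3]
    conv_lhs => rw [← f.sum_repr' x]
    simp only [map_sum, map_smul, h4, sum_inner, inner_smul_left, inner_sum, inner_smul_right]
    refine Finset.sum_congr rfl fun i _ => ?_
    rw [Finset.sum_eq_single i]
    · rw [real_inner_self_eq_norm_sq, f.norm_eq_one]; simp; ring
    · intro j _ hj
      rw [f.inner_eq_zero hj]; simp
    · simp
  have h3 : ∑ i, hA.eigenvalues i * inner ℝ (f i) x ^ 2
      ≤ ∑ i, hA.eigenvalues₀ k * inner ℝ (f i) x ^ 2 := by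
    refine Finset.sum_le_sum fun i _ => ?_
    by_cases hi : i ∈ B
    · rw [hxf i hi]; simp
    · refine mul_le_mul_of_nonneg_right ?_ (sq_nonneg _)
      rw [he]
      exact hA.eigenvalues₀_antitone (by simpa [B] using hi)
  have h4 := f.sum_sq_norm_inner_right x
  simp only [Real.norm_eq_abs, sq_abs] at h4
  rw [← Finset.mul_sum, h4] at h3
  have h5 : 0 < ‖x‖ ^ 2 := by positivity
  nlinarith

/-- How much the leading eigenvectors leave the top coordinate subspace: the square sum of their
coordinates outside `T`. -/
noncomputable def leakage {p K : ℕ} (b : OrthonormalBasis (Fin p) ℝ (EuclideanSpace ℝ (Fin p)))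
    (T : Finset (Fin p)) (G : Matrix (Fin p) (Fin K) ℝ) : ℝ :=
  ∑ i ∈ Tᶜ, ∑ j, inner ℝ (b i) (colVec G j) ^ 2

theorem leakage_nonneg {p K : ℕ} (b : OrthonormalBasis (Fin p) ℝ (EuclideanSpace ℝ (Fin p)))
    (T : Finset (Fin p)) (G : Matrix (Fin p) (Fin K) ℝ) : 0 ≤ leakage b T G :=
  Finset.sum_nonneg fun _ _ => Finset.sum_nonneg fun _ _ => sq_nonneg _

/-- A one-sided Davis-Kahan bound. If `A` is close to the diagonal matrix `d` in the basis `b` and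
`d` has a gap, read the eigenvector equation `A g = α g` in a coordinate `i` outside `T`: it says
that `(α - d i) g i` is a coordinate of the error applied to `g`. -/
theorem leakage_le {p K : ℕ} {A : Matrix (Fin p) (Fin p) ℝ} (hA : A.IsHermitian)
    (b : OrthonormalBasis (Fin p) ℝ (EuclideanSpace ℝ (Fin p))) {T : Finset (Fin p)}
    (hT : T.card = K) {d : Fin p → ℝ} {c F : ℝ} (hc : 0 < c) (htop : ∀ i ∈ T, c ≤ d i)
    (hbulk : ∀ i ∉ T, d i ≤ c / 4)
    (hF : ∑ i, ∑ j, (entryIn b A i j - if i = j then d i else 0) ^ 2 ≤ F)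
    (hFc : F ≤ (c / 2) ^ 2) {G : Matrix (Fin p) (Fin K) ℝ} (hG : IsLeadingEigenvectors hA G) :
    leakage b T G ≤ K * (16 / c ^ 2 * F) := by
  set err : Fin p → Fin p → ℝ := fun i j => entryIn b A i j - if i = j then d i else 0 with herr
  have hrow : ∀ i (x : EuclideanSpace ℝ (Fin p)), (∑ j, err i j * inner ℝ (b j) x) ^ 2
      ≤ (∑ j, err i j ^ 2) * ‖x‖ ^ 2 := by
    intro i x
    have h1 := b.sum_sq_norm_inner_right x
    simp only [Real.norm_eq_abs, sq_abs] at h1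
    rw [← h1]
    exact Finset.sum_mul_sq_le_sq_mul_sq _ _ _
  have hAx : ∀ i (x : EuclideanSpace ℝ (Fin p)), inner ℝ (b i) (WithLp.toLp 2 (A *ᵥ x.ofLp))
      = d i * inner ℝ (b i) x + ∑ j, err i j * inner ℝ (b j) x := by
    intro i x
    rw [inner_mulVec_eq_sum_entryIn]
    simp only [herr, sub_mul, Finset.sum_sub_distrib, ite_mul, zero_mul, Finset.sum_ite_eq,
      Finset.mem_univ, if_true]
    ring
  have hquad : ∀ x : EuclideanSpace ℝ (Fin p), (∀ i ∉ T, inner ℝ (b i) x = 0) →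
      c / 2 * ‖x‖ ^ 2 ≤ inner ℝ x (WithLp.toLp 2 (A *ᵥ x.ofLp)) := by
    intro x hx
    have h1 := b.sum_sq_norm_inner_right x
    simp only [Real.norm_eq_abs, sq_abs] at h1
    rw [← b.sum_inner_mul_inner]
    simp only [real_inner_comm x, hAx, mul_add, Finset.sum_add_distrib]
    have h2 : c * ‖x‖ ^ 2 ≤ ∑ i, inner ℝ x (b i) * (d i * inner ℝ x (b i)) := by
      rw [← h1, Finset.mul_sum]
      refine Finset.sum_le_sum fun i _ => ?_
      rw [real_inner_comm]
      by_cases hi : i ∈ T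
      · nlinarith [htop i hi, sq_nonneg (inner ℝ x (b i))]
      · rw [← real_inner_comm, hx i hi]; simp
    have h3 : (∑ i, inner ℝ x (b i) * ∑ j, err i j * inner ℝ x (b j)) ^ 2
        ≤ (c / 2 * ‖x‖ ^ 2) ^ 2 := by
      refine (Finset.sum_mul_sq_le_sq_mul_sq _ _ _).trans ?_
      have h4 : ∑ i, (∑ j, err i j * inner ℝ x (b j)) ^ 2 ≤ (c / 2) ^ 2 * ‖x‖ ^ 2 := by
        refine le_trans ?_ (mul_le_mul_of_nonneg_right (hF.trans hFc) (sq_nonneg ‖x‖))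
        rw [Finset.sum_mul]
        exact Finset.sum_le_sum fun i _ => by simpa only [real_inner_comm x] using hrow i x
      have h5 : ∑ i, inner ℝ x (b i) ^ 2 = ‖x‖ ^ 2 := by
        rw [← h1]; exact Finset.sum_congr rfl fun i _ => by rw [real_inner_comm]
      rw [h5]
      nlinarith [sq_nonneg ‖x‖]
    have h6 := abs_le_of_sq_le_sq h3 (by positivity)
    have h7 := (abs_le.1 h6).1
    linarith
  have hone : ∀ j : Fin K, ∑ i ∈ Tᶜ, inner ℝ (b i) (colVec G j) ^ 2 ≤ 16 / c ^ 2 * F := by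
    intro j
    have hKp : K ≤ p := by rw [← hT]; simpa using Finset.card_le_univ T
    let k : Fin (Fintype.card (Fin p)) := ⟨j, by simpa using j.2.trans_le hKp⟩
    have hα := le_eigenvalues_of_le_quadratic hA b hT hquad k j.2
    have hAg := hG.2 j k rfl
    set α := hA.eigenvalues₀ k
    set g := colVec G j with hg
    have hgn : ‖g‖ = 1 := norm_colVec hG.1 j
    have h1 : ∀ i ∈ Tᶜ, inner ℝ (b i) g ^ 2 ≤ 16 / c ^ 2 * ∑ j, err i j ^ 2 := by
      intro i hi
      have hd := hbulk i (Finset.mem_compl.1 hi)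
      have h2 := hAx i g
      have h3 : WithLp.toLp 2 (A *ᵥ g.ofLp) = α • g := by
        rw [hg, colVec, ← WithLp.toLp_smul, ← hAg]
      rw [h3, inner_smul_right] at h2
      have h4 := hrow i g
      rw [hgn, one_pow, mul_one, ← sub_eq_of_eq_add' h2, ← sub_mul, mul_pow] at h4
      have h5 : (c / 4) ^ 2 ≤ (α - d i) ^ 2 := pow_le_pow_left₀ (by positivity) (by linarith) 2
      have h6 := (mul_le_mul_of_nonneg_right h5 (sq_nonneg (inner ℝ (b i) g))).trans h4
      rw [div_mul_eq_mul_div, le_div_iff₀ (by positivity)]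
      nlinarith
    refine (Finset.sum_le_sum h1).trans ?_
    rw [← Finset.mul_sum]
    refine mul_le_mul_of_nonneg_left (le_trans ?_ hF) (by positivity)
    exact Finset.sum_le_sum_of_subset_of_nonneg (Finset.subset_univ _) fun i _ _ =>
      Finset.sum_nonneg fun _ _ => sq_nonneg _
  rw [leakage, Finset.sum_comm]
  refine (Finset.sum_le_sum fun j _ => hone j).trans ?_
  simp

/-! ### The projection that removes the estimated factors -/

/-- The length of the image of `x` under `Q`. -/
noncomputable def projNorm {p q : ℕ} (Q : Matrix (Fin q) (Fin p) ℝ)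
    (x : EuclideanSpace ℝ (Fin p)) : ℝ := l2norm (Q *ᵥ x.ofLp)

section ProjNorm

variable {p K q : ℕ} {Q : Matrix (Fin q) (Fin p) ℝ}

theorem projNorm_eq (Q : Matrix (Fin q) (Fin p) ℝ) (x : EuclideanSpace ℝ (Fin p)) :
    projNorm Q x = ‖Matrix.toEuclideanLin Q x‖ := rfl

theorem projNorm_nonneg (Q : Matrix (Fin q) (Fin p) ℝ) (x : EuclideanSpace ℝ (Fin p)) :
    0 ≤ projNorm Q x := norm_nonneg _

theorem projNorm_add_le (Q : Matrix (Fin q) (Fin p) ℝ) (x y : EuclideanSpace ℝ (Fin p)) :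
    projNorm Q (x + y) ≤ projNorm Q x + projNorm Q y := by
  simp only [projNorm_eq, map_add]
  exact norm_add_le _ _

theorem projNorm_smul (Q : Matrix (Fin q) (Fin p) ℝ) (c : ℝ) (x : EuclideanSpace ℝ (Fin p)) :
    projNorm Q (c • x) = |c| * projNorm Q x := by
  simp only [projNorm_eq, map_smul, norm_smul, Real.norm_eq_abs]

theorem projNorm_sum_le {ι : Type*} (Q : Matrix (Fin q) (Fin p) ℝ) (s : Finset ι)
    (f : ι → EuclideanSpace ℝ (Fin p)) :
    projNorm Q (∑ i ∈ s, f i) ≤ ∑ i ∈ s, projNorm Q (f i) := by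
  simp only [projNorm_eq, map_sum]
  exact norm_sum_le _ _

variable {G : Matrix (Fin p) (Fin K) ℝ} {Q : Matrix (Fin (p - K)) (Fin p) ℝ}

/-- The rows of `Q` and the columns of `G` together form an orthonormal basis. -/
theorem projNorm_sq (hK : K ≤ p) (hG : Gᵀ * G = 1) (hQ : IsNullProjection G Q)
    (x : EuclideanSpace ℝ (Fin p)) :
    projNorm Q x ^ 2 = ‖x‖ ^ 2 - ∑ j, inner ℝ (colVec G j) x ^ 2 := by
  have h1 : Matrix.fromRows Q Gᵀ * (Matrix.fromRows Q Gᵀ)ᵀ = 1 := by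
    have hGQ : Gᵀ * Qᵀ = 0 := by rw [← Matrix.transpose_mul, hQ.1, Matrix.transpose_zero]
    rw [Matrix.transpose_fromRows, Matrix.fromRows_mul_fromCols, Matrix.transpose_transpose, hQ.1,
      hQ.2, hG, hGQ, Matrix.fromBlocks_one]
  have h2 : (Matrix.fromRows Q Gᵀ)ᵀ * Matrix.fromRows Q Gᵀ = 1 :=
    (Matrix.mul_eq_one_comm_of_card_eq _ _ _
      (by simp only [Fintype.card_sum, Fintype.card_fin]; omega)).1 h1
  rw [Matrix.transpose_fromRows, Matrix.fromCols_mul_fromRows, Matrix.transpose_transpose] at h2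
  have h3 : ∀ {r : ℕ} (M : Matrix (Fin r) (Fin p) ℝ), ∑ i, (M *ᵥ x.ofLp) i ^ 2
      = x.ofLp ⬝ᵥ ((Mᵀ * M) *ᵥ x.ofLp) := by
    intro r M
    rw [← Matrix.mulVec_mulVec, Matrix.dotProduct_mulVec, ← Matrix.mulVec_transpose,
      Matrix.transpose_transpose]
    exact Finset.sum_congr rfl fun i _ => sq _
  have h4 : ∑ j, inner ℝ (colVec G j) x ^ 2 = ∑ i, (Gᵀ *ᵥ x.ofLp) i ^ 2 := by
    refine Finset.sum_congr rfl fun j _ => ?_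
    congr 1
    simp [colVec, PiLp.inner_apply, Matrix.mulVec, dotProduct, mul_comm]
  have h5 : projNorm Q x ^ 2 = ∑ i, (Q *ᵥ x.ofLp) i ^ 2 := EuclideanSpace.real_norm_sq_eq _
  have h6 : ‖x‖ ^ 2 = x.ofLp ⬝ᵥ ((1 : Matrix (Fin p) (Fin p) ℝ) *ᵥ x.ofLp) := by
    rw [EuclideanSpace.real_norm_sq_eq, Matrix.one_mulVec]
    exact Finset.sum_congr rfl fun i _ => sq _
  rw [h4, h5, h6, ← h2, Matrix.add_mulVec, dotProduct_add, h3, h3, Matrix.transpose_transpose]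
  ring

theorem projNorm_le_norm (hK : K ≤ p) (hG : Gᵀ * G = 1) (hQ : IsNullProjection G Q)
    (x : EuclideanSpace ℝ (Fin p)) : projNorm Q x ≤ ‖x‖ := by
  refine abs_le_of_sq_le_sq' ?_ (norm_nonneg x) |>.2
  rw [projNorm_sq hK hG hQ]
  have : 0 ≤ ∑ j, inner ℝ (colVec G j) x ^ 2 := Finset.sum_nonneg fun _ _ => sq_nonneg _
  linarith

variable {b : OrthonormalBasis (Fin p) ℝ (EuclideanSpace ℝ (Fin p))} {T : Finset (Fin p)}

/-- The component of `x` along the basis vectors indexed by `s`. -/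
noncomputable def coordPart (b : OrthonormalBasis (Fin p) ℝ (EuclideanSpace ℝ (Fin p)))
    (s : Finset (Fin p)) (x : EuclideanSpace ℝ (Fin p)) : EuclideanSpace ℝ (Fin p) :=
  ∑ i ∈ s, inner ℝ (b i) x • b i

theorem coordPart_add_compl (b : OrthonormalBasis (Fin p) ℝ (EuclideanSpace ℝ (Fin p)))
    (T : Finset (Fin p)) (x : EuclideanSpace ℝ (Fin p)) :
    coordPart b Tᶜ x + coordPart b T x = x := by
  rw [coordPart, coordPart, Finset.sum_compl_add_sum, b.sum_repr']

theorem norm_coordPart_sq (b : OrthonormalBasis (Fin p) ℝ (EuclideanSpace ℝ (Fin p)))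
    (s : Finset (Fin p)) (x : EuclideanSpace ℝ (Fin p)) :
    ‖coordPart b s x‖ ^ 2 = ∑ i ∈ s, inner ℝ (b i) x ^ 2 := by
  rw [← real_inner_self_eq_norm_sq, coordPart, sum_inner]
  refine Finset.sum_congr rfl fun i hi => ?_
  rw [inner_sum, Finset.sum_eq_single i]
  · rw [inner_smul_left, inner_smul_right, real_inner_self_eq_norm_sq, b.norm_eq_one]; simp; ring
  · intro j _ hj
    rw [inner_smul_left, inner_smul_right, b.inner_eq_zero hj.symm]; simp
  · exact fun h => absurd hi h

/-- The projected basis vectors of the top coordinates have square sum equal to the leakage: both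
equal `K` minus the square sum of the coordinates of `G` inside `T`. -/
theorem sum_projNorm_sq_top (hK : K ≤ p) (hT : T.card = K) (hG : Gᵀ * G = 1)
    (hQ : IsNullProjection G Q) : ∑ i ∈ T, projNorm Q (b i) ^ 2 = leakage b T G := by
  have h1 : ∑ i ∈ T, projNorm Q (b i) ^ 2
      = K - ∑ i ∈ T, ∑ j, inner ℝ (b i) (colVec G j) ^ 2 := by
    simp only [projNorm_sq hK hG hQ, b.norm_eq_one, Finset.sum_sub_distrib]
    simp [hT, real_inner_comm]
  have h2 : (∑ i ∈ Tᶜ, ∑ j, inner ℝ (b i) (colVec G j) ^ 2)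
      + ∑ i ∈ T, ∑ j, inner ℝ (b i) (colVec G j) ^ 2 = K := by
    rw [Finset.sum_compl_add_sum, Finset.sum_comm]
    have h3 : ∀ j, ∑ i, inner ℝ (b i) (colVec G j) ^ 2 = 1 := fun j => by
      have := b.sum_sq_norm_inner_right (colVec G j)
      simp only [Real.norm_eq_abs, sq_abs] at this
      rw [this, norm_colVec hG, one_pow]
    simp [h3]
  rw [h1, leakage]
  linarith

theorem projNorm_coordPart_top_sq_le (hK : K ≤ p) (hT : T.card = K) (hG : Gᵀ * G = 1)
    (hQ : IsNullProjection G Q) (x : EuclideanSpace ℝ (Fin p)) :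
    projNorm Q (coordPart b T x) ^ 2 ≤ leakage b T G * ‖coordPart b T x‖ ^ 2 := by
  have h1 : projNorm Q (coordPart b T x) ≤ ∑ i ∈ T, projNorm Q (b i) * |inner ℝ (b i) x| := by
    refine (projNorm_sum_le _ _ _).trans (le_of_eq (Finset.sum_congr rfl fun i _ => ?_))
    rw [projNorm_smul, mul_comm]
  refine (pow_le_pow_left₀ (projNorm_nonneg _ _) h1 2).trans ?_
  refine (Finset.sum_mul_sq_le_sq_mul_sq _ _ _).trans (le_of_eq ?_)
  rw [sum_projNorm_sq_top hK hT hG hQ, norm_coordPart_sq]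
  simp only [sq_abs]

theorem le_projNorm_coordPart_compl_sq (hK : K ≤ p) (hG : Gᵀ * G = 1)
    (hQ : IsNullProjection G Q) (x : EuclideanSpace ℝ (Fin p)) :
    (1 - leakage b T G) * ‖coordPart b Tᶜ x‖ ^ 2 ≤ projNorm Q (coordPart b Tᶜ x) ^ 2 := by
  rw [projNorm_sq hK hG hQ]
  have h1 : ∀ j, inner ℝ (colVec G j) (coordPart b Tᶜ x) ^ 2
      ≤ (∑ i ∈ Tᶜ, inner ℝ (b i) (colVec G j) ^ 2) * ‖coordPart b Tᶜ x‖ ^ 2 := fun j => by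
    rw [norm_coordPart_sq]
    refine le_trans (le_of_eq ?_) (Finset.sum_mul_sq_le_sq_mul_sq _ _ _)
    congr 1
    rw [coordPart, inner_sum]
    exact Finset.sum_congr rfl fun i _ => by rw [inner_smul_right, mul_comm, real_inner_comm]
  have h2 := Finset.sum_le_sum fun j (_ : j ∈ Finset.univ) => h1 j
  rw [← Finset.sum_mul, Finset.sum_comm] at h2
  have h3 : ∑ i ∈ Tᶜ, ∑ j, inner ℝ (b i) (colVec G j) ^ 2 = leakage b T G := rfl
  rw [h3] at h2
  linarith

/-- The projected length of an observation is that of its bulk part, up to the projected factor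
part and the location error. -/
theorem abs_projNorm_sq_sub_le (hK : K ≤ p) (hT : T.card = K) (hG : Gᵀ * G = 1)
    (hQ : IsNullProjection G Q) (x z : EuclideanSpace ℝ (Fin p)) {B E h : ℝ}
    (hB : ‖coordPart b Tᶜ x‖ ≤ B) (hh : leakage b T G ≤ h)
    (hE : √(leakage b T G) * ‖coordPart b T x‖ + ‖z‖ ≤ E) :
    |projNorm Q (x + z) ^ 2 - ‖coordPart b Tᶜ x‖ ^ 2| ≤ E * (2 * B + E) + h * B ^ 2 := by
  set w := coordPart b Tᶜ x with hw
  set a := coordPart b T x with ha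
  have hxz : x + z = w + (a + z) := by
    rw [← add_assoc, hw, ha, coordPart_add_compl]
  have hwx : w = (x + z) + (-1 : ℝ) • (a + z) := by rw [hxz]; module
  have h1 : projNorm Q (a + z) ≤ E := by
    refine (projNorm_add_le _ _ _).trans (le_trans (add_le_add ?_ (projNorm_le_norm hK hG hQ z)) hE)
    refine abs_le_of_sq_le_sq' ?_ (by positivity) |>.2
    rw [mul_pow, Real.sq_sqrt (leakage_nonneg _ _ _)]
    exact projNorm_coordPart_top_sq_le hK hT hG hQ x
  have h2 : projNorm Q (x + z) ≤ projNorm Q w + E := by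
    rw [hxz]; exact (projNorm_add_le _ _ _).trans (by linarith)
  have h3 : projNorm Q w ≤ projNorm Q (x + z) + E := by
    have h4 : projNorm Q w ≤ projNorm Q (x + z) + projNorm Q ((-1 : ℝ) • (a + z)) := by
      conv_lhs => rw [hwx]
      exact projNorm_add_le _ _ _
    rw [projNorm_smul] at h4
    simp at h4
    linarith
  have h5 := projNorm_le_norm hK hG hQ w
  have h6 := le_projNorm_coordPart_compl_sq (b := b) (T := T) hK hG hQ x
  rw [← hw] at h6
  have hn := projNorm_nonneg Q (x + z)
  have hn' := projNorm_nonneg Q w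
  have hE0 : 0 ≤ E := (projNorm_nonneg _ _).trans h1
  have hw0 := norm_nonneg w
  have h7 : leakage b T G * ‖w‖ ^ 2 ≤ h * B ^ 2 :=
    mul_le_mul hh (pow_le_pow_left₀ hw0 hB 2) (sq_nonneg _) ((leakage_nonneg b T G).trans hh)
  have h8 : 0 ≤ h * B ^ 2 := mul_nonneg ((leakage_nonneg b T G).trans hh) (sq_nonneg _)
  have h9 : projNorm Q w ^ 2 ≤ ‖w‖ ^ 2 := pow_le_pow_left₀ hn' h5 2
  rw [abs_le]
  constructor
  · -- a drop of the length by at most `E` from a length at most `B`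
    have h10 : projNorm Q w ^ 2 - projNorm Q (x + z) ^ 2 ≤ E * (2 * B) := by
      have h11 : projNorm Q w ^ 2 - projNorm Q (x + z) ^ 2
        = (projNorm Q w - projNorm Q (x + z)) * (projNorm Q w + projNorm Q (x + z)) := by ring
      rcases le_total (projNorm Q w) (projNorm Q (x + z)) with h12 | h12
      · have : 0 ≤ E * (2 * B) := by
          have : 0 ≤ B := hw0.trans hB
          positivity
        nlinarith
      · rw [h11]
        exact mul_le_mul (by linarith) (by linarith) (by linarith) hE0
    nlinarith
  · have h10 : projNorm Q (x + z) ^ 2 ≤ (projNorm Q w + E) ^ 2 := pow_le_pow_left₀ hn h2 2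
    have h11 : E * projNorm Q w ≤ E * B := mul_le_mul_of_nonneg_left (h5.trans hB) hE0
    nlinarith

end ProjNorm

/-! ### From projected lengths to the scale estimates -/

/-- If `d` is close to the constant `τ` in mean square and `r` averages to about one, then
`q = (1 / n) ∑ r / d` is close to `1 / τ`, and `d q` is close to one in mean square. -/
theorem average_inv_mul_sub_one_sq_le {n : ℕ} {d r : Fin n → ℝ} {τ c A ρ : ℝ}
    (hc : 0 < c) (hA : 0 ≤ A) (hd : ∀ t, c ≤ d t) (hdr : ∀ t, d t ≤ r t)
    (h1 : 1 / (n : ℝ) * ∑ t, (d t - τ) ^ 2 ≤ A * ρ)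
    (h2 : (1 / (n : ℝ) * ∑ t, r t - 1) ^ 2 ≤ A * ρ)
    (h3 : 1 / (n : ℝ) * ∑ t, r t ^ 2 ≤ A) :
    1 / (n : ℝ) * ∑ t, (1 / (d t * (1 / (n : ℝ) * ∑ s, r s / d s)) - 1) ^ 2
      ≤ 2 / c ^ 2 * (2 * A ^ 2 / c ^ 2 + 3 * A) * ρ := by
  have hAρ : 0 ≤ A * ρ := le_trans (sq_nonneg _) h2
  rcases Nat.eq_zero_or_pos n with rfl | hn
  · simp only [Finset.univ_eq_empty, Finset.sum_empty, mul_zero]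
    have h0 : 2 / c ^ 2 * (2 * A ^ 2 / c ^ 2 + 3 * A) * ρ
        = 2 / c ^ 2 * (2 * A / c ^ 2 * (A * ρ) + 3 * (A * ρ)) := by ring
    rw [h0]; positivity
  have hn' : (0 : ℝ) < n := by exact_mod_cast hn
  have hd0 : ∀ t, 0 < d t := fun t => hc.trans_le (hd t)
  set q := 1 / (n : ℝ) * ∑ s, r s / d s with hq
  have hq1 : 1 ≤ q := by
    have : ∑ s : Fin n, (1 : ℝ) ≤ ∑ s, r s / d s :=
      Finset.sum_le_sum fun s _ => (one_le_div (hd0 s)).2 (hdr s)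
    simp only [Finset.sum_const, Finset.card_univ, Fintype.card_fin, nsmul_eq_mul, mul_one] at this
    rw [hq, one_div, ← div_eq_inv_mul, le_div_iff₀ hn']
    linarith
  have hτq : (1 - τ * q) ^ 2 ≤ (2 * A ^ 2 / c ^ 2 + 2 * A) * ρ := by
    have h4 : τ * q - 1 = 1 / (n : ℝ) * (∑ t, r t / d t * (τ - d t))
        + (1 / (n : ℝ) * ∑ t, r t - 1) := by
      have h5 : ∀ t, r t / d t * (τ - d t) = τ * (r t / d t) - r t := fun t => by
        have := (hd0 t).ne'
        field_simp
      simp only [h5, Finset.sum_sub_distrib, ← Finset.mul_sum, hq]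
      ring
    have h6 : (1 / (n : ℝ) * (∑ t, r t / d t * (τ - d t))) ^ 2 ≤ A / c ^ 2 * (A * ρ) := by
      have h7 := Finset.sum_mul_sq_le_sq_mul_sq Finset.univ (fun t => r t / d t) fun t => τ - d t
      have h8 : 1 / (n : ℝ) * ∑ t, (r t / d t) ^ 2 ≤ A / c ^ 2 := by
        rw [le_div_iff₀ (by positivity)]
        refine le_trans ?_ h3
        rw [mul_assoc, Finset.sum_mul]
        refine mul_le_mul_of_nonneg_left (Finset.sum_le_sum fun t _ => ?_) (by positivity)
        rw [div_pow, div_mul_eq_mul_div, div_le_iff₀ (by have := hd0 t; positivity)]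
        exact mul_le_mul_of_nonneg_left (pow_le_pow_left₀ hc.le (hd t) 2) (sq_nonneg _)
      have h9 : 1 / (n : ℝ) * ∑ t, (τ - d t) ^ 2 ≤ A * ρ := by
        refine le_trans (le_of_eq ?_) h1
        congr 1; exact Finset.sum_congr rfl fun t _ => by ring
      calc (1 / (n : ℝ) * (∑ t, r t / d t * (τ - d t))) ^ 2
          = (1 / (n : ℝ)) ^ 2 * (∑ t, r t / d t * (τ - d t)) ^ 2 := by ring
        _ ≤ (1 / (n : ℝ)) ^ 2 * ((∑ t, (r t / d t) ^ 2) * ∑ t, (τ - d t) ^ 2) :=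
            mul_le_mul_of_nonneg_left h7 (sq_nonneg _)
        _ = (1 / (n : ℝ) * ∑ t, (r t / d t) ^ 2) * (1 / (n : ℝ) * ∑ t, (τ - d t) ^ 2) := by ring
        _ ≤ _ := mul_le_mul h8 h9 (by positivity) (by positivity)
    have h10 : (1 - τ * q) ^ 2 = (τ * q - 1) ^ 2 := by ring
    rw [h10, h4]
    set a := 1 / (n : ℝ) * (∑ t, r t / d t * (τ - d t))
    set e := 1 / (n : ℝ) * ∑ t, r t - 1
    have h11 : (2 * A ^ 2 / c ^ 2 + 2 * A) * ρ = 2 * (A / c ^ 2 * (A * ρ)) + 2 * (A * ρ) := by ring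
    rw [h11]
    nlinarith [sq_nonneg (a - e)]
  have h12 : ∀ t, (1 / (d t * q) - 1) ^ 2
      ≤ 2 / c ^ 2 * (1 - τ * q) ^ 2 + 2 / c ^ 2 * (d t - τ) ^ 2 := by
    intro t
    have hdt := hd0 t
    have hq0 : 0 < q := by linarith
    have h13 : 1 / (d t * q) - 1 = (1 - τ * q) / (d t * q) + (τ - d t) / d t := by
      field_simp
      ring
    have h14 : ((1 - τ * q) / (d t * q)) ^ 2 ≤ (1 - τ * q) ^ 2 / c ^ 2 := by
      rw [div_pow]
      refine div_le_div_of_nonneg_left (sq_nonneg _) (by positivity) (pow_le_pow_left₀ hc.le ?_ 2)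
      nlinarith [hd t]
    have h15 : ((τ - d t) / d t) ^ 2 ≤ (d t - τ) ^ 2 / c ^ 2 := by
      rw [div_pow, show (τ - d t) ^ 2 = (d t - τ) ^ 2 by ring]
      exact div_le_div_of_nonneg_left (sq_nonneg _) (by positivity)
        (pow_le_pow_left₀ hc.le (hd t) 2)
    rw [h13]
    have h16 : 2 / c ^ 2 * (1 - τ * q) ^ 2 + 2 / c ^ 2 * (d t - τ) ^ 2
      = 2 * ((1 - τ * q) ^ 2 / c ^ 2) + 2 * ((d t - τ) ^ 2 / c ^ 2) := by ring
    rw [h16]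
    nlinarith [sq_nonneg ((1 - τ * q) / (d t * q) - (τ - d t) / d t)]
  have h17 : 1 / (n : ℝ) * ∑ t, (1 / (d t * q) - 1) ^ 2
      ≤ 1 / (n : ℝ) * ∑ t, (2 / c ^ 2 * (1 - τ * q) ^ 2 + 2 / c ^ 2 * (d t - τ) ^ 2) :=
    mul_le_mul_of_nonneg_left (Finset.sum_le_sum fun t _ => h12 t) (by positivity)
  refine h17.trans ?_
  rw [Finset.sum_add_distrib, mul_add]
  have h18 : 1 / (n : ℝ) * ∑ _t : Fin n, 2 / c ^ 2 * (1 - τ * q) ^ 2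
      = 2 / c ^ 2 * (1 - τ * q) ^ 2 := by
    simp only [Finset.sum_const, Finset.card_univ, Fintype.card_fin, nsmul_eq_mul]
    field_simp
  rw [h18]
  have h19 : 1 / (n : ℝ) * (∑ t, 2 / c ^ 2 * (d t - τ) ^ 2) ≤ 2 / c ^ 2 * (A * ρ) := by
    rw [← Finset.mul_sum, mul_left_comm]
    exact mul_le_mul_of_nonneg_left h1 (by positivity)
  have h20 := mul_le_mul_of_nonneg_left hτq (show 0 ≤ 2 / c ^ 2 by positivity)
  have h21 : 2 / c ^ 2 * (2 * A ^ 2 / c ^ 2 + 3 * A) * ρ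
      = 2 / c ^ 2 * ((2 * A ^ 2 / c ^ 2 + 2 * A) * ρ) + 2 / c ^ 2 * (A * ρ) := by ring
  linarith

/-- The scale estimate in terms of the projected and full squared lengths `d`, `r` of the
standardised residuals: `ξ̂² = ξ² d q` with `q` the average of `r / d`. -/
theorem ipsnScale_eq {n p q : ℕ} {y : Fin n → Fin p → ℝ} {m : Fin p → ℝ}
    {Q : Matrix (Fin q) (Fin p) ℝ} {x : Fin n → EuclideanSpace ℝ (Fin p)} {ξ : Fin n → ℝ}
    (hp : 0 < p) (hξ : ∀ t, 0 < ξ t) (hyx : ∀ t, y t - m = (√(p : ℝ) * ξ t) • (x t).ofLp)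
    (hx : ∀ t, 0 < projNorm Q (x t)) (t : Fin n) :
    ipsnScale y m Q t = ξ t * projNorm Q (x t) *
      √(1 / (n : ℝ) * ∑ s, ‖x s‖ ^ 2 / projNorm Q (x s) ^ 2) := by
  have hp' : (0 : ℝ) < p := by exact_mod_cast hp
  have hsp : 0 < √(p : ℝ) := Real.sqrt_pos.2 hp'
  have h1 : ∀ s, l2norm (Q *ᵥ (y s - m)) = √(p : ℝ) * ξ s * projNorm Q (x s) := fun s => by
    have h2 := projNorm_smul Q (√(p : ℝ) * ξ s) (x s)
    rw [abs_of_pos (mul_pos hsp (hξ s))] at h2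
    rw [hyx, ← h2]; rfl
  have h2 : ∀ s, (Matrix.vecMulVec (ipsnX y m Q s) (ipsnX y m Q s)).trace
      = p * (‖x s‖ ^ 2 / projNorm Q (x s) ^ 2) := fun s => by
    rw [Matrix.trace_vecMulVec, ipsnX, h1, hyx, smul_smul, smul_dotProduct, dotProduct_smul,
      EuclideanSpace.real_norm_sq_eq]
    have h3 : (x s).ofLp ⬝ᵥ (x s).ofLp = ∑ i, (x s) i ^ 2 :=
      Finset.sum_congr rfl fun i _ => (sq _).symm
    rw [h3]
    have h4 := (hξ s).ne'
    have h5 := (hx s).ne'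
    have h6 := hsp.ne'
    have h7 := Real.mul_self_sqrt hp'.le
    simp only [smul_eq_mul]
    field_simp
    rw [sq, h7, mul_comm]
  have h3 : ipsnEta y m Q = 1 / (1 / (n : ℝ) * ∑ s, ‖x s‖ ^ 2 / projNorm Q (x s) ^ 2) := by
    rw [ipsnEta, Matrix.trace_smul, Matrix.trace_sum]
    simp only [h2, ← Finset.mul_sum, smul_eq_mul]
    rw [mul_left_comm, ← div_div, div_self hp'.ne']
  rw [ipsnScale, h1, h3, Real.sqrt_mul hp'.le, one_div (1 / (n : ℝ) * _), Real.sqrt_inv,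
    ← div_div, div_inv_eq_mul]
  congr 1
  field_simp

theorem abs_norm_add_sq_sub_le {E : Type*} [NormedAddCommGroup E] [InnerProductSpace ℝ E]
    (x : E) {z : E} {θ : ℝ} (hz : ‖z‖ ≤ θ) :
    |‖x + z‖ ^ 2 - ‖x‖ ^ 2| ≤ θ * (‖x‖ ^ 2 + 1) + θ ^ 2 := by
  have h2 := norm_add_sq_real x z
  have h3 := abs_le.1 (abs_real_inner_le_norm x z)
  have h4 : ‖x‖ * ‖z‖ ≤ ‖x‖ * θ := mul_le_mul_of_nonneg_left hz (norm_nonneg _)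
  have h5 : ‖z‖ ^ 2 ≤ θ ^ 2 := pow_le_pow_left₀ (norm_nonneg _) hz 2
  have h6 : 2 * (‖x‖ * θ) ≤ θ * (‖x‖ ^ 2 + 1) := by
    nlinarith [mul_nonneg ((norm_nonneg z).trans hz) (sq_nonneg (‖x‖ - 1))]
  have h7 := sq_nonneg ‖z‖
  have h8 := sq_nonneg θ
  rw [h2, abs_le]
  constructor <;> linarith [h3.1, h3.2]

/-- On the event that the location, the factor space, and the averages of the quadratic forms are
all accurate to the order `ρ`, the scale estimates are bounded below and accurate. -/
theorem ipsnScale_bounds {n p K : ℕ} {R : Matrix (Fin p) (Fin p) ℝ}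
    {b : OrthonormalBasis (Fin p) ℝ (EuclideanSpace ℝ (Fin p))} {l : Fin p → ℝ}
    {T : Finset (Fin p)} {δ : ℝ} (hδ : 0 < δ) (hb : IsFactorBasis R b l T K δ)
    {y : Fin n → Fin p → ℝ} {c m : Fin p → ℝ} {G : Matrix (Fin p) (Fin K) ℝ}
    {Q : Matrix (Fin (p - K)) (Fin p) ℝ} {ξ : Fin n → ℝ} {u : Fin n → EuclideanSpace ℝ (Fin p)}
    (hn : 0 < n) (hp : 0 < p) (hK : K ≤ p) (hG : Gᵀ * G = 1) (hQ : IsNullProjection G Q)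
    (hy : ∀ t, y t = ellipticalObs c R (ξ t) (u t)) (hu : ∀ t, ‖u t‖ = 1)
    {cξ : ℝ} (hcξ : 0 < cξ) (hξ : ∀ t, cξ < ξ t)
    {A ρ s h x : ℝ} (hA : 1 ≤ A) (hρ : 0 ≤ ρ)
    (hs : ∀ i, |m i - c i| ≤ s) (hsA : (s / cξ) ^ 2 ≤ A * ρ)
    (hh : leakage b T G ≤ h) (hhA : h ≤ A * ρ)
    (hx : ∀ t, ∀ i ∈ T, inner ℝ (b i) (u t) ^ 2 ≤ x) (hxK : K * x ≤ 1 / 4)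
    (hxA : h * (K * (p / δ * x)) ≤ A * ρ)
    (hbulk : 1 / (n : ℝ) * ∑ t, (∑ i ∈ Tᶜ, l i * inner ℝ (b i) (u t) ^ 2
      - (∑ i ∈ Tᶜ, l i) / p) ^ 2 ≤ A * ρ)
    (hmean : (1 / (n : ℝ) * ∑ t, ∑ i, l i * inner ℝ (b i) (u t) ^ 2 - 1) ^ 2 ≤ A * ρ)
    (hsq : 1 / (n : ℝ) * ∑ t, (∑ i, l i * inner ℝ (b i) (u t) ^ 2) ^ 2 ≤ A)
    (hρ1 : A * ρ ≤ 1) (hρδ : √(A * ρ) * (√(1 / δ) + 2) ^ 2 ≤ δ / 4) :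
    (∀ t, cξ * √(δ / 2) < ipsnScale y m Q t) ∧
    1 / (n : ℝ) * ∑ t, (ξ t ^ 2 / ipsnScale y m Q t ^ 2 - 1) ^ 2
      ≤ 2 / (δ / 2) ^ 2 * (2 * (27 * A + 2 * A * (√(1 / δ) + 2) ^ 4) ^ 2 / (δ / 2) ^ 2
        + 3 * (27 * A + 2 * A * (√(1 / δ) + 2) ^ 4)) * ρ := by
  have hn' : (0 : ℝ) < n := by exact_mod_cast hn
  have hp' : (0 : ℝ) < p := by exact_mod_cast hp
  have hl : ∀ i, 0 ≤ l i := fun i => hδ.le.trans (hb.le_eigenvalue hδ i)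
  have hAρ : 0 ≤ A * ρ := le_trans (sq_nonneg _) hmean
  set θ := √(A * ρ) with hθ
  have hθ0 : 0 ≤ θ := Real.sqrt_nonneg _
  have hθ2 : θ ^ 2 = A * ρ := Real.sq_sqrt hAρ
  have hθ1 : θ ≤ 1 := by rw [hθ]; exact Real.sqrt_le_one.2 hρ1
  set B := √(1 / δ) with hB
  have hB0 : 0 ≤ B := Real.sqrt_nonneg _
  have hB2 : B ^ 2 = 1 / δ := Real.sq_sqrt (by positivity)
  have hξ0 : ∀ t, 0 < ξ t := fun t => hcξ.trans (hξ t)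
  have hsp : 0 < √(p : ℝ) := Real.sqrt_pos.2 hp'
  have hs0 : 0 ≤ s := (abs_nonneg _).trans (hs ⟨0, hp⟩)
  set X : Fin n → EuclideanSpace ℝ (Fin p) := fun t => WithLp.toLp 2 (R *ᵥ (u t).ofLp) with hX
  set z : Fin n → EuclideanSpace ℝ (Fin p) := fun t =>
    (√(p : ℝ) * ξ t)⁻¹ • WithLp.toLp 2 (c - m) with hz
  have hyx : ∀ t, y t - m = (√(p : ℝ) * ξ t) • (X t + z t).ofLp := fun t => by
    have h1 : √(p : ℝ) * ξ t ≠ 0 := (mul_pos hsp (hξ0 t)).ne'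
    simp only [hX, hz, WithLp.ofLp_add, WithLp.ofLp_smul, smul_add, smul_smul,
      mul_inv_cancel₀ h1, one_smul, hy, ellipticalObs]
    abel
  -- the location error is at most `θ` after division by `√p ξ`
  have hzn : ∀ t, ‖z t‖ ≤ θ := fun t => by
    have h1 : ‖WithLp.toLp 2 (c - m)‖ ≤ √(p : ℝ) * s := by
      rw [EuclideanSpace.norm_eq, ← Real.sqrt_sq hs0, ← Real.sqrt_mul hp'.le]
      refine Real.sqrt_le_sqrt ?_
      have : ∑ _i : Fin p, s ^ 2 = p * s ^ 2 := by simp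
      rw [← this]
      refine Finset.sum_le_sum fun i _ => pow_le_pow_left₀ (norm_nonneg _) ?_ 2
      rw [Real.norm_eq_abs, WithLp.ofLp_toLp, Pi.sub_apply, abs_sub_comm]
      exact hs i
    have h2 : s / cξ ≤ θ := by
      rw [hθ]; exact Real.le_sqrt_of_sq_le hsA
    refine le_trans ?_ h2
    rw [hz]
    simp only [norm_smul, norm_inv, Real.norm_eq_abs, abs_of_pos (mul_pos hsp (hξ0 t))]
    calc (√(p : ℝ) * ξ t)⁻¹ * ‖WithLp.toLp 2 (c - m)‖ ≤ (√(p : ℝ) * ξ t)⁻¹ * (√(p : ℝ) * s) :=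
          mul_le_mul_of_nonneg_left h1 (by have := hξ0 t; positivity)
      _ = s / ξ t := by
          have := (hξ0 t).ne'
          field_simp
      _ ≤ s / cξ := div_le_div_of_nonneg_left hs0 hcξ (hξ t).le
  have hpart : ∀ S t, ‖coordPart b S (X t)‖ ^ 2 = ∑ i ∈ S, l i * inner ℝ (b i) (u t) ^ 2 :=
    fun S t => by
      rw [norm_coordPart_sq]
      refine Finset.sum_congr rfl fun i _ => ?_
      rw [hX, hb.inner_root, mul_pow, Real.sq_sqrt (hl i)]
  have hXn : ∀ t, ‖X t‖ ^ 2 = ∑ i, l i * inner ℝ (b i) (u t) ^ 2 := fun t => hb.norm_root_sq hδ _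
  have hun : ∀ t, ∑ i, inner ℝ (b i) (u t) ^ 2 = 1 := fun t => by
    have := b.sum_sq_norm_inner_right (u t)
    simp only [Real.norm_eq_abs, sq_abs] at this
    rw [this, hu, one_pow]
  have huT : ∀ t, ∑ i ∈ T, inner ℝ (b i) (u t) ^ 2 ≤ K * x := fun t => by
    rw [← hb.card_top, ← nsmul_eq_mul]
    exact Finset.sum_le_card_nsmul _ _ _ (hx t)
  have hW : ∀ t, ‖coordPart b Tᶜ (X t)‖ ^ 2 ≤ B ^ 2 := fun t => by
    have h1 : 1 / δ = ∑ i, 1 / δ * inner ℝ (b i) (u t) ^ 2 := by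
      rw [← Finset.mul_sum, hun, mul_one]
    rw [hpart, hB2, h1]
    refine (Finset.sum_le_sum fun i hi => mul_le_mul_of_nonneg_right
      (hb.bulk i (Finset.mem_compl.1 hi)).2 (sq_nonneg _)).trans ?_
    exact Finset.sum_le_sum_of_subset_of_nonneg (Finset.subset_univ _) fun i _ _ => by positivity
  have hWl : ∀ t, 3 * δ / 4 ≤ ‖coordPart b Tᶜ (X t)‖ ^ 2 := fun t => by
    have h1 : δ * ∑ i ∈ Tᶜ, inner ℝ (b i) (u t) ^ 2 ≤ ‖coordPart b Tᶜ (X t)‖ ^ 2 := by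
      rw [hpart, Finset.mul_sum]
      exact Finset.sum_le_sum fun i _ => mul_le_mul_of_nonneg_right
        (hb.le_eigenvalue hδ i) (sq_nonneg _)
    have h2 := Finset.sum_compl_add_sum T fun i => inner ℝ (b i) (u t) ^ 2
    rw [hun] at h2
    have h3 : 3 / 4 ≤ ∑ i ∈ Tᶜ, inner ℝ (b i) (u t) ^ 2 := by linarith [huT t]
    nlinarith
  have hT : ∀ t, √(leakage b T G) * ‖coordPart b T (X t)‖ + ‖z t‖ ≤ 2 * θ := fun t => by
    have h1 : √(leakage b T G) * ‖coordPart b T (X t)‖ ≤ θ := by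
      refine abs_le_of_sq_le_sq' ?_ hθ0 |>.2
      rw [mul_pow, Real.sq_sqrt (leakage_nonneg _ _ _), hθ2, hpart]
      refine le_trans (mul_le_mul hh ?_ (Finset.sum_nonneg fun i _ =>
        mul_nonneg (hl i) (sq_nonneg _)) ((leakage_nonneg _ _ _).trans hh)) hxA
      rw [mul_left_comm]
      refine (Finset.sum_le_sum fun i hi => mul_le_mul_of_nonneg_right (hb.top i hi).2
        (sq_nonneg _)).trans ?_
      rw [← Finset.mul_sum]
      exact mul_le_mul_of_nonneg_left (huT t) (by positivity)
    linarith [hzn t]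
  set D := θ * (B + 2) ^ 2 with hD
  have hdW : ∀ t, |projNorm Q (X t + z t) ^ 2 - ‖coordPart b Tᶜ (X t)‖ ^ 2| ≤ D := fun t => by
    refine (abs_projNorm_sq_sub_le hK hb.card_top hG hQ (X t) (z t)
      (abs_le_of_sq_le_sq' (hW t) hB0).2 hh (hT t)).trans ?_
    have h1 : h ≤ θ := hhA.trans (by rw [← hθ2]; nlinarith)
    have h2 : h * B ^ 2 ≤ θ * B ^ 2 := mul_le_mul_of_nonneg_right h1 (sq_nonneg _)
    rw [hD]
    nlinarith
  have hd : ∀ t, δ / 2 ≤ projNorm Q (X t + z t) ^ 2 := fun t => by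
    have := (abs_le.1 (hdW t)).1
    linarith [hWl t]
  have hdpos : ∀ t, 0 < projNorm Q (X t + z t) := fun t => by
    have h1 := hd t
    have h2 := projNorm_nonneg Q (X t + z t)
    rcases h2.eq_or_lt with h3 | h3
    · rw [← h3] at h1; norm_num at h1; linarith
    · exact h3
  have hdr : ∀ t, projNorm Q (X t + z t) ^ 2 ≤ ‖X t + z t‖ ^ 2 := fun t =>
    pow_le_pow_left₀ (projNorm_nonneg _ _) (projNorm_le_norm hK hG hQ _) 2
  have hscale := ipsnScale_eq hp hξ0 hyx hdpos
  set q := 1 / (n : ℝ) * ∑ s, ‖X s + z s‖ ^ 2 / projNorm Q (X s + z s) ^ 2 with hq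
  have hq1 : 1 ≤ q := by
    have : ∑ s : Fin n, (1 : ℝ) ≤ ∑ s, ‖X s + z s‖ ^ 2 / projNorm Q (X s + z s) ^ 2 :=
      Finset.sum_le_sum fun s _ => (one_le_div (by have := hdpos s; positivity)).2 (hdr s)
    simp only [Finset.sum_const, Finset.card_univ, Fintype.card_fin, nsmul_eq_mul, mul_one] at this
    rw [hq, one_div, ← div_eq_inv_mul, le_div_iff₀ hn']
    linarith
  have hq0 : 0 < q := zero_lt_one.trans_le hq1
  constructor
  · intro t
    rw [hscale]
    have h1 : √(δ / 2) ≤ projNorm Q (X t + z t) :=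
      Real.sqrt_le_iff.2 ⟨projNorm_nonneg _ _, hd t⟩
    have h2 : 1 ≤ √q := Real.one_le_sqrt.2 hq1
    have h3 : 0 < √(δ / 2) := Real.sqrt_pos.2 (by positivity)
    calc cξ * √(δ / 2) < ξ t * √(δ / 2) := mul_lt_mul_of_pos_right (hξ t) h3
      _ ≤ ξ t * projNorm Q (X t + z t) := mul_le_mul_of_nonneg_left h1 (hξ0 t).le
      _ ≤ ξ t * projNorm Q (X t + z t) * √q :=
          le_mul_of_one_le_right (mul_nonneg (hξ0 t).le (projNorm_nonneg _ _)) h2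
  · have h1 : ∀ t, ξ t ^ 2 / ipsnScale y m Q t ^ 2 = 1 / (projNorm Q (X t + z t) ^ 2 * q) :=
      fun t => by
        have h2 := (hξ0 t).ne'
        have h3 := (hdpos t).ne'
        rw [hscale, mul_pow, mul_pow, Real.sq_sqrt hq0.le]
        have h4 := hq0.ne'
        clear_value q
        field_simp
    simp only [h1]
    set A' := 27 * A + 2 * A * (B + 2) ^ 4 with hA'
    have hB4 : 0 ≤ A * (B + 2) ^ 4 := by positivity
    have hAA' : 27 * A * ρ ≤ A' * ρ := mul_le_mul_of_nonneg_right (by rw [hA']; linarith) hρ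
    have hr : ∀ t, |‖X t + z t‖ ^ 2 - ‖X t‖ ^ 2| ≤ θ * (‖X t‖ ^ 2 + 1) + θ ^ 2 := fun t =>
      abs_norm_add_sq_sub_le (X t) (hzn t)
    simp only [← hXn] at hmean hsq
    have hmean' := abs_le.1 (abs_le_of_sq_le_sq (hmean.trans hθ2.ge) hθ0)
    refine average_inv_mul_sub_one_sq_le (τ := (∑ i ∈ Tᶜ, l i) / p) (by positivity)
      (by rw [hA']; positivity) hd hdr ?_ ?_ ?_
    · have h2 : ∀ t, (projNorm Q (X t + z t) ^ 2 - (∑ i ∈ Tᶜ, l i) / p) ^ 2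
          ≤ 2 * (∑ i ∈ Tᶜ, l i * inner ℝ (b i) (u t) ^ 2 - (∑ i ∈ Tᶜ, l i) / p) ^ 2
            + 2 * D ^ 2 := fun t => by
        rw [← hpart]
        have h3 : (projNorm Q (X t + z t) ^ 2 - ‖coordPart b Tᶜ (X t)‖ ^ 2) ^ 2 ≤ D ^ 2 := by
          rw [← sq_abs]; exact pow_le_pow_left₀ (abs_nonneg _) (hdW t) 2
        set a := projNorm Q (X t + z t) ^ 2
        set e := ‖coordPart b Tᶜ (X t)‖ ^ 2
        set f := (∑ i ∈ Tᶜ, l i) / (p : ℝ)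
        linarith [sq_nonneg ((a - e) - (e - f)), h3]
      refine (mul_le_mul_of_nonneg_left (Finset.sum_le_sum fun t _ => h2 t)
        (by positivity)).trans ?_
      rw [Finset.sum_add_distrib, ← Finset.mul_sum, mul_add, mul_left_comm]
      have h4 : 1 / (n : ℝ) * ∑ _t : Fin n, 2 * D ^ 2 = 2 * (A * ρ) * (B + 2) ^ 4 := by
        simp only [Finset.sum_const, Finset.card_univ, Fintype.card_fin, nsmul_eq_mul]
        rw [hD, mul_pow, hθ2]
        field_simp
      rw [h4]
      have h5 : A' * ρ = 27 * (A * ρ) + 2 * (A * ρ) * (B + 2) ^ 4 := by rw [hA']; ring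
      linarith
    · have h2 : |1 / (n : ℝ) * ∑ t, ‖X t + z t‖ ^ 2 - 1 / (n : ℝ) * ∑ t, ‖X t‖ ^ 2|
          ≤ θ * (1 / (n : ℝ) * ∑ t, ‖X t‖ ^ 2 + 1) + θ ^ 2 := by
        rw [← mul_sub, ← Finset.sum_sub_distrib, abs_mul, abs_of_pos (by positivity)]
        refine (mul_le_mul_of_nonneg_left ((Finset.abs_sum_le_sum_abs _ _).trans
          (Finset.sum_le_sum fun t _ => hr t)) (by positivity)).trans (le_of_eq ?_)
        simp only [Finset.sum_add_distrib, ← Finset.mul_sum, Finset.sum_const, Finset.card_univ,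
          Fintype.card_fin, nsmul_eq_mul]
        field_simp
      have h3 := abs_le.1 h2
      set a := 1 / (n : ℝ) * ∑ t, ‖X t + z t‖ ^ 2
      set e := 1 / (n : ℝ) * ∑ t, ‖X t‖ ^ 2
      have h4 : θ * (e + 1) ≤ 3 * θ := by
        have : e + 1 ≤ 3 := by linarith [hmean'.2]
        rw [mul_comm 3]
        exact mul_le_mul_of_nonneg_left this hθ0
      have h5 : θ ^ 2 ≤ θ := by rw [sq]; exact mul_le_of_le_one_left hθ0 hθ1
      have h6 : |a - 1| ≤ 5 * θ := by
        rw [abs_le]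
        constructor <;> linarith [h3.1, h3.2, hmean'.1, hmean'.2]
      have h7 : (a - 1) ^ 2 ≤ (5 * θ) ^ 2 := by
        rw [← sq_abs]; exact pow_le_pow_left₀ (abs_nonneg _) h6 2
      rw [mul_pow, hθ2] at h7
      linarith
    · have h2 : ∀ t, (‖X t + z t‖ ^ 2) ^ 2 ≤ 8 * (‖X t‖ ^ 2) ^ 2 + 8 := fun t => by
        have h3 : ‖X t + z t‖ ^ 2 ≤ 2 * ‖X t‖ ^ 2 + 2 := by
          have h4 : ‖X t + z t‖ ≤ ‖X t‖ + 1 :=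
            (norm_add_le _ _).trans (by linarith [hzn t])
          have h5 := pow_le_pow_left₀ (norm_nonneg _) h4 2
          linarith [sq_nonneg (‖X t‖ - 1)]
        have h6 := pow_le_pow_left₀ (sq_nonneg _) h3 2
        linarith [sq_nonneg (‖X t‖ ^ 2 - 1)]
      refine (mul_le_mul_of_nonneg_left (Finset.sum_le_sum fun t _ => h2 t)
        (by positivity)).trans ?_
      rw [Finset.sum_add_distrib, ← Finset.mul_sum, mul_add, mul_left_comm]
      have h4 : 1 / (n : ℝ) * ∑ _t : Fin n, (8 : ℝ) = 8 := by
        simp only [Finset.sum_const, Finset.card_univ, Fintype.card_fin, nsmul_eq_mul]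
        field_simp
      rw [h4, hA']
      linarith

/-! ### The probability that a step fails -/

theorem measureReal_lt_le_of_integral_le {Ω : Type*} [MeasurableSpace Ω] {P : Measure Ω}
    [IsFiniteMeasure P] {f : Ω → ℝ} (hf : 0 ≤ f) (hint : Integrable f P) {M L : ℝ} (hM : 0 < M)
    (hL : 0 < L) (hle : ∫ ω, f ω ∂P ≤ M) : P.real {ω | L * M < f ω} ≤ 1 / L := by
  have h1 := mul_meas_ge_le_integral_of_nonneg (ae_of_all P hf) hint (L * M)
  have h2 : P.real {ω | L * M < f ω} ≤ P.real {ω | L * M ≤ f ω} :=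
    measureReal_mono (fun ω hω => by
      rw [Set.mem_ofPred_eq] at hω ⊢; exact le_of_lt hω) (measure_ne_top _ _)
  refine h2.trans ?_
  rw [le_div_iff₀ hL]
  have h3 : L * M * P.real {ω | L * M ≤ f ω} ≤ M := h1.trans hle
  have h4 : M * (P.real {ω | L * M ≤ f ω} * L) ≤ M * 1 := by linarith
  exact le_of_mul_le_mul_left h4 hM

namespace IsFactorBasis

variable {p K : ℕ} {R : Matrix (Fin p) (Fin p) ℝ} {δ : ℝ}
  {b : OrthonormalBasis (Fin p) ℝ (EuclideanSpace ℝ (Fin p))} {l : Fin p → ℝ} {T : Finset (Fin p)}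

theorem sum_bulk_sq_le (hb : IsFactorBasis R b l T K δ) (hδ : 0 < δ) :
    ∑ i ∈ Tᶜ, l i ^ 2 ≤ p / δ ^ 2 := by
  have h1 : ∑ i ∈ Tᶜ, l i ^ 2 ≤ ∑ _i ∈ Tᶜ, 1 / δ ^ 2 := Finset.sum_le_sum fun i hi => by
    have h2 := pow_le_pow_left₀ (hδ.le.trans (hb.le_eigenvalue hδ i))
      (hb.bulk i (Finset.mem_compl.1 hi)).2 2
    rwa [div_pow, one_pow] at h2
  refine h1.trans ?_
  rw [Finset.sum_const, nsmul_eq_mul, mul_one_div]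
  refine div_le_div_of_nonneg_right ?_ (by positivity)
  have := Finset.card_le_univ Tᶜ
  rw [Fintype.card_fin] at this
  exact_mod_cast this

theorem sum_sq_le (hb : IsFactorBasis R b l T K δ) (hδ : 0 < δ) :
    ∑ i, l i ^ 2 ≤ (K + 1) / δ ^ 2 * p ^ 2 := by
  rw [← Finset.sum_compl_add_sum T]
  have h1 : ∑ i ∈ T, l i ^ 2 ≤ K * (p / δ) ^ 2 := by
    rw [← hb.card_top, ← nsmul_eq_mul]
    exact Finset.sum_le_card_nsmul _ _ _ fun i hi =>
      pow_le_pow_left₀ (hδ.le.trans (hb.le_eigenvalue hδ i)) (hb.top i hi).2 2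
  have h2 := hb.sum_bulk_sq_le hδ
  have h3 : (p : ℝ) ≤ (p : ℝ) ^ 2 := by exact_mod_cast Nat.le_self_pow (by norm_num) p
  have h4 : (p : ℝ) / δ ^ 2 ≤ (p : ℝ) ^ 2 / δ ^ 2 := div_le_div_of_nonneg_right h3 (by positivity)
  have h5 : (K + 1) / δ ^ 2 * (p : ℝ) ^ 2 = K * (p / δ) ^ 2 + (p : ℝ) ^ 2 / δ ^ 2 := by
    field_simp
  linarith

end IsFactorBasis

namespace IsEllipticalDriver

variable {n p : ℕ} {Ω : Type*} [MeasurableSpace Ω] {P : Measure Ω}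
  {ξ : Fin n → Ω → ℝ} {u : Fin n → Ω → EuclideanSpace ℝ (Fin p)}

theorem integrable_direction [IsProbabilityMeasure P] (h : IsEllipticalDriver P ξ u) (t : Fin n)
    {f : EuclideanSpace ℝ (Fin p) → ℝ} (hf : Continuous f) :
    Integrable (fun ω => f (u t ω)) P := by
  have := isProbabilityMeasure_uniformSphere (h.dim_pos t)
  have h2 : Integrable f (uniformSphere p) := (isRotationInvariant_uniformSphere p).integrable hf
  rw [← h.direction_law t] at h2
  exact h2.comp_measurable (h.measurable_direction t)

variable {b : OrthonormalBasis (Fin p) ℝ (EuclideanSpace ℝ (Fin p))} {l : Fin p → ℝ}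

theorem integral_quadratic_sub_sq_le [IsProbabilityMeasure P] (h : IsEllipticalDriver P ξ u)
    (t : Fin n) (s : Finset (Fin p)) (hl : ∀ i, 0 ≤ l i) :
    ∫ ω, (∑ i ∈ s, l i * inner ℝ (b i) (u t ω) ^ 2 - (∑ i ∈ s, l i) / p) ^ 2 ∂P
      ≤ 3 * (∑ i ∈ s, l i ^ 2) / p ^ 2 := by
  have := isProbabilityMeasure_uniformSphere (h.dim_pos t)
  rw [h.integral_direction t
    (f := fun x => (∑ i ∈ s, l i * inner ℝ (b i) x ^ 2 - (∑ i ∈ s, l i) / p) ^ 2) (by fun_prop)]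
  exact (isRotationInvariant_uniformSphere p).integral_quadratic_sub_sq_le b s hl

theorem integral_average_quadratic_sub_sq_le [IsProbabilityMeasure P]
    (h : IsEllipticalDriver P ξ u) (s : Finset (Fin p)) (hl : ∀ i, 0 ≤ l i) :
    ∫ ω, 1 / (n : ℝ) * ∑ t, (∑ i ∈ s, l i * inner ℝ (b i) (u t ω) ^ 2 - (∑ i ∈ s, l i) / p) ^ 2 ∂P
      ≤ 3 * (∑ i ∈ s, l i ^ 2) / p ^ 2 := by
  have h0 : 0 ≤ 3 * (∑ i ∈ s, l i ^ 2) / (p : ℝ) ^ 2 := by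
    have : 0 ≤ ∑ i ∈ s, l i ^ 2 := Finset.sum_nonneg fun _ _ => sq_nonneg _
    positivity
  rw [integral_const_mul, integral_finsetSum _ fun t _ => h.integrable_direction t
    (f := fun x => (∑ i ∈ s, l i * inner ℝ (b i) x ^ 2 - (∑ i ∈ s, l i) / p) ^ 2) (by fun_prop)]
  have h1 : ∑ t : Fin n, ∫ ω, (∑ i ∈ s, l i * inner ℝ (b i) (u t ω) ^ 2 - (∑ i ∈ s, l i) / p) ^ 2 ∂P
      ≤ n * (3 * (∑ i ∈ s, l i ^ 2) / (p : ℝ) ^ 2) := by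
    refine (Finset.sum_le_sum fun t _ => h.integral_quadratic_sub_sq_le t s hl).trans ?_
    simp
  refine (mul_le_mul_of_nonneg_left h1 (by positivity)).trans ?_
  rw [← mul_assoc, one_div]
  exact mul_le_of_le_one_left h0 (inv_mul_le_one (a := (n : ℝ)))

/-- The averages over independent directions gain the factor `1 / n`. -/
theorem integral_average_sub_one_sq_le [IsProbabilityMeasure P] (h : IsEllipticalDriver P ξ u)
    (hn : 0 < n) (hl : ∀ i, 0 ≤ l i) (hsum : ∑ i, l i = p) :
    ∫ ω, (1 / (n : ℝ) * ∑ t, ∑ i, l i * inner ℝ (b i) (u t ω) ^ 2 - 1) ^ 2 ∂P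
      ≤ 3 * (∑ i, l i ^ 2) / p ^ 2 / n := by
  have hn' : (0 : ℝ) < n := by exact_mod_cast hn
  have hp' : (p : ℝ) ≠ 0 := by exact_mod_cast (h.dim_pos ⟨0, hn⟩).ne'
  have := isProbabilityMeasure_uniformSphere (h.dim_pos ⟨0, hn⟩)
  set f : EuclideanSpace ℝ (Fin p) → ℝ := fun x => ∑ i, l i * inner ℝ (b i) x ^ 2 - 1 with hf
  have hfc : Continuous f := by fun_prop
  have h0 : ∀ t, ∫ ω, f (u t ω) ∂P = 0 := fun t => by
    have hν := isRotationInvariant_uniformSphere p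
    rw [h.integral_direction t hfc.measurable, hf,
      integral_sub (hν.integrable (by fun_prop)) (integrable_const _),
      integral_finsetSum _ fun i _ => hν.integrable (by fun_prop)]
    have : ∀ i, ∫ w, l i * inner ℝ (b i) w ^ 2 ∂(uniformSphere p) = l i / p := fun i => by
      rw [integral_const_mul, hν.integral_inner_sq (b.norm_eq_one i), mul_one_div]
    simp only [this]
    rw [← Finset.sum_div, hsum, div_self hp']
    simp
  have h2 : ∀ t, ∫ ω, f (u t ω) ^ 2 ∂P ≤ 3 * (∑ i, l i ^ 2) / p ^ 2 := fun t => by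
    have := h.integral_quadratic_sub_sq_le (b := b) t Finset.univ hl
    rwa [hsum, div_self hp'] at this
  have hst : ∀ s t, s ≠ t → ∫ ω, f (u s ω) * f (u t ω) ∂P = 0 := fun s t hst => by
    have hi : IndepFun (fun ω => f (u s ω)) (fun ω => f (u t ω)) P :=
      (h.direction_indep.indepFun hst).comp hfc.measurable hfc.measurable
    rw [hi.integral_fun_mul_eq_mul_integral
      (hfc.measurable.comp (h.measurable_direction s)).aestronglyMeasurable
      (hfc.measurable.comp (h.measurable_direction t)).aestronglyMeasurable, h0, zero_mul]
  have hi : ∀ s t, Integrable (fun ω => f (u s ω) * f (u t ω)) P := fun s t => by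
    obtain ⟨C, hC⟩ := (isCompact_closedBall (0 : EuclideanSpace ℝ (Fin p)) 1).exists_bound_of_continuousOn
      hfc.continuousOn
    refine Integrable.bdd_mul (c := C) (h.integrable_direction t hfc)
      (hfc.measurable.comp (h.measurable_direction s)).aestronglyMeasurable ?_
    filter_upwards [h.norm_direction s] with ω hω
    exact hC _ (by simp [hω])
  have h3 : ∀ ω, (1 / (n : ℝ) * ∑ t, ∑ i, l i * inner ℝ (b i) (u t ω) ^ 2 - 1) ^ 2
      = (1 / (n : ℝ)) ^ 2 * ∑ s, ∑ t, f (u s ω) * f (u t ω) := fun ω => by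
    rw [← Finset.sum_mul_sum, ← sq, ← mul_pow]
    congr 1
    simp only [hf, Finset.sum_sub_distrib, mul_sub]
    simp
    field_simp
  simp only [h3]
  rw [integral_const_mul, integral_finsetSum _ fun s _ => integrable_finsetSum _ fun t _ => hi s t]
  have h4 : ∀ s, ∫ ω, ∑ t, f (u s ω) * f (u t ω) ∂P ≤ 3 * (∑ i, l i ^ 2) / p ^ 2 := fun s => by
    rw [integral_finsetSum _ fun t _ => hi s t, Finset.sum_eq_single s
      (fun t _ hts => hst s t hts.symm) (by simp)]
    simpa only [sq] using h2 s
  have h5 := Finset.sum_le_sum fun s (_ : s ∈ Finset.univ) => h4 s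
  refine (mul_le_mul_of_nonneg_left h5 (sq_nonneg _)).trans (le_of_eq ?_)
  simp only [Finset.sum_const, Finset.card_univ, Fintype.card_fin, nsmul_eq_mul]
  field_simp

theorem integral_average_sq_le [IsProbabilityMeasure P] (h : IsEllipticalDriver P ξ u)
    (hp : 0 < p) (hl : ∀ i, 0 ≤ l i) (hsum : ∑ i, l i = p) :
    ∫ ω, 1 / (n : ℝ) * ∑ t, (∑ i, l i * inner ℝ (b i) (u t ω) ^ 2) ^ 2 ∂P
      ≤ 6 * (∑ i, l i ^ 2) / p ^ 2 + 2 := by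
  have hp' : (p : ℝ) ≠ 0 := by exact_mod_cast hp.ne'
  have h1 := h.integral_average_quadratic_sub_sq_le (b := b) Finset.univ hl
  rw [hsum, div_self hp'] at h1
  have hint : ∀ c : ℝ, Integrable (fun ω => 1 / (n : ℝ) *
      ∑ t, (∑ i, l i * inner ℝ (b i) (u t ω) ^ 2 - c) ^ 2) P := fun c =>
    (integrable_finsetSum _ fun t _ => h.integrable_direction t
      (f := fun x => (∑ i, l i * inner ℝ (b i) x ^ 2 - c) ^ 2) (by fun_prop)).const_mul _
  have hint0 := hint 0
  simp only [sub_zero] at hint0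
  have h2 : ∫ ω, 1 / (n : ℝ) * ∑ t, (∑ i, l i * inner ℝ (b i) (u t ω) ^ 2) ^ 2 ∂P
      ≤ ∫ ω, (2 * (1 / (n : ℝ) * ∑ t, (∑ i, l i * inner ℝ (b i) (u t ω) ^ 2 - 1) ^ 2) + 2) ∂P := by
    refine integral_mono hint0 (((hint 1).const_mul 2).add (integrable_const _)) fun ω => ?_
    simp only
    have h3 : ∀ t, (∑ i, l i * inner ℝ (b i) (u t ω) ^ 2) ^ 2
        ≤ 2 * (∑ i, l i * inner ℝ (b i) (u t ω) ^ 2 - 1) ^ 2 + 2 := fun t => by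
      nlinarith [sq_nonneg (∑ i, l i * inner ℝ (b i) (u t ω) ^ 2 - 2)]
    refine (mul_le_mul_of_nonneg_left (Finset.sum_le_sum fun t _ => h3 t)
      (by positivity)).trans ?_
    rw [Finset.sum_add_distrib, ← Finset.mul_sum, mul_add, mul_left_comm]
    have h4 : 1 / (n : ℝ) * ∑ _t : Fin n, (2 : ℝ) ≤ 2 := by
      simp only [Finset.sum_const, Finset.card_univ, Fintype.card_fin, nsmul_eq_mul]
      rw [← mul_assoc, one_div]
      exact mul_le_of_le_one_left (by norm_num) (inv_mul_le_one (a := (n : ℝ)))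
    linarith
  rw [integral_add ((hint 1).const_mul 2) (integrable_const _), integral_const_mul (2 : ℝ)] at h2
  simp only [integral_const, probReal_univ, smul_eq_mul, one_mul] at h2
  refine h2.trans ?_
  have : 6 * (∑ i, l i ^ 2) / (p : ℝ) ^ 2 = 2 * (3 * (∑ i, l i ^ 2) / (p : ℝ) ^ 2) := by ring
  rw [this]
  linarith

theorem measure_large_coordinate_le [IsProbabilityMeasure P] (h : IsEllipticalDriver P ξ u)
    (T : Finset (Fin p)) {x : ℝ} (hx : 0 ≤ x) :
    P.real {ω | ∃ t, ∃ i ∈ T, x < inner ℝ (b i) (u t ω) ^ 2}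
      ≤ n * T.card * (2 * Real.exp (-(p * x / 2))) := by
  have h1 : ∀ t i, P.real {ω | x < inner ℝ (b i) (u t ω) ^ 2} ≤ 2 * Real.exp (-(p * x / 2)) := by
    intro t i
    have := isProbabilityMeasure_uniformSphere (h.dim_pos t)
    have h2 := (isRotationInvariant_uniformSphere p).measureReal_le_abs_inner_le (b.norm_eq_one i)
      (Real.sqrt_nonneg x)
    rw [Real.sq_sqrt hx] at h2
    refine le_trans ?_ h2
    have hm : MeasurableSet {w : EuclideanSpace ℝ (Fin p) | √x ≤ |inner ℝ (b i) w|} :=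
      measurableSet_le measurable_const (by fun_prop)
    rw [← h.direction_law t, map_measureReal_apply (h.measurable_direction t) hm]
    refine measureReal_mono (fun ω hω => ?_) (measure_ne_top _ _)
    simp only [Set.mem_preimage, Set.mem_ofPred_eq] at hω ⊢
    exact (Real.sqrt_le_sqrt hω.le).trans (le_of_eq (Real.sqrt_sq_eq_abs _))
  have hsub : {ω | ∃ t, ∃ i ∈ T, x < inner ℝ (b i) (u t ω) ^ 2}
      = ⋃ t, ⋃ i ∈ T, {ω | x < inner ℝ (b i) (u t ω) ^ 2} := by
    ext ω; simp
  rw [hsub]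
  refine (measureReal_iUnion_fintype_le _).trans ?_
  have h3 : ∀ t, P.real (⋃ i ∈ T, {ω | x < inner ℝ (b i) (u t ω) ^ 2})
      ≤ T.card * (2 * Real.exp (-(p * x / 2))) := fun t => by
    refine (measureReal_biUnion_finset_le _ _).trans ?_
    rw [← nsmul_eq_mul]
    exact Finset.sum_le_card_nsmul _ _ _ fun i _ => h1 t i
  refine (Finset.sum_le_sum fun t _ => h3 t).trans (le_of_eq ?_)
  simp
  ring

end IsEllipticalDriver

namespace IsEllipticalDriver

variable {n p : ℕ} {Ω : Type*} [MeasurableSpace Ω] {P : Measure Ω} [IsProbabilityMeasure P]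
  {ξ : Fin n → Ω → ℝ} {u : Fin n → Ω → EuclideanSpace ℝ (Fin p)}

/-- With high probability the estimated factor space is close to the true one. -/
theorem measure_large_leakage_le (h : IsEllipticalDriver P ξ u) (hn : 2 ≤ n) (hp : 2 ≤ p)
    (hpos : ∀ t, ∀ᵐ ω ∂P, 0 < ξ t ω) {R : Matrix (Fin p) (Fin p) ℝ}
    {b : OrthonormalBasis (Fin p) ℝ (EuclideanSpace ℝ (Fin p))} {l : Fin p → ℝ}
    {T : Finset (Fin p)} {K : ℕ} {δ : ℝ} (hδ : 0 < δ) (hb : IsFactorBasis R b l T K δ)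
    {c : Fin p → ℝ} {y : Ω → Fin n → Fin p → ℝ}
    (hy : ∀ ω t, y ω t = ellipticalObs c R (ξ t ω) (u t ω))
    {G : Ω → Matrix (Fin p) (Fin K) ℝ}
    (hG : ∀ ω, IsLeadingEigenvectors (kendallTau_isHermitian (y ω)) (G ω))
    {L : ℝ} (hL : 0 < L) (hgap : 1 / (δ ^ 2 * p) ≤ δ / 24 / 4)
    (hLn : L * (16 / n) ≤ (δ / 24 / 2) ^ 2) :
    P.real {ω | K * (16 / (δ / 24) ^ 2 * (L * (16 / n))) < leakage b T (G ω)} ≤ 1 / L := by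
  have hn' : (0 : ℝ) < n := by exact_mod_cast (by omega : 0 < n)
  have hl : ∀ i, 0 ≤ l i := fun i => hδ.le.trans (hb.le_eigenvalue hδ i)
  obtain ⟨hint, hle⟩ := h.integral_sum_kendall_sub_mean_sq_le (b := b) hn hl
  set mean : Fin p → Fin p → ℝ := fun i j =>
    pairAverage (fun e => ∫ ω', kendallKernel b l i j (pairDiff ξ u e ω') ∂P) with hmean
  have hνp : ∀ e : Fin n × Fin n,
      IsProbabilityMeasure (P.map fun ω => ‖pairDiff ξ u e ω‖⁻¹ • pairDiff ξ u e ω) := fun e => by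
    have := h.measurable_pairDiff e
    exact Measure.isProbabilityMeasure_map (by fun_prop)
  have hoff : ∀ i j, i ≠ j → mean i j = 0 := fun i j hij => by
    have h1 : ∀ e : Fin n × Fin n, e.1 ≠ e.2 →
        ∫ ω', kendallKernel b l i j (pairDiff ξ u e ω') ∂P = 0 := fun e he => by
      rw [← h.integral_kendallKernel_pairDiff hp hpos he]
      exact integral_kendallKernel_of_ne (h.isRotationInvariant_map_pairDiff hp hpos he) hij
    exact le_antisymm (pairAverage_le hn fun e he => (h1 e he).le)
      (le_pairAverage hn fun e he => (h1 e he).ge)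
  have htop : ∀ i ∈ T, δ / 24 ≤ mean i i := fun i hi => le_pairAverage hn fun e he => by
    have := hνp e
    rw [← h.integral_kendallKernel_pairDiff hp hpos he]
    exact le_integral_kendallKernel_top (h.isRotationInvariant_map_pairDiff hp hpos he) hδ hb hi
  have hbulk : ∀ i ∉ T, mean i i ≤ δ / 24 / 4 := fun i hi => pairAverage_le hn fun e he => by
    have := hνp e
    rw [← h.integral_kendallKernel_pairDiff hp hpos he]
    exact (integral_kendallKernel_bulk_le (h.isRotationInvariant_map_pairDiff hp hpos he) hδ hb
      hi).trans hgap
  refine le_trans (measureReal_mono ?_ (measure_ne_top _ _))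
    (measureReal_lt_le_of_integral_le (fun ω => Finset.sum_nonneg fun i _ =>
      Finset.sum_nonneg fun j _ => sq_nonneg _) hint (by positivity) hL hle)
  intro ω hω
  rw [Set.mem_ofPred_eq] at hω ⊢
  by_contra! hsmall
  refine absurd (leakage_le (kendallTau_isHermitian (y ω)) b hb.card_top (by positivity) htop hbulk
    (le_trans (le_of_eq ?_) hsmall) hLn (hG ω)) (not_le.2 hω)
  refine Finset.sum_congr rfl fun i _ => Finset.sum_congr rfl fun j _ => ?_
  rw [entryIn_kendallTau hδ hb (hy ω)]
  congr 2
  split_ifs with hij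
  · rw [← hij]
  · exact (hoff i j hij).symm

/-- All the failure probabilities together, for one sample size and dimension. -/
theorem measure_inaccurate_le (h : IsEllipticalDriver P ξ u) (hn : 2 ≤ n) (hp : 2 ≤ p)
    {R S : Matrix (Fin p) (Fin p) ℝ} (hR : IsPSDSqrt R S)
    {b : OrthonormalBasis (Fin p) ℝ (EuclideanSpace ℝ (Fin p))} {l : Fin p → ℝ}
    {T : Finset (Fin p)} {K : ℕ} {δ : ℝ} (hδ : 0 < δ) (hb : IsFactorBasis R b l T K δ)
    (hK : K ≤ p) {c : Fin p → ℝ} {y : Ω → Fin n → Fin p → ℝ}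
    (hy : ∀ ω t, y ω t = ellipticalObs c R (ξ t ω) (u t ω))
    {H : ℝ} {m : Ω → Fin p → ℝ} {G : Ω → Matrix (Fin p) (Fin K) ℝ}
    {Q : Ω → Matrix (Fin (p - K)) (Fin p) ℝ}
    (hfit : ∀ ω, IsIPSNFit K H (y ω) (m ω) (G ω) (Q ω))
    {cξ : ℝ} (hcξ : 0 < cξ) (hξ : ∀ t, ∀ᵐ ω ∂P, cξ < ξ t ω)
    {s κ v : ℝ} (hH : 1 < H) (hs : 0 ≤ s) (hs1 : s ≤ 1) (hκ : 0 ≤ κ) (hκH : κ * H ≤ 1)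
    (hHv : 2 * v ≤ (H - 1) ^ 2) (hξ2 : ∀ t, Integrable (fun ω => ξ t ω ^ 2) P)
    (hv : ∀ t i, (∫ ω, ξ t ω ^ 2 ∂P) * S i i ≤ v)
    {L A ρ x : ℝ} (hL : 0 < L) (hgap : 1 / (δ ^ 2 * p) ≤ δ / 24 / 4)
    (hLn : L * (16 / n) ≤ (δ / 24 / 2) ^ 2) (hA : 1 ≤ A) (hρ : 0 ≤ ρ)
    (hsA : (s / cξ) ^ 2 ≤ A * ρ)
    (hhA : K * (16 / (δ / 24) ^ 2 * (L * (16 / n))) ≤ A * ρ)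
    (hx : 0 ≤ x) (hxK : K * x ≤ 1 / 4)
    (hxA : K * (16 / (δ / 24) ^ 2 * (L * (16 / n))) * (K * (p / δ * x)) ≤ A * ρ)
    (hbulkA : L * (3 / (δ ^ 2 * p)) ≤ A * ρ) (hmeanA : L * (3 * (K + 1) / δ ^ 2 / n) ≤ A * ρ)
    (hsqA : L * (6 * (K + 1) / δ ^ 2 + 2) ≤ A)
    (hρ1 : A * ρ ≤ 1) (hρδ : √(A * ρ) * (√(1 / δ) + 2) ^ 2 ≤ δ / 4) :
    P.real {ω | ¬((∀ t, cξ * √(δ / 2) < ipsnScale (y ω) (m ω) (Q ω) t) ∧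
      1 / (n : ℝ) * ∑ t, (ξ t ω ^ 2 / ipsnScale (y ω) (m ω) (Q ω) t ^ 2 - 1) ^ 2
        ≤ 2 / (δ / 2) ^ 2 * (2 * (27 * A + 2 * A * (√(1 / δ) + 2) ^ 4) ^ 2 / (δ / 2) ^ 2
          + 3 * (27 * A + 2 * A * (√(1 / δ) + 2) ^ 4)) * ρ)}
      ≤ 2 * p * Real.exp (n * (-(κ * s / 2) + κ ^ 2 * (2 * v + 2)))
        + n * K * (2 * Real.exp (-(p * x / 2))) + 4 / L := by
  have hn' : (0 : ℝ) < n := by exact_mod_cast (by omega : 0 < n)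
  have hp' : (0 : ℝ) < p := by exact_mod_cast (by omega : 0 < p)
  have hl : ∀ i, 0 ≤ l i := fun i => hδ.le.trans (hb.le_eigenvalue hδ i)
  have hpos : ∀ t, ∀ᵐ ω ∂P, 0 < ξ t ω := fun t => (hξ t).mono fun ω hω => hcξ.trans hω
  set h₀ : ℝ := K * (16 / (δ / 24) ^ 2 * (L * (16 / n))) with hh₀
  set N : Set Ω := {ω | ¬((∀ t, cξ < ξ t ω) ∧ ∀ t, ‖u t ω‖ = 1)} with hN
  set E₁ : Set Ω := {ω | ∃ i, s < |m ω i - c i|} with hE₁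
  set E₂ : Set Ω := {ω | h₀ < leakage b T (G ω)} with hE₂
  set E₃ : Set Ω := {ω | L * (3 / (δ ^ 2 * p)) < 1 / (n : ℝ) * ∑ t,
    (∑ i ∈ Tᶜ, l i * inner ℝ (b i) (u t ω) ^ 2 - (∑ i ∈ Tᶜ, l i) / p) ^ 2} with hE₃
  set E₄ : Set Ω := {ω | L * (3 * (K + 1) / δ ^ 2 / n) <
    (1 / (n : ℝ) * ∑ t, ∑ i, l i * inner ℝ (b i) (u t ω) ^ 2 - 1) ^ 2} with hE₄
  set E₅ : Set Ω := {ω | L * (6 * (K + 1) / δ ^ 2 + 2) <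
    1 / (n : ℝ) * ∑ t, (∑ i, l i * inner ℝ (b i) (u t ω) ^ 2) ^ 2} with hE₅
  set E₆ : Set Ω := {ω | ∃ t, ∃ i ∈ T, x < inner ℝ (b i) (u t ω) ^ 2} with hE₆
  have hPN : P.real N = 0 := by
    have h1 : ∀ᵐ ω ∂P, (∀ t, cξ < ξ t ω) ∧ ∀ t, ‖u t ω‖ = 1 :=
      (ae_all_iff.2 hξ).and (ae_all_iff.2 h.norm_direction)
    rw [measureReal_def, ae_iff.1 h1]; rfl
  have hP1 := h.measure_huber_deviation_le hR hy (fun ω => (hfit ω).location) hH hs hs1 hκ hκH hHv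
    hξ2 hv
  have hP2 := h.measure_large_leakage_le hn hp hpos hδ hb hy (fun ω => (hfit ω).leading) hL hgap hLn
  have hsq := hb.sum_sq_le hδ
  have hsq' : (∑ i, l i ^ 2) / (p : ℝ) ^ 2 ≤ (K + 1) / δ ^ 2 := by
    rwa [div_le_iff₀ (by positivity)]
  have hP3 : P.real E₃ ≤ 1 / L := by
    refine measureReal_lt_le_of_integral_le
      (f := fun ω => 1 / (n : ℝ) * ∑ t, (∑ i ∈ Tᶜ, l i * inner ℝ (b i) (u t ω) ^ 2
        - (∑ i ∈ Tᶜ, l i) / p) ^ 2) (fun ω => ?_) ?_ (by positivity) hL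
      ((h.integral_average_quadratic_sub_sq_le Tᶜ hl).trans ?_)
    · exact mul_nonneg (by positivity) (Finset.sum_nonneg fun _ _ => sq_nonneg _)
    · exact (integrable_finsetSum _ fun t _ => h.integrable_direction t
        (f := fun w => (∑ i ∈ Tᶜ, l i * inner ℝ (b i) w ^ 2 - (∑ i ∈ Tᶜ, l i) / p) ^ 2)
        (by fun_prop)).const_mul _
    · have h1 := hb.sum_bulk_sq_le hδ
      rw [div_le_div_iff₀ (by positivity) (by positivity)]
      rw [le_div_iff₀ (by positivity)] at h1
      nlinarith
  have hP4 : P.real E₄ ≤ 1 / L := by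
    refine measureReal_lt_le_of_integral_le
      (f := fun ω => (1 / (n : ℝ) * ∑ t, ∑ i, l i * inner ℝ (b i) (u t ω) ^ 2 - 1) ^ 2)
      (fun ω => sq_nonneg _) ?_ (by positivity) hL
      ((h.integral_average_sub_one_sq_le (by omega) hl hb.sum_eq).trans ?_)
    · obtain ⟨C, hC⟩ := (isCompact_closedBall (0 : EuclideanSpace ℝ (Fin p)) 1).exists_bound_of_continuousOn
        (f := fun w => ∑ i, l i * inner ℝ (b i) w ^ 2) (by fun_prop)
      have hm : Measurable fun ω =>
          (1 / (n : ℝ) * ∑ t, ∑ i, l i * inner ℝ (b i) (u t ω) ^ 2 - 1) ^ 2 := by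
        have := h.measurable_direction
        fun_prop
      refine Integrable.of_bound (C := (C + 1) ^ 2) hm.aestronglyMeasurable ?_
      filter_upwards [ae_all_iff.2 h.norm_direction] with ω hω
      rw [Real.norm_eq_abs, abs_of_nonneg (sq_nonneg _), ← sq_abs]
      refine pow_le_pow_left₀ (abs_nonneg _) ((abs_sub _ _).trans ?_) 2
      rw [abs_one, abs_mul, abs_of_pos (by positivity)]
      have h1 : |∑ t, ∑ i, l i * inner ℝ (b i) (u t ω) ^ 2| ≤ n * C := by
        refine (Finset.abs_sum_le_sum_abs _ _).trans ?_
        refine (Finset.sum_le_sum fun t _ => hC (u t ω) (by simp [hω])).trans ?_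
        simp
      have h2 := mul_le_mul_of_nonneg_left h1 (show 0 ≤ 1 / (n : ℝ) by positivity)
      have h3 : 1 / (n : ℝ) * (n * C) = C := by field_simp
      linarith
    · refine div_le_div_of_nonneg_right ?_ hn'.le
      rw [mul_div_assoc, mul_div_assoc]
      linarith
  have hP5 : P.real E₅ ≤ 1 / L := by
    refine measureReal_lt_le_of_integral_le
      (f := fun ω => 1 / (n : ℝ) * ∑ t, (∑ i, l i * inner ℝ (b i) (u t ω) ^ 2) ^ 2)
      (fun ω => ?_) ?_ (by positivity) hL
      ((h.integral_average_sq_le (by omega) hl hb.sum_eq).trans ?_)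
    · exact mul_nonneg (by positivity) (Finset.sum_nonneg fun _ _ => sq_nonneg _)
    · exact (integrable_finsetSum _ fun t _ => h.integrable_direction t
        (f := fun w => (∑ i, l i * inner ℝ (b i) w ^ 2) ^ 2) (by fun_prop)).const_mul _
    · rw [mul_div_assoc, mul_div_assoc]
      linarith
  have hP6 := h.measure_large_coordinate_le (b := b) T hx
  rw [hb.card_top] at hP6
  have hsub : {ω | ¬((∀ t, cξ * √(δ / 2) < ipsnScale (y ω) (m ω) (Q ω) t) ∧
      1 / (n : ℝ) * ∑ t, (ξ t ω ^ 2 / ipsnScale (y ω) (m ω) (Q ω) t ^ 2 - 1) ^ 2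
        ≤ 2 / (δ / 2) ^ 2 * (2 * (27 * A + 2 * A * (√(1 / δ) + 2) ^ 4) ^ 2 / (δ / 2) ^ 2
          + 3 * (27 * A + 2 * A * (√(1 / δ) + 2) ^ 4)) * ρ)}
      ⊆ N ∪ (E₁ ∪ (E₂ ∪ (E₃ ∪ (E₄ ∪ (E₅ ∪ E₆))))) := by
    intro ω hω
    by_contra hgood
    simp only [Set.mem_union, not_or, hN, hE₁, hE₂, hE₃, hE₄, hE₅, hE₆, Set.mem_ofPred_eq,
      not_exists, not_lt, not_and] at hgood
    obtain ⟨hgN, hg1, hg2, hg3, hg4, hg5, hg6⟩ := hgood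
    have hg0 : (∀ t, cξ < ξ t ω) ∧ ∀ t, ‖u t ω‖ = 1 := by_contra fun h0 =>
      hgN fun ha hb => h0 ⟨ha, hb⟩
    exact hω (ipsnScale_bounds hδ hb (by omega) (by omega) hK (hfit ω).leading.1 (hfit ω).null
      (hy ω) hg0.2 hcξ hg0.1 hA hρ hg1 hsA hg2 hhA hg6 hxK hxA (hg3.trans hbulkA)
      (hg4.trans hmeanA) (hg5.trans hsqA) hρ1 hρδ)
  refine (measureReal_mono hsub (measure_ne_top _ _)).trans ?_
  have hu1 := measureReal_union_le (μ := P) N (E₁ ∪ (E₂ ∪ (E₃ ∪ (E₄ ∪ (E₅ ∪ E₆)))))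
  have hu2 := measureReal_union_le (μ := P) E₁ (E₂ ∪ (E₃ ∪ (E₄ ∪ (E₅ ∪ E₆))))
  have hu3 := measureReal_union_le (μ := P) E₂ (E₃ ∪ (E₄ ∪ (E₅ ∪ E₆)))
  have hu4 := measureReal_union_le (μ := P) E₃ (E₄ ∪ (E₅ ∪ E₆))
  have hu5 := measureReal_union_le (μ := P) E₄ (E₅ ∪ E₆)
  have hu6 := measureReal_union_le (μ := P) E₅ E₆
  have h4L : 4 / L = 1 / L + 1 / L + 1 / L + 1 / L := by ring
  linarith

end IsEllipticalDriver

/-! ### Asymptotics -/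

/-- A moment of order above two controls the second moment, by `x² ≤ 1 + x ^ (2 + ε)`. -/
theorem integral_sq_le_of_integral_rpow_lt {Ω : Type*} [MeasurableSpace Ω] {P : Measure Ω}
    [IsProbabilityMeasure P] {X : Ω → ℝ} {ε C : ℝ} (hε : 0 < ε) (hX : Measurable X)
    (h0 : ∀ᵐ ω ∂P, 0 ≤ X ω) (hint : Integrable (fun ω => X ω ^ (2 + ε)) P)
    (hC : ∫ ω, X ω ^ (2 + ε) ∂P < C) :
    Integrable (fun ω => X ω ^ 2) P ∧ ∫ ω, X ω ^ 2 ∂P ≤ 1 + C := by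
  have h1 : ∀ᵐ ω ∂P, X ω ^ 2 ≤ 1 + X ω ^ (2 + ε) := by
    filter_upwards [h0] with ω hω
    rcases le_total (X ω) 1 with h2 | h2
    · have h3 := Real.rpow_nonneg hω (2 + ε)
      have h4 := pow_le_one₀ (n := 2) hω h2
      linarith
    · have h3 : X ω ^ (2 : ℝ) ≤ X ω ^ (2 + ε) := Real.rpow_le_rpow_of_exponent_le h2 (by linarith)
      rw [Real.rpow_two] at h3
      linarith
  have h2 : Integrable (fun ω => 1 + X ω ^ (2 + ε)) P := (integrable_const 1).add hint
  have h3 : Integrable (fun ω => X ω ^ 2) P := by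
    refine h2.mono' (hX.pow_const 2).aestronglyMeasurable ?_
    filter_upwards [h1] with ω hω
    rwa [Real.norm_eq_abs, abs_of_nonneg (sq_nonneg _)]
  refine ⟨h3, (integral_mono_ae h3 h2 h1).trans ?_⟩
  rw [integral_add (integrable_const 1) hint]
  simp only [integral_const, probReal_univ, smul_eq_mul, one_mul]
  linarith

theorem tendsto_measure_zero_of_real {Ω : ℕ → Type*} [∀ k, MeasurableSpace (Ω k)]
    {P : ∀ k, Measure (Ω k)} [∀ k, IsProbabilityMeasure (P k)] {B : ∀ k, Set (Ω k)}
    (h : ∀ η : ℝ, 0 < η → ∀ᶠ k in atTop, (P k).real (B k) ≤ η) :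
    Tendsto (fun k => P k (B k)) atTop (𝓝 0) := by
  rw [ENNReal.tendsto_nhds_zero]
  intro ε hε
  have h1 : min ε 1 ≠ ⊤ := ne_top_of_le_ne_top ENNReal.one_ne_top (min_le_right _ _)
  have h2 : 0 < (min ε 1).toReal := ENNReal.toReal_pos (by simp [hε.ne']) h1
  filter_upwards [h _ h2] with k hk
  refine le_trans ?_ (min_le_left ε 1)
  rw [← ENNReal.ofReal_toReal h1]
  exact ENNReal.le_ofReal_iff_toReal_le (measure_ne_top _ _) h2.le |>.2 hk

section Growth

variable {n p : ℕ → ℕ}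

theorem tendsto_log_div_of_isLittleO {γ : ℝ} (hγ : 0 < γ) (hp : Tendsto p atTop atTop)
    (hlogp : (fun k => Real.log (p k) ^ (2 + γ)) =o[atTop] (fun k => (n k : ℝ))) :
    Tendsto (fun k => Real.log (p k) / n k) atTop (𝓝 0) := by
  have hl : Tendsto (fun k => Real.log (p k)) atTop atTop :=
    Real.tendsto_log_atTop.comp (tendsto_natCast_atTop_atTop.comp hp)
  refine IsLittleO.tendsto_div_nhds_zero (IsBigO.trans_isLittleO ?_ hlogp)
  refine IsBigO.of_bound 1 ?_
  filter_upwards [hl.eventually_ge_atTop 1] with k hk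
  rw [one_mul, Real.norm_eq_abs, Real.norm_eq_abs, abs_of_nonneg (by linarith),
    abs_of_nonneg (Real.rpow_nonneg (by linarith) _)]
  calc Real.log (p k) = Real.log (p k) ^ (1 : ℝ) := (Real.rpow_one _).symm
    _ ≤ _ := Real.rpow_le_rpow_of_exponent_le hk (by linarith)

theorem tendsto_log_div_self (hp : Tendsto p atTop atTop) :
    Tendsto (fun k => Real.log (p k) / p k) atTop (𝓝 0) :=
  (Real.isLittleO_log_id_atTop.tendsto_div_nhds_zero).comp (tendsto_natCast_atTop_atTop.comp hp)

end Growth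

set_option maxHeartbeats 800000 in
theorem proposition1
    -- the constants of the assumptions
    (cξ Cξ ε cσ Cσ δ γ : ℝ) (K : ℕ)
    (hcξ : 0 < cξ) (hCξ : cξ < Cξ) (hε : 0 < ε) (hε2 : ε < 2)
    (hcσ : 0 < cσ) (hCσ : cσ < Cσ) (hδ : 0 < δ) (hγ : 0 < γ)
    -- sample sizes and dimensions, both tending to infinity
    (n p : ℕ → ℕ)
    (hn : Tendsto n atTop atTop) (hp : Tendsto p atTop atTop)
    (hKp : ∀ k, K ≤ p k)
    (hlogp : (fun k => Real.log (p k) ^ (2 + γ)) =o[atTop] (fun k => (n k : ℝ)))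
    (hlogn : (fun k => Real.log (n k)) =O[atTop] (fun k => Real.log (p k)))
    -- location and scatter matrix, the latter normalised to trace `p`
    (μ : ∀ k, Fin (p k) → ℝ)
    (S R : ∀ k, Matrix (Fin (p k)) (Fin (p k)) ℝ)
    (hS : ∀ k, (S k).PosSemidef) (hR : ∀ k, IsPSDSqrt (R k) (S k))
    (htr : ∀ k, (S k).trace = p k)
    (hdiag : ∀ k i, cσ < S k i i ∧ S k i i < Cσ)
    (hfactor : ∀ k, HasFactorStructure (hS k).isHermitian K δ)
    -- the random scalars and directions
    (Ω : ℕ → Type*) [∀ k, MeasurableSpace (Ω k)]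
    (P : ∀ k, Measure (Ω k)) [∀ k, IsProbabilityMeasure (P k)]
    (ξ : ∀ k, Fin (n k) → Ω k → ℝ)
    (u : ∀ k, Fin (n k) → Ω k → EuclideanSpace ℝ (Fin (p k)))
    (hdriver : ∀ k, IsEllipticalDriver (P k) (ξ k) (u k))
    (hmoment : ∀ k t, Integrable (fun ω => ξ k t ω ^ (2 + ε)) (P k) ∧
      ∫ ω, ξ k t ω ^ (2 + ε) ∂(P k) < Cξ)
    (hlower : ∀ k t, ∀ᵐ ω ∂(P k), cξ < |ξ k t ω|)
    -- the observations
    (y : ∀ k, Ω k → Fin (n k) → Fin (p k) → ℝ)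
    (hy : ∀ k ω t, y k ω t = ellipticalObs (μ k) (R k) (ξ k t ω) (u k t ω))
    -- the tuning parameter, and any outcome of the location and projection steps
    (H : ℕ → ℝ) (hHpos : ∀ k, 0 < H k) (hH : Tendsto H atTop atTop)
    (hHO : H =O[atTop] (fun k => √((n k : ℝ) / Real.log (p k))))
    (m : ∀ k, Ω k → Fin (p k) → ℝ)
    (G : ∀ k, Ω k → Matrix (Fin (p k)) (Fin K) ℝ)
    (Q : ∀ k, Ω k → Matrix (Fin (p k - K)) (Fin (p k)) ℝ)
    (hfit : ∀ k ω, IsIPSNFit K (H k) (y k ω) (m k ω) (G k ω) (Q k ω)) :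
    (∃ c₁ : ℝ, 0 < c₁ ∧
      HighProbability P
        (fun k => {ω | ∀ t, c₁ < ipsnScale (y k ω) (m k ω) (Q k ω) t})) ∧
    IsBigOInProbability P
      (fun k ω => (1 / (n k : ℝ)) *
        ∑ t, (ξ k t ω ^ 2 / ipsnScale (y k ω) (m k ω) (Q k ω) t ^ 2 - 1) ^ 2)
      (fun k => Real.log (p k) / p k + Real.log (p k) / n k) := by
  have hl : Tendsto (fun k => Real.log (p k)) atTop atTop :=
    Real.tendsto_log_atTop.comp (tendsto_natCast_atTop_atTop.comp hp)
  have hn' : Tendsto (fun k => (n k : ℝ)) atTop atTop := tendsto_natCast_atTop_atTop.comp hn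
  have hp' : Tendsto (fun k => (p k : ℝ)) atTop atTop := tendsto_natCast_atTop_atTop.comp hp
  have hln := tendsto_log_div_of_isLittleO hγ hp hlogp
  have hlp := tendsto_log_div_self hp
  set ρ : ℕ → ℝ := fun k => Real.log (p k) / p k + Real.log (p k) / n k with hρdef
  have hρ0 : Tendsto ρ atTop (𝓝 0) := by simpa using hlp.add hln
  obtain ⟨a, ha, hHa⟩ := hHO.exists_pos
  obtain ⟨a', ha', hna⟩ := hlogn.exists_pos
  have hξ2 : ∀ k t, Integrable (fun ω => ξ k t ω ^ 2) (P k) ∧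
      ∫ ω, ξ k t ω ^ 2 ∂(P k) ≤ 1 + Cξ := fun k t =>
    integral_sq_le_of_integral_rpow_lt hε ((hdriver k).measurable_scalar t)
      ((hdriver k).scalar_nonneg t) (hmoment k t).1 (hmoment k t).2
  have hξlow : ∀ k t, ∀ᵐ ω ∂(P k), cξ < ξ k t ω := fun k t => by
    filter_upwards [hlower k t, (hdriver k).scalar_nonneg t] with ω h1 h2
    rwa [abs_of_nonneg h2] at h1
  set v : ℝ := (1 + Cξ) * Cσ with hv
  have hv0 : 0 ≤ v := mul_nonneg (by linarith) (by linarith)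
  -- the shift `C √(log p / n)` makes the Chernoff exponent equal to `-2 log p`
  set C : ℝ := 2 * a * ((1 / a) ^ 2 * (2 * v + 2) + 2) with hC
  have hC0 : 0 ≤ C := by positivity
  have key : ∀ η : ℝ, 0 < η → ∃ M : ℝ, 0 < M ∧ ∀ᶠ k in atTop,
      (P k).real {ω | ¬((∀ t, cξ * √(δ / 2) < ipsnScale (y k ω) (m k ω) (Q k ω) t) ∧
        1 / (n k : ℝ) * ∑ t, (ξ k t ω ^ 2 / ipsnScale (y k ω) (m k ω) (Q k ω) t ^ 2 - 1) ^ 2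
          ≤ M * ρ k)} ≤ η := by
    intro η hη
    -- four moment bounds fail with probability at most `1 / L` each, `η / 2` together
    set L : ℝ := 8 / η with hL
    have hL0 : 0 < L := by positivity
    set D : ℝ := K * (16 / (δ / 24) ^ 2 * (L * 16)) with hD
    have hD0 : 0 ≤ D := by positivity
    set A₁ : ℝ := (C / cξ) ^ 2 with hA₁
    set A₂ : ℝ := D * (K * (1 / δ * (2 * (a' + 1)))) with hA₂
    set A₃ : ℝ := L * (3 / δ ^ 2) with hA₃
    set A₄ : ℝ := L * (3 * (K + 1) / δ ^ 2) with hA₄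
    set A₅ : ℝ := L * (6 * (K + 1) / δ ^ 2 + 2) with hA₅
    have h₁ : 0 ≤ A₁ := by positivity
    have h₂ : 0 ≤ A₂ := by positivity
    have h₃ : 0 ≤ A₃ := by positivity
    have h₄ : 0 ≤ A₄ := by positivity
    have h₅ : 0 ≤ A₅ := by positivity
    -- `A` dominates the constants of all the error terms measured against `ρ`
    set A : ℝ := 1 + D + A₁ + A₂ + A₃ + A₄ + A₅ with hA
    have hA1 : 1 ≤ A := by linarith
    have hA0 : 0 < A := by linarith
    have hAρ : Tendsto (fun k => A * ρ k) atTop (𝓝 0) := by simpa using hρ0.const_mul A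
    have hinvp : Tendsto (fun k => ((p k : ℝ))⁻¹) atTop (𝓝 0) := tendsto_inv_atTop_zero.comp hp'
    have hinvn : Tendsto (fun k => ((n k : ℝ))⁻¹) atTop (𝓝 0) := tendsto_inv_atTop_zero.comp hn'
    refine ⟨2 / (δ / 2) ^ 2 * (2 * (27 * A + 2 * A * (√(1 / δ) + 2) ^ 4) ^ 2 / (δ / 2) ^ 2
          + 3 * (27 * A + 2 * A * (√(1 / δ) + 2) ^ 4)), by positivity, ?_⟩
    have e1 : ∀ᶠ k in atTop, C * √(Real.log (p k) / n k) ≤ 1 := by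
      have h1 : Tendsto (fun k => C * √(Real.log (p k) / n k)) atTop (𝓝 0) := by
        simpa using hln.sqrt.const_mul C
      exact h1.eventually_le_const (by norm_num)
    have e2 : ∀ᶠ k in atTop, 1 / (δ ^ 2 * p k) ≤ δ / 24 / 4 := by
      have h1 : Tendsto (fun k => 1 / δ ^ 2 * ((p k : ℝ))⁻¹) atTop (𝓝 0) := by
        have := hinvp.const_mul (1 / δ ^ 2)
        rwa [mul_zero] at this
      filter_upwards [h1.eventually_le_const (show 0 < δ / 24 / 4 by positivity)] with k hk
      rwa [one_div_mul_eq_div, ← one_div, div_div, mul_comm] at hk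
    have e3 : ∀ᶠ k in atTop, L * (16 / n k) ≤ (δ / 24 / 2) ^ 2 := by
      have h1 : Tendsto (fun k => L * (16 * ((n k : ℝ))⁻¹)) atTop (𝓝 0) := by
        simpa using (hinvn.const_mul 16).const_mul L
      exact h1.eventually_le_const (by positivity)
    have e4 : ∀ᶠ k in atTop, K * (2 * (a' + 1) * (Real.log (p k) / p k)) ≤ 1 / 4 := by
      have h1 : Tendsto (fun k => (K : ℝ) * (2 * (a' + 1) * (Real.log (p k) / p k))) atTop (𝓝 0) := by
        simpa using (hlp.const_mul (2 * (a' + 1))).const_mul (K : ℝ)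
      exact h1.eventually_le_const (by norm_num)
    have e5 : ∀ᶠ k in atTop, √(A * ρ k) * (√(1 / δ) + 2) ^ 2 ≤ δ / 4 := by
      have h1 : Tendsto (fun k => √(A * ρ k) * (√(1 / δ) + 2) ^ 2) atTop (𝓝 0) := by
        simpa using hAρ.sqrt.mul_const ((√(1 / δ) + 2) ^ 2)
      exact h1.eventually_le_const (by positivity)
    have e6 : ∀ᶠ k in atTop, (2 + 2 * K) * ((p k : ℝ))⁻¹ ≤ η / 2 := by
      have h1 : Tendsto (fun k => (2 + 2 * (K : ℝ)) * ((p k : ℝ))⁻¹) atTop (𝓝 0) := by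
        simpa using hinvp.const_mul (2 + 2 * (K : ℝ))
      exact h1.eventually_le_const (by positivity)
    filter_upwards [e1, e2, e3, e4, e5, e6, hAρ.eventually_le_const zero_lt_one,
      hn.eventually_ge_atTop 2, hp.eventually_ge_atTop 2, hl.eventually_ge_atTop 1,
      hH.eventually_ge_atTop (2 + 2 * v), hHa.bound, hna.bound] with k f1 f2 f3 f4 f5 f6 f7 f8 f9
      f10 f11 f12 f13
    have hnk : (0 : ℝ) < n k := by exact_mod_cast (by omega : 0 < n k)
    have hpk : (0 : ℝ) < p k := by exact_mod_cast (by omega : 0 < p k)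
    set ℓ := Real.log (p k) with hℓ
    have hℓ0 : 0 < ℓ := by linarith
    have hexp : Real.exp ℓ = p k := Real.exp_log hpk
    set w := √(ℓ / n k) with hw
    have hw0 : 0 < w := Real.sqrt_pos.2 (by positivity)
    have hw2 : w ^ 2 = ℓ / n k := Real.sq_sqrt (by positivity)
    have hH' : H k ≤ a * w⁻¹ := by
      rw [Real.norm_eq_abs, Real.norm_eq_abs, abs_of_pos (hHpos k),
        abs_of_nonneg (Real.sqrt_nonneg _)] at f12
      rwa [hw, ← Real.sqrt_inv, inv_div]
    have hlogn' : Real.log (n k) ≤ a' * ℓ := by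
      rw [Real.norm_eq_abs, Real.norm_eq_abs, abs_of_pos hℓ0] at f13
      exact (le_abs_self _).trans f13
    have hρk : ρ k = ℓ / p k + ℓ / n k := rfl
    have hρn : ℓ / n k ≤ ρ k := by rw [hρk]; have : 0 ≤ ℓ / p k := by positivity
                                   linarith
    have hρp : ℓ / p k ≤ ρ k := by rw [hρk]; have : 0 ≤ ℓ / n k := by positivity
                                   linarith
    have hρ1n : 1 / (n k : ℝ) ≤ ρ k := (div_le_div_of_nonneg_right f10 hnk.le).trans hρn
    have hρ1p : 1 / (p k : ℝ) ≤ ρ k := (div_le_div_of_nonneg_right f10 hpk.le).trans hρp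
    have hρk0 : 0 ≤ ρ k := le_trans (by positivity) hρn
    have hmul : ∀ B z : ℝ, 0 ≤ B → B ≤ A → z ≤ ρ k → B * z ≤ A * ρ k := fun B z h0 h1 h2 =>
      (mul_le_mul_of_nonneg_left h2 h0).trans (mul_le_mul_of_nonneg_right h1 hρk0)
    have hκH : 1 / a * w * H k ≤ 1 := by
      refine (mul_le_mul_of_nonneg_left hH' (by positivity)).trans_eq ?_
      field_simp
    have hHv : 2 * v ≤ (H k - 1) ^ 2 := by
      rw [sq]
      have h1 : H k - 1 ≤ (H k - 1) * (H k - 1) := le_mul_of_one_le_left (by linarith) (by linarith)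
      linarith
    obtain ⟨b, l, T, hb⟩ := exists_isFactorBasis hδ (hS k) (hR k) (htr k) (hKp k) (hfactor k)
    -- `n ≤ p ^ a'`, so this `x` bounds all the `n K` squared top coordinates except with
    -- probability at most `2 K / p`
    have hmain := (hdriver k).measure_inaccurate_le f8 f9 (hR k) hδ hb (hKp k) (hy k) (hfit k)
      hcξ (hξlow k) (s := C * w) (κ := 1 / a * w) (v := v) (by linarith) (by positivity) f1
      (by positivity) ?_ ?_ (fun t => (hξ2 k t).1) ?_ (L := L) (A := A) (ρ := ρ k)
      (x := 2 * (a' + 1) * (ℓ / p k)) hL0 f2 f3 hA1 hρk0 ?_ ?_ (by positivity) f4 ?_ ?_ ?_ ?_ f7 f5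
    · refine hmain.trans ?_
      have g1 : (n k : ℝ) * (-(1 / a * w * (C * w) / 2) + (1 / a * w) ^ 2 * (2 * v + 2))
          = -(2 * ℓ) := by
        have : (n k : ℝ) * (-(1 / a * w * (C * w) / 2) + (1 / a * w) ^ 2 * (2 * v + 2))
          = n k * w ^ 2 * (-(1 / a * C / 2) + (1 / a) ^ 2 * (2 * v + 2)) := by ring
        rw [this, hw2, hC]
        field_simp
        ring
      have g2 : 2 * (p k : ℝ) * Real.exp (-(2 * ℓ)) = 2 * (p k : ℝ)⁻¹ := by
        rw [show -(2 * ℓ) = -ℓ + -ℓ by ring, Real.exp_add, Real.exp_neg, hexp]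
        field_simp
      have g3 : (n k : ℝ) * K * (2 * Real.exp (-(p k * (2 * (a' + 1) * (ℓ / p k)) / 2)))
          ≤ 2 * K * (p k : ℝ)⁻¹ := by
        have : -(p k * (2 * (a' + 1) * (ℓ / p k)) / 2) = -(a' * ℓ) + -ℓ := by
          field_simp
          ring
        rw [this, Real.exp_add, Real.exp_neg ℓ, hexp]
        have h1 : (n k : ℝ) * Real.exp (-(a' * ℓ)) ≤ 1 := by
          calc (n k : ℝ) * Real.exp (-(a' * ℓ))
              = Real.exp (Real.log (n k) + -(a' * ℓ)) := by rw [Real.exp_add, Real.exp_log hnk]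
            _ ≤ 1 := Real.exp_le_one_iff.2 (by linarith)
        have h2 : (n k : ℝ) * K * (2 * (Real.exp (-(a' * ℓ)) * (p k : ℝ)⁻¹))
          = (n k * Real.exp (-(a' * ℓ))) * (2 * K * (p k : ℝ)⁻¹) := by ring
        rw [h2]
        exact mul_le_of_le_one_left (by positivity) h1
      have g4 : 4 / L = η / 2 := by rw [hL]; field_simp; norm_num
      rw [g1, g2, g4]
      linarith
    · exact hκH
    · exact hHv
    · intro t i
      refine mul_le_mul (hξ2 k t).2 (hdiag k i).2.le (hcσ.trans (hdiag k i).1).le (by linarith)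
    · rw [mul_div_right_comm, mul_pow, hw2]
      exact hmul A₁ _ h₁ (by linarith) hρn
    · have : K * (16 / (δ / 24) ^ 2 * (L * (16 / (n k : ℝ)))) = D * (1 / n k) := by
        rw [hD]; ring
      rw [this]
      exact hmul D _ hD0 (by linarith) hρ1n
    · have : K * (16 / (δ / 24) ^ 2 * (L * (16 / (n k : ℝ)))) *
          (K * (p k / δ * (2 * (a' + 1) * (ℓ / p k)))) = A₂ * (ℓ / n k) := by
        rw [hA₂, hD]
        field_simp
      rw [this]
      exact hmul A₂ _ h₂ (by linarith) hρn
    · have : L * (3 / (δ ^ 2 * p k)) = A₃ * (1 / p k) := by rw [hA₃]; field_simp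
      rw [this]
      exact hmul A₃ _ h₃ (by linarith) hρ1p
    · have : L * (3 * (K + 1) / δ ^ 2 / n k) = A₄ * (1 / n k) := by rw [hA₄]; ring
      rw [this]
      exact hmul A₄ _ h₄ (by linarith) hρ1n
    · linarith
  constructor
  · refine ⟨cξ * √(δ / 2), mul_pos hcξ (Real.sqrt_pos.2 (by positivity)), ?_⟩
    refine tendsto_measure_zero_of_real fun η hη => ?_
    obtain ⟨M, -, hM⟩ := key η hη
    filter_upwards [hM] with k hk
    refine (measureReal_mono (fun ω hω => ?_) (measure_ne_top _ _)).trans hk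
    rw [Set.mem_compl_iff, Set.mem_ofPred_eq] at hω
    rw [Set.mem_ofPred_eq]
    exact fun h => hω h.1
  · intro η hη
    obtain ⟨M, hM0, hM⟩ := key η hη
    refine ⟨M, hM0, ?_⟩
    filter_upwards [hM] with k hk
    refine (ENNReal.le_ofReal_iff_toReal_le (measure_ne_top _ _) hη.le).2
      ((measureReal_mono (fun ω hω => ?_) (measure_ne_top _ _)).trans hk)
    rw [Set.mem_ofPred_eq] at hω ⊢
    rw [abs_of_nonneg (mul_nonneg (by positivity) (Finset.sum_nonneg fun _ _ => sq_nonneg _))] at hω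
    exact fun h => absurd h.2 (not_le.2 hω)
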